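/- Let $d,n\ge 0$ and let $(M,\pi)$ be a smooth (Hausdorff, second countable) Poisson manifold of dimension $2(d+1)+n$ that is regular of rank $d+1$, i.e. the bundle map $\sharp_\pi\colon T^*M\to TM$, $\sharp_\pi\eta=\pi(\cdot,\eta)$, has constant rank $2(d+1)$. For $H\in C^2(M)$ let $X_H=\sharp_\pi(dH)$ be its Hamiltonian vector field and $\varphi_H^t$ its (local) flow. Fix a countable locally finite family of smooth charts $\varphi_i\colon U_i\to\mathbb R^{2(d+1)+n}$ with closed sets $K_i\subset U_i$ covering $M$, and let $\|u\|_{C^2}=\sup_i\sup_{x\in K_i}\max_{m\le 2}\|D^m(u\circ\varphi_i^{-1})(\varphi_i(x))\|$. Let $H\in C^2(M)$, $p\in M$, $T>0$, and suppose that the orbit of $p$ is defined on $[0,T]$; put $\Gamma=\{\varphi_H^t(p):0\le t\le T\}$ and $p'=\varphi_H^T(p)$. Let $\mathcal E$ be the connected component of $H^{-1}(H(p))$ containing $p$ and $S$ the symplectic leaf through $p$. Let $\Sigma\ni p$ and $\Sigma'\ni p'$ be transversals, i.e. $2d$-dimensional $C^1$ submanifolds of $M$ contained in $\mathcal E\cap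 S$ with $T_p(\mathcal E\cap S)=T_p\Sigma\oplus\mathbb R X_H(p)$ and $T_{p'}(\mathcal E\cap S)=T_{p'}\Sigma'\oplus\mathbb R X_H(p')$, where $T_q(\mathcal E\cap S)=\operatorname{im}\sharp_\pi(q)\cap\ker dH(q)$ (so that $X_H(p)\ne0$). Assume that the Poincaré map $P_H\colon\Sigma\cap U\to\Sigma'$ is defined on $\Sigma\cap U$ for some neighbourhood $U$ of $p$: $P_H(x)=\varphi_H^{\tau(x)}(x)$, where $\tau(x)$ is the first positive time at which the orbit of $x$ meets $\Sigma'$, $\tau$ is $C^1$ on $\Sigma\cap U$, and $\tau(p)=T$. Fix symplectic bases of $T_p\Sigma$ and $T_{p'}\Sigma'$ for the symplectic form of the leaf, and use them to write derivatives at $p$ of maps from $\Sigma$ to $\Sigma'$ sending $p$ to $p'$ as $2d\times2d$ matrices. Then $P_H$ is differentiable at $p$, and for every $\varepsilon>0$ there is $\delta>0$ such that the following holds. Let $W\subset M$ be any set that is a neighbourhood of each point $\varphi_H^t(p)$, $0<t<T$ (for instance any tubular neighbourhood of $\Gamma$), and let $A\in\mathrm{Sp}(2d,\mathbb R)$ satisfy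 $\|A-I\|=\max_j\sum_i|(A-I)_{ij}|<\delta$. Then there is $H'\in C^2(M)$ with $\|H'-H\|_{C^2}<\varepsilon$ and $X_{H'}=X_H$ on $(M\setminus W)\cup\Gamma$, such that the Poincaré map $P_{H'}$ of $H'$ at $p$ between $\Sigma$ and $\Sigma'$ (with $P_{H'}(p)=p'$ and transition time $T$ at $p$) is defined near $p$ in the same sense, is differentiable at $p$, and $$D_pP_{H'}=A\,D_pP_H .$$ -/

import Mathlib

open Set Topology
open scoped Manifold ContDiff ENNReal

noncomputable section

namespace FranksPoisson

section General

variable (E : Type*) [NormedAddCommGroup E] [NormedSpace ℝ E]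
  (M : Type*) [TopologicalSpace M] [ChartedSpace E M]

variable {E M} in
/-- The differential `df(x)` of a function on `M`, as a covector at `x`. -/
def dAt (f : M → ℝ) (x : M) : TangentSpace 𝓘(ℝ, E) x →L[ℝ] ℝ :=
  mfderiv 𝓘(ℝ, E) 𝓘(ℝ, ℝ) f x

/-- A smooth Poisson structure on `M`. The bivector `π` is recorded through the bundle map
`♯ : T*M → TM`, `♯ η = π(·, η)`, so that `π(ξ, η) = ξ (♯ η)`. It is skew-symmetric, the bracket
`{f, g} = π(df, dg)` of smooth functions is smooth (smoothness of the bivector field), and the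
bracket satisfies the Jacobi identity, which is the equation `[π, π] = 0`. -/
structure PoissonStructure where
  sharp : ∀ x : M, (TangentSpace 𝓘(ℝ, E) x →L[ℝ] ℝ) →ₗ[ℝ] TangentSpace 𝓘(ℝ, E) x
  skew : ∀ (x : M) (ξ η : TangentSpace 𝓘(ℝ, E) x →L[ℝ] ℝ), ξ (sharp x η) = -η (sharp x ξ)
  smooth : ∀ f g : M → ℝ, ContMDiff 𝓘(ℝ, E) 𝓘(ℝ, ℝ) ∞ f → ContMDiff 𝓘(ℝ, E) 𝓘(ℝ, ℝ) ∞ g →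
    ContMDiff 𝓘(ℝ, E) 𝓘(ℝ, ℝ) ∞ (fun x => dAt (E := E) f x (sharp x (dAt (E := E) g x)))
  jacobi : ∀ f g h : M → ℝ, ContMDiff 𝓘(ℝ, E) 𝓘(ℝ, ℝ) ∞ f →
    ContMDiff 𝓘(ℝ, E) 𝓘(ℝ, ℝ) ∞ g → ContMDiff 𝓘(ℝ, E) 𝓘(ℝ, ℝ) ∞ h →
    ∀ x : M,
      dAt (E := E) f x (sharp x (dAt (E := E)
        (fun y => dAt (E := E) g y (sharp y (dAt (E := E) h y))) x)) +
      dAt (E := E) g x (sharp x (dAt (E := E)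
        (fun y => dAt (E := E) h y (sharp y (dAt (E := E) f y))) x)) +
      dAt (E := E) h x (sharp x (dAt (E := E)
        (fun y => dAt (E := E) f y (sharp y (dAt (E := E) g y))) x)) = 0

/-- A countable, locally finite family of smooth charts `chart i` of `M`, together with closed sets
`K i` inside the chart domains that cover `M`; it is used to measure `C²` norms on `M`. -/
structure NormAtlas where
  chart : ℕ → OpenPartialHomeomorph M E
  chart_mem : ∀ i, chart i ∈ IsManifold.maximalAtlas 𝓘(ℝ, E) ∞ M
  K : ℕ → Set M
  isClosed_K : ∀ i, IsClosed (K i)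
  K_subset : ∀ i, K i ⊆ (chart i).source
  locallyFinite : LocallyFinite K
  cover : ⋃ i, K i = univ

variable {E M}

/-- The (extended) `C²` norm of `u : M → ℝ`: the supremum over all charts `i` and points of `K i`
of the norms of the derivatives of order `0, 1, 2` of the coordinate expression of `u`. -/
def NormAtlas.c2norm (𝔄 : NormAtlas E M) (u : M → ℝ) : ℝ≥0∞ :=
  ⨆ i : ℕ, ⨆ x ∈ 𝔄.K i, ⨆ m ∈ Finset.range 3,
    ‖iteratedFDeriv ℝ m (u ∘ (𝔄.chart i).symm) (𝔄.chart i x)‖ₑ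

namespace PoissonStructure

variable (π : PoissonStructure E M)

/-- `π` is regular of rank `r`: the characteristic distribution `im ♯` has constant
dimension `2 r`. -/
def IsRegular (r : ℕ) : Prop :=
  ∀ x : M, Module.finrank ℝ (LinearMap.range (π.sharp x)) = 2 * r

/-- The Hamiltonian vector field `X_H = ♯ dH = π(·, dH)`. -/
def hamVF (H : M → ℝ) (x : M) : TangentSpace 𝓘(ℝ, E) x := π.sharp x (dAt (E := E) H x)

/-- `y` is the endpoint of an integral curve of a smooth Hamiltonian vector field starting
at `x`. -/
def HamStep (x y : M) : Prop :=
  ∃ (h : M → ℝ) (c : ℝ → M), ContMDiff 𝓘(ℝ, E) 𝓘(ℝ, ℝ) ∞ h ∧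
    IsMIntegralCurveOn (I := 𝓘(ℝ, E)) c (π.hamVF h) (Icc 0 1) ∧ c 0 = x ∧ c 1 = y

/-- The symplectic leaf through `p`: the points that can be joined to `p` by finitely many
successive integral curves of smooth Hamiltonian vector fields. -/
def leaf (p : M) : Set M := {q | Relation.ReflTransGen π.HamStep p q}

end PoissonStructure

/-- The energy surface of `H` through `p`: the connected component of `H⁻¹(H(p))` containing
`p`. -/
def energySurface (H : M → ℝ) (p : M) : Set M := connectedComponentIn (H ⁻¹' {H p}) p

/-- `N` is a `k`-dimensional (embedded) `C¹` submanifold of `M`: around each of its points there is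
a `C¹` chart of `M` in which `N` is a `k`-dimensional linear subspace. -/
def IsC1Submanifold (E : Type*) [NormedAddCommGroup E] [NormedSpace ℝ E]
    {M : Type*} [TopologicalSpace M] [ChartedSpace E M] (k : ℕ) (N : Set M) : Prop :=
  ∀ x ∈ N, ∃ e ∈ IsManifold.maximalAtlas 𝓘(ℝ, E) 1 M, x ∈ e.source ∧
    ∃ L : Submodule ℝ E, Module.finrank ℝ L = k ∧ e.source ∩ N = e.source ∩ e ⁻¹' (L : Set E)

/-- The tangent space `T_x N` of a `C¹` submanifold `N` at `x`: the (span of the) velocities at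
`x` of the `C¹` curves in `N` through `x`. -/
def tangentAt (N : Set M) (x : M) : Submodule ℝ (TangentSpace 𝓘(ℝ, E) x) :=
  Submodule.span ℝ {v | ∃ c : ℝ → M, ContMDiffAt 𝓘(ℝ, ℝ) 𝓘(ℝ, E) 1 c 0 ∧ c 0 = x ∧
    (∀ᶠ t in 𝓝 (0 : ℝ), c t ∈ N) ∧
    HasMFDerivAt 𝓘(ℝ, ℝ) 𝓘(ℝ, E) c 0 ((1 : ℝ →L[ℝ] ℝ).smulRight v)}

/-- `N` is a transversal to the Hamiltonian flow of `H` at `p` inside `𝓔 ∩ S`, where `𝓔` is the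
energy surface and `S` the symplectic leaf through `p`: a `2d`-dimensional submanifold contained
in `𝓔 ∩ S`, with `p ∈ N` and `T_p (𝓔 ∩ S) = T_p N ⊕ ℝ X_H(p)`. Here
`T_p (𝓔 ∩ S) = T_p S ∩ T_p 𝓔 = im ♯ ∩ ker dH(p)`. (When the rank is `d + 1`, counting
dimensions shows that such an `N` can only exist if `X_H(p) ≠ 0`.) -/
structure IsTransversal (π : PoissonStructure E M) (H : M → ℝ) (d : ℕ) (N : Set M) (p : M) :
    Prop where
  submanifold : IsC1Submanifold E (2 * d) N
  mem : p ∈ N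
  subset : N ⊆ energySurface H p ∩ π.leaf p
  sup_eq : tangentAt N p ⊔ Submodule.span ℝ {π.hamVF H p} =
    LinearMap.range (π.sharp p) ⊓ LinearMap.ker (dAt (E := E) H p).toLinearMap
  disjoint : Disjoint (tangentAt N p) (Submodule.span ℝ {π.hamVF H p})

/-- `P` is a Poincaré map of `H` at `p`, from the transversal `N` at `p` to the transversal `N'` at
`p'`, with `P p = p'` and transition time `T` at `p`. For the points `x` of `N` in some
neighbourhood `U` of `p` one has `P x = φ_H^{τ(x)}(x)`, where `τ` is `C¹` on `N ∩ U` and `τ(x)` is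
the first positive time at which the orbit of `x` meets `N'`. -/
def IsPoincareMap (π : PoissonStructure E M) (H : M → ℝ) (N N' : Set M) (p p' : M) (T : ℝ)
    (P : M → M) : Prop :=
  P p = p' ∧ ∃ U ∈ 𝓝 p, ∃ τ : M → ℝ, τ p = T ∧
    ContMDiffOn 𝓘(ℝ, E) 𝓘(ℝ, ℝ) 1 τ (N ∩ U) ∧
    ∀ x ∈ N ∩ U, 0 < τ x ∧ P x ∈ N' ∧
      ∃ c : ℝ → M, IsMIntegralCurveOn (I := 𝓘(ℝ, E)) c (π.hamVF H) (Icc 0 (τ x)) ∧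
        c 0 = x ∧ c (τ x) = P x ∧ ∀ t ∈ Ioo 0 (τ x), c t ∉ N'

/-- `b = (v_1, …, v_d, w_1, …, w_d)` is a symplectic basis of `T_p N`, for a submanifold `N` of a
symplectic leaf: a basis with `ω(v_i, w_j) = δ_{ij}` and `ω(v_i, v_j) = ω(w_i, w_j) = 0`. The
symplectic form of the leaf is `ω(♯ ξ, ♯ η) = π(ξ, η)`. -/
structure IsSymplecticBasis (π : PoissonStructure E M) {d : ℕ} (N : Set M) (p : M)
    (b : Fin d ⊕ Fin d → TangentSpace 𝓘(ℝ, E) p) : Prop where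
  linearIndependent : LinearIndependent ℝ b
  span_eq : Submodule.span ℝ (range b) = tangentAt N p
  symplectic : ∃ ξ : Fin d ⊕ Fin d → (TangentSpace 𝓘(ℝ, E) p →L[ℝ] ℝ),
    (∀ i, π.sharp p (ξ i) = b i) ∧
    ∀ i j, ξ i (π.sharp p (ξ j)) = Matrix.J (Fin d) ℝ j i

/-- `L` is the matrix, in the bases `b` of `T_p N` and `b'` of `T_{p'} N'`, of the derivative at
`p` of `P : N → N'`, where `P p = p'`. -/
def IsDerivMatrix {ι : Type*} [Fintype ι] (N : Set M) (P : M → M) {p p' : M}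
    (b : ι → TangentSpace 𝓘(ℝ, E) p) (b' : ι → TangentSpace 𝓘(ℝ, E) p')
    (L : Matrix ι ι ℝ) : Prop :=
  P p = p' ∧ ∃ Φ : TangentSpace 𝓘(ℝ, E) p →L[ℝ] TangentSpace 𝓘(ℝ, E) (P p),
    HasMFDerivWithinAt 𝓘(ℝ, E) 𝓘(ℝ, E) P N p Φ ∧
    ∀ j, (Φ (b j) : E) = (∑ i, L i j • b' i : TangentSpace 𝓘(ℝ, E) p')

end General

end FranksPoisson

end

open Set Topology
open scoped Manifold ContDiff ENNReal

noncomputable section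

set_option linter.unusedSectionVars false

/-! The Hamiltonian is changed only near a short arc of the orbit of `γ 0`, just after its start and
inside one chart. Let Φ and Φ' be the old and new flows in that chart and let the arc end before
time `c`. Follow Φ' for time `c`, then Φ backwards for time `c`, then slide along Φ onto `N`. This
gives a return map R of `N` to itself, and the new Poincaré map is P ∘ R
(`IsPoincareMap.comp_return`). If `L` is the matrix of DP and `Q` that of DR at the base point, the
task is to arrange L Q = A L, that is, Q = L⁻¹ A L. The matrix `L` is symplectic
(`IsPoincareMap.exists_isDerivMatrix`), so Q is symplectic and near the identity when A is. Hence Q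
= exp Z with Z small and Z J symmetric (`exists_small_log`).

To produce exp Z, take covectors ξ_i at the base point with ♯ ξ_i = b_i and transport them along the
flow. Let h vanish to first order along the arc and have second derivative a'(t) ∑ (Z J)_{ij} ξ_i(t)
ξ_j(t) there, where a rises from 0 to 1. The orbit does not move, since dh = 0 on it. By variation
of constants in the linearized equation, the derivative of the flow on the b_k picks up the factor
exp (a Z) (`IsLocalPoisson.fderiv_perturbed_flow`). This rests on the fact that Hamiltonian flows
preserve the Poisson tensor, which is the Jacobi identity integrated in time
(`IsLocalPoisson.fderiv_flow_sharp`).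

Two points about size and regularity matter. Since H is only C², the transported covectors are only
C¹ in time, and functions with these differentials along the arc are built from primitives in order
to be C² (`exists_function_of_differential`). Moreover δ may not depend on W, so h must fit in
arbitrarily thin tubes at bounded cost. A cutoff at scale r costs r⁻ᵐ in the m-th derivative, while
a product of two functions vanishing on the arc is of size r², so the C² norm stays bounded as r → 0
(`exists_uniform_cutoff`).

It remains to see that R maps `N` into `N` and that `N'` is not met too early. Constant rank gives
local C¹ Casimirs v whose differential has kernel im ♯ (`IsLocalPoisson.exists_casimirs`). A leaf
may return to a chart infinitely often, but it meets only countably many levels of v. A submanifold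
inside the leaf is locally connected, so v is constant on it near each point
(`PoissonStructure.countable_image_leaf`, `IsC1Submanifold.eventually_eq`). Thus near the base point
the joint level set of v and H consists of points that the flow slides onto `N`
(`IsTransversal.exists_section`). Both flows preserve v, and H returns to its old value once the
orbit has left the support of h. The same argument, applied at an intermediate time, would turn an
early visit to `N'` into an early visit of an old orbit, which is excluded. -/

namespace FranksPoisson

/-! ### Flows of compactly supported C¹ vector fields and their derivatives. -/

section Flow

open Filter

variable {F : Type*} [NormedAddCommGroup F] [NormedSpace ℝ F]

/-- Global solutions of a Lipschitz ODE exist once they exist on all bounded intervals. -/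
lemma exists_global_solution_of_local {f : ℝ → F → F} {K : NNReal}
    (hf : ∀ t, LipschitzWith K (f t)) (y₀ : F)
    (h : ∀ T : ℝ, 0 < T → ∃ y : ℝ → F, y 0 = y₀ ∧ ∀ t ∈ Ioo (-T) T, HasDerivAt y (f t (y t)) t) :
    ∃ y : ℝ → F, y 0 = y₀ ∧ ∀ t, HasDerivAt y (f t (y t)) t := by
  choose! y hy0 hy using h
  have hpos : ∀ t : ℝ, 0 < |t| + 1 := fun t => by positivity
  have key : ∀ T T' : ℝ, 0 < T → T ≤ T' → EqOn (y T) (y T') (Ioo (-T) T) := by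
    intro T T' hT hTT'
    refine ODE_solution_unique_of_mem_Ioo (v := f) (s := fun _ => univ) (t₀ := 0)
      (fun t _ => (hf t).lipschitzOnWith) ⟨by linarith, hT⟩
      (fun t ht => ⟨hy T hT t ht, mem_univ _⟩)
      (fun t ht => ⟨hy T' (by linarith) t ⟨by linarith [ht.1], by linarith [ht.2]⟩, mem_univ _⟩) ?_
    rw [hy0 T hT, hy0 T' (by linarith)]
  -- The value at t is taken from the solution on (-(|t| + 1), |t| + 1). Near t all these agree with
  -- the one solution of half-length |t| + 2, which can be differentiated.
  refine ⟨fun t => y (|t| + 1) t, by simp [hy0], fun t => ?_⟩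
  have h2 : HasDerivAt (y (|t| + 2)) (f t (y (|t| + 2) t)) t :=
    hy _ (by positivity) t ⟨by linarith [neg_abs_le t], by linarith [le_abs_self t]⟩
  have hag : ∀ s, |s| < |t| + 1 → y (|s| + 1) s = y (|t| + 2) s := by
    intro s hs
    exact key _ _ (hpos s) (by linarith) ⟨by linarith [neg_abs_le s], by linarith [le_abs_self s]⟩
  have h3 := hag t (by linarith)
  simp only
  rw [h3]
  refine h2.congr_of_eventuallyEq ?_
  have : ∀ᶠ s in 𝓝 t, |s| < |t| + 1 :=
    (continuous_abs.tendsto t).eventually (gt_mem_nhds (by linarith))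
  filter_upwards [this] with s hs using hag s hs

/-- A field bounded by B cannot carry `y₀` farther than B T in time T, so Picard–Lindelöf on the
ball of radius B T covers the whole interval at once. -/
lemma exists_local_solution_of_bounded [CompleteSpace F] {f : ℝ → F → F} {K : NNReal}
    (hf : ∀ t, LipschitzWith K (f t)) (hc : ∀ x, Continuous fun t => f t x) {T : ℝ} (hT : 0 < T)
    {B : ℝ} (hB : ∀ t ∈ Icc (-T) T, ∀ x, ‖f t x‖ ≤ B) (y₀ : F) :
    ∃ y : ℝ → F, y 0 = y₀ ∧ ∀ t ∈ Ioo (-T) T, HasDerivAt y (f t (y t)) t := by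
  have h0 : (0 : ℝ) ∈ Icc (-T) T := ⟨by linarith, hT.le⟩
  have hB0 : 0 ≤ B := (norm_nonneg _).trans (hB 0 h0 y₀)
  have hpl : IsPicardLindelof f (⟨0, h0⟩ : Icc (-T) T) y₀ ⟨B * T, by positivity⟩ 0 ⟨B, hB0⟩ K := by
    refine ⟨fun t _ => (hf t).lipschitzOnWith, fun x _ => (hc x).continuousOn,
      fun t ht x _ => hB t ht x, ?_⟩
    simp
    exact le_rfl
  obtain ⟨y, hy0, hy⟩ := hpl.exists_eq_forall_mem_Icc_hasDerivWithinAt₀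
  exact ⟨y, hy0, fun t ht => (hy t (Ioo_subset_Icc_self ht)).hasDerivAt (Icc_mem_nhds ht.1 ht.2)⟩

lemma norm_le_of_norm_deriv_le {y y' : ℝ → F} {K T : ℝ}
    (hy : ∀ t ∈ Ioo (-T) T, HasDerivAt y (y' t) t) (hb : ∀ t ∈ Ioo (-T) T, ‖y' t‖ ≤ K * ‖y t‖) :
    ∀ t ∈ Ioo (-T) T, ‖y t‖ ≤ ‖y 0‖ * Real.exp (K * |t|) := by
  have pos : ∀ z z' : ℝ → F, (∀ t ∈ Ioo (-T) T, HasDerivAt z (z' t) t) →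
      (∀ t ∈ Ioo (-T) T, ‖z' t‖ ≤ K * ‖z t‖) → ∀ t ∈ Ico 0 T, ‖z t‖ ≤ ‖z 0‖ * Real.exp (K * t) := by
    intro z z' hz hzb t ht
    have hsub : Icc 0 t ⊆ Ioo (-T) T := fun s hs =>
      ⟨by linarith [hs.1, ht.1, ht.2], hs.2.trans_lt ht.2⟩
    have := norm_le_gronwallBound_of_norm_deriv_right_le (f := z) (f' := z') (δ := ‖z 0‖) (K := K)
      (ε := 0) (a := 0) (b := t) (fun s hs => (hz s (hsub hs)).continuousAt.continuousWithinAt)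
      (fun s hs => (hz s (hsub (Ico_subset_Icc_self hs))).hasDerivWithinAt) le_rfl
      (fun s hs => by simpa using hzb s (hsub (Ico_subset_Icc_self hs))) t ⟨ht.1, le_rfl⟩
    simpa [gronwallBound_ε0] using this
  intro t ht
  rcases le_total 0 t with h | h
  · rw [abs_of_nonneg h]
    exact pos y y' hy hb t ⟨h, ht.2⟩
  · rw [abs_of_nonpos h]
    have := pos (fun s => y (-s)) (fun s => -y' (-s)) (fun s hs => by
        have h1 := hy (-s) ⟨by linarith [hs.2], by linarith [hs.1]⟩
        simpa [Function.comp_def] using h1.scomp s (hasDerivAt_neg s))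
      (fun s hs => by
        rw [norm_neg]; exact hb (-s) ⟨by linarith [hs.2], by linarith [hs.1]⟩)
      (-t) ⟨by linarith, by linarith [ht.1]⟩
    simpa using this

/-- Linear ODEs with continuous bounded coefficients have global solutions. -/
lemma exists_linear_solution [FiniteDimensional ℝ F] {A : ℝ → F →L[ℝ] F} (hA : Continuous A)
    {K : NNReal} (hK : ∀ t, ‖A t‖ ≤ K) (y₀ : F) :
    ∃ y : ℝ → F, y 0 = y₀ ∧ ∀ t, HasDerivAt y (A t (y t)) t := by
  have hL : ∀ t, LipschitzWith K (A t) := fun t =>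
    (A t).lipschitz.weaken (by exact_mod_cast hK t)
  refine exists_global_solution_of_local (f := fun t y => A t y) hL y₀ fun T hT => ?_
  -- A linear field is unbounded, so it is cut off outside the ball of radius R. By Grönwall the
  -- solution of the truncated equation stays below R up to time T, where the cutoff is 1, and
  -- therefore solves the linear equation.
  set R : ℝ := ‖y₀‖ * Real.exp (K * T) + 1 with hR
  have hRpos : 0 < R := by positivity
  let β : ContDiffBump (0 : F) := ⟨R, R + 1, hRpos, by linarith⟩
  have hsm : ContDiff ℝ 1 fun y : F => β y • y := β.contDiff.smul contDiff_id
  have hcs : HasCompactSupport fun y : F => β y • y := β.hasCompactSupport.smul_right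
  obtain ⟨C, hC⟩ := hsm.lipschitzWith_of_hasCompactSupport hcs (by norm_num)
  obtain ⟨B, hB⟩ := hcs.exists_bound_of_continuous hsm.continuous
  obtain ⟨y, hy0, hy⟩ := exists_local_solution_of_bounded (f := fun t y => A t (β y • y))
    (K := K * C) (fun t => (hL t).comp hC) (fun x => by fun_prop) hT (B := K * B)
    (fun t _ x => ((A t).le_opNorm _).trans
      (mul_le_mul (hK t) (hB x) (norm_nonneg _) K.2)) y₀
  refine ⟨y, hy0, fun t ht => ?_⟩
  have hbd := norm_le_of_norm_deriv_le (K := K) hy (fun t _ => by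
    refine ((A t).le_opNorm _).trans (mul_le_mul (hK t) ?_ (norm_nonneg _) K.2)
    rw [norm_smul, Real.norm_of_nonneg β.nonneg]
    exact mul_le_of_le_one_left (norm_nonneg _) β.le_one) t ht
  have h1 : β (y t) = 1 := by
    refine β.one_of_mem_closedBall ?_
    rw [mem_closedBall_zero_iff]
    refine hbd.trans ?_
    rw [hy0]
    have : Real.exp (K * |t|) ≤ Real.exp (K * T) :=
      Real.exp_le_exp.2 (mul_le_mul_of_nonneg_left (abs_lt.2 ht).le K.2)
    have := mul_le_mul_of_nonneg_left this (norm_nonneg y₀)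
    change _ ≤ R
    linarith
  have := hy t ht
  simpa [h1] using this


/-- `Φ` is a global flow of the vector field `X`. -/
structure IsFlow (X : F → F) (Φ : ℝ → F → F) : Prop where
  zero : ∀ x, Φ 0 x = x
  deriv : ∀ x t, HasDerivAt (fun s => Φ s x) (X (Φ t x)) t

lemma IsFlow.neg {X : F → F} {Φ : ℝ → F → F} (h : IsFlow X Φ) :
    IsFlow (fun x => -X x) (fun t => Φ (-t)) := by
  refine ⟨fun x => by simp [h.zero], fun x t => ?_⟩
  simpa [Function.comp_def] using (h.deriv x (-t)).scomp t (hasDerivAt_neg t)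

lemma IsFlow.eq_of_hasDerivAt {X : F → F} {Φ : ℝ → F → F} (h : IsFlow X Φ) {K : NNReal}
    (hX : LipschitzWith K X) {c : ℝ → F} (hc : ∀ t, HasDerivAt c (X (c t)) t) (t : ℝ) :
    c t = Φ t (c 0) :=
  congrFun (ODE_solution_unique_univ (v := fun _ => X) (s := fun _ => univ) (t₀ := 0)
    (fun _ => hX.lipschitzOnWith) (fun t => ⟨hc t, mem_univ _⟩)
    (fun t => ⟨h.deriv (c 0) t, mem_univ _⟩) (by simp [h.zero])) t

lemma IsFlow.add {X : F → F} {Φ : ℝ → F → F} (h : IsFlow X Φ) {K : NNReal}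
    (hX : LipschitzWith K X) (s t : ℝ) (x : F) : Φ (s + t) x = Φ s (Φ t x) := by
  have := h.eq_of_hasDerivAt hX (c := fun s => Φ (s + t) x) (fun s => by
    simpa using (h.deriv x (s + t)).comp_add_const s t) s
  simpa using this

lemma IsFlow.dist_le {X : F → F} {Φ : ℝ → F → F} (h : IsFlow X Φ) {K : NNReal}
    (hX : LipschitzWith K X) {t T : ℝ} (ht : 0 ≤ t) (htT : t ≤ T) (x y : F) :
    ‖Φ t x - Φ t y‖ ≤ ‖x - y‖ * Real.exp (K * T) := by
  have := dist_le_of_trajectories_ODE (v := fun _ => X) (K := K) (f := fun s => Φ s x)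
    (g := fun s => Φ s y) (a := 0) (b := t) (δ := dist x y) (fun _ => hX)
    (fun s _ => (h.deriv x s).continuousAt.continuousWithinAt)
    (fun s _ => (h.deriv x s).hasDerivWithinAt)
    (fun s _ => (h.deriv y s).continuousAt.continuousWithinAt)
    (fun s _ => (h.deriv y s).hasDerivWithinAt) (by simp [h.zero]) t ⟨ht, le_rfl⟩
  simp only [dist_eq_norm] at this
  refine this.trans (mul_le_mul_of_nonneg_left ?_ (norm_nonneg _))
  exact Real.exp_le_exp.2 (mul_le_mul_of_nonneg_left (by linarith) K.2)

lemma gronwallBound_zero_eq_mul (K ε x : ℝ) :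
    gronwallBound 0 K ε x = ε * gronwallBound 0 K 1 x := by
  by_cases hK : K = 0
  · simp [hK, gronwallBound_K0]
  · simp [gronwallBound_of_K_ne_0 hK]; ring

/-- The error Φ_t y - Φ_t z - Y_t (y - z) solves the linearized equation up to a remainder. Uniform
continuity of DX makes the remainder at most η ‖Φ_t y - Φ_t z‖, and Grönwall finishes. The strict
derivative comes for free because both points vary. -/
lemma IsFlow.hasStrictFDerivAt_of_nonneg {X : F → F} {Φ : ℝ → F → F} (h : IsFlow X Φ)
    (hX : ContDiff ℝ 1 X) (hc : HasCompactSupport X) {x : F} {Y : ℝ → F →L[ℝ] F}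
    (hY0 : Y 0 = ContinuousLinearMap.id ℝ F)
    (hY : ∀ t, HasDerivAt Y ((fderiv ℝ X (Φ t x)).comp (Y t)) t) {T : ℝ} (hT : 0 ≤ T) :
    HasStrictFDerivAt (Φ T) (Y T) x := by
  obtain ⟨K, hK⟩ := hX.lipschitzWith_of_hasCompactSupport hc (by norm_num)
  have hdc : Continuous (fderiv ℝ X) := hX.continuous_fderiv (by norm_num)
  have huc : UniformContinuous (fderiv ℝ X) :=
    (hc.fderiv ℝ).uniformContinuous_of_continuous hdc
  have hdK : ∀ y, ‖fderiv ℝ X y‖ ≤ K := fun y => norm_fderiv_le_of_lipschitz ℝ hK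
  rw [hasStrictFDerivAt_iff_isLittleO, Asymptotics.isLittleO_iff]
  intro c hcpos
  set M := Real.exp (K * T) with hM
  set G := gronwallBound 0 K 1 T with hG
  have hM0 : 0 < M := Real.exp_pos _
  have hG0 : 0 ≤ G := by
    have := gronwallBound_mono (δ := 0) (K := (K : ℝ)) (ε := 1) le_rfl zero_le_one K.2 hT
    simpa [gronwallBound_x0] using this
  -- Grönwall returns η · M · G · ‖y - z‖, where M bounds the expansion of the flow and G is the
  -- Grönwall factor for a unit source. This choice of η makes it at most c ‖y - z‖.
  set η := c / (M * G + 1) with hη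
  have hη0 : 0 < η := by positivity
  obtain ⟨δ, hδ, hδη⟩ := Metric.uniformContinuous_iff.1 huc η hη0
  have hev : ∀ᶠ p : F × F in 𝓝 (x, x), ‖p.1 - x‖ < δ / M ∧ ‖p.2 - x‖ < δ / M := by
    have : Metric.ball x (δ / M) ×ˢ Metric.ball x (δ / M) ∈ 𝓝 (x, x) :=
      prod_mem_nhds (Metric.ball_mem_nhds _ (by positivity)) (Metric.ball_mem_nhds _ (by positivity))
    filter_upwards [this] with p hp
    simpa [dist_eq_norm] using hp
  filter_upwards [hev] with ⟨y, z⟩ ⟨hy, hz⟩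
  simp only at hy hz ⊢
  have hnear : ∀ w, ‖w - x‖ < δ / M → ∀ t, 0 ≤ t → t ≤ T → Φ t w ∈ Metric.ball (Φ t x) δ := by
    intro w hw t ht htT
    rw [Metric.mem_ball, dist_eq_norm]
    refine (h.dist_le hK ht htT w x).trans_lt ?_
    rwa [lt_div_iff₀ hM0] at hw
  have hmv : ∀ t, 0 ≤ t → t ≤ T →
      ‖X (Φ t y) - X (Φ t z) - fderiv ℝ X (Φ t x) (Φ t y - Φ t z)‖ ≤ η * ‖Φ t y - Φ t z‖ := by
    intro t ht htT
    refine (convex_ball (Φ t x) δ).norm_image_sub_le_of_norm_fderiv_le' (𝕜 := ℝ)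
      (fun w _ => (hX.differentiable (by norm_num)) w) (fun w hw => ?_)
      (hnear z hz t ht htT) (hnear y hy t ht htT)
    have := hδη hw
    rw [dist_eq_norm] at this
    exact this.le
  have hgr := norm_le_gronwallBound_of_norm_deriv_right_le
    (f := fun t => Φ t y - Φ t z - Y t (y - z))
    (f' := fun t => X (Φ t y) - X (Φ t z) - fderiv ℝ X (Φ t x) (Y t (y - z)))
    (δ := 0) (K := K) (ε := η * (‖y - z‖ * M)) (a := 0) (b := T)
    (fun t _ => (((h.deriv y t).sub (h.deriv z t)).sub
      ((hY t).clm_apply (hasDerivAt_const t (y - z)))).continuousAt.continuousWithinAt)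
    (fun t _ => by
      have := ((h.deriv y t).sub (h.deriv z t)).sub ((hY t).clm_apply (hasDerivAt_const t (y - z)))
      simpa [Pi.sub_def] using this.hasDerivWithinAt)
    (by simp [h.zero, hY0]) (fun t ht => by
      have e : X (Φ t y) - X (Φ t z) - fderiv ℝ X (Φ t x) (Y t (y - z)) =
          fderiv ℝ X (Φ t x) (Φ t y - Φ t z - Y t (y - z)) +
          (X (Φ t y) - X (Φ t z) - fderiv ℝ X (Φ t x) (Φ t y - Φ t z)) := by
        simp only [map_sub]; abel
      rw [e]
      refine (norm_add_le _ _).trans (add_le_add ?_ ?_)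
      · exact ((fderiv ℝ X (Φ t x)).le_opNorm _).trans
          (mul_le_mul_of_nonneg_right (hdK _) (norm_nonneg _))
      · refine (hmv t ht.1 ht.2.le).trans (mul_le_mul_of_nonneg_left ?_ hη0.le)
        exact h.dist_le hK ht.1 ht.2.le y z) T ⟨hT, le_rfl⟩
  refine hgr.trans ?_
  rw [sub_zero, gronwallBound_zero_eq_mul, ← hG]
  have : η * (M * G + 1) = c := by rw [hη]; field_simp
  nlinarith [norm_nonneg (y - z), mul_nonneg hη0.le (norm_nonneg (y - z))]

lemma IsFlow.hasStrictFDerivAt {X : F → F} {Φ : ℝ → F → F} (h : IsFlow X Φ)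
    (hX : ContDiff ℝ 1 X) (hc : HasCompactSupport X) {x : F} {Y : ℝ → F →L[ℝ] F}
    (hY0 : Y 0 = ContinuousLinearMap.id ℝ F)
    (hY : ∀ t, HasDerivAt Y ((fderiv ℝ X (Φ t x)).comp (Y t)) t) (t : ℝ) :
    HasStrictFDerivAt (Φ t) (Y t) x := by
  rcases le_total 0 t with ht | ht
  · exact h.hasStrictFDerivAt_of_nonneg hX hc hY0 hY ht
  · have := h.neg.hasStrictFDerivAt_of_nonneg (x := x) (Y := fun t => Y (-t)) hX.neg
      (by simpa using! hc.neg) (by simpa using hY0) (fun t => by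
        have := (hY (-t)).scomp t (hasDerivAt_neg t)
        simpa [Function.comp_def, fderiv_fun_neg] using this) (T := -t) (by linarith)
    simpa using this

/-- Strict differentiability at x says that f - f' x is ε/2-Lipschitz near x. Hence its derivative
f' y - f' x has norm at most ε/2 for all y near x, which is continuity of the derivative. -/
lemma contDiff_one_of_hasStrictFDerivAt {F' : Type*} [NormedAddCommGroup F'] [NormedSpace ℝ F']
    {f : F → F'} {f' : F → F →L[ℝ] F'} (h : ∀ x, HasStrictFDerivAt f (f' x) x) :
    ContDiff ℝ 1 f := by
  rw [contDiff_one_iff_fderiv]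
  refine ⟨fun x => (h x).hasFDerivAt.differentiableAt, ?_⟩
  have e : fderiv ℝ f = f' := funext fun x => (h x).hasFDerivAt.fderiv
  rw [e, continuous_iff_continuousAt]
  intro x
  rw [Metric.continuousAt_iff']
  intro ε hε
  have hε2 : (0 : ℝ) < ε / 2 := by linarith
  obtain ⟨s, hs, hl⟩ := (h x).approximates_deriv_on_nhds (c := ⟨ε / 2, hε2.le⟩) (Or.inr hε2)
  filter_upwards [eventually_mem_nhds_iff.2 hs] with y hy
  rw [dist_eq_norm]
  have := ((h y).hasFDerivAt.sub (f' x).hasFDerivAt).le_of_lipschitzOn hy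
    hl.lipschitzOnWith
  refine lt_of_le_of_lt this ?_
  change ε / 2 < ε
  linarith

section FiniteDim

variable [FiniteDimensional ℝ F]

lemma exists_isFlow {X : F → F} (hX : ContDiff ℝ 1 X) (hc : HasCompactSupport X) :
    ∃ Φ, IsFlow X Φ := by
  have := FiniteDimensional.complete ℝ F
  obtain ⟨K, hK⟩ := hX.lipschitzWith_of_hasCompactSupport hc (by norm_num)
  obtain ⟨B, hB⟩ := hc.exists_bound_of_continuous hX.continuous
  have : ∀ x : F, ∃ y : ℝ → F, y 0 = x ∧ ∀ t, HasDerivAt y (X (y t)) t := fun x =>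
    exists_global_solution_of_local (f := fun _ => X) (fun _ => hK) x fun T hT =>
      exists_local_solution_of_bounded (fun _ => hK) (fun _ => continuous_const) hT
        (fun _ _ y => hB y) x
  choose y hy0 hy using this
  exact ⟨fun t x => y x t, hy0, fun x t => hy x t⟩

lemma IsFlow.exists_variational {X : F → F} {Φ : ℝ → F → F} (h : IsFlow X Φ)
    (hX : ContDiff ℝ 1 X) (hc : HasCompactSupport X) (x : F) :
    ∃ Y : ℝ → F →L[ℝ] F, Y 0 = ContinuousLinearMap.id ℝ F ∧
      ∀ t, HasDerivAt Y ((fderiv ℝ X (Φ t x)).comp (Y t)) t := by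
  have := FiniteDimensional.complete ℝ F
  obtain ⟨K, hK⟩ := hX.lipschitzWith_of_hasCompactSupport hc (by norm_num)
  have hcont : Continuous fun t => fderiv ℝ X (Φ t x) :=
    (hX.continuous_fderiv (by norm_num)).comp
      (continuous_iff_continuousAt.2 fun t => (h.deriv x t).continuousAt)
  obtain ⟨Y, h0, hY⟩ := exists_linear_solution
    (A := fun t => ContinuousLinearMap.compL ℝ F F F (fderiv ℝ X (Φ t x)))
    ((ContinuousLinearMap.compL ℝ F F F).continuous.comp hcont) (K := K) (fun t => by
      refine ContinuousLinearMap.opNorm_le_bound _ K.2 fun L => ?_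
      refine (ContinuousLinearMap.opNorm_comp_le _ _).trans ?_
      exact mul_le_mul_of_nonneg_right (norm_fderiv_le_of_lipschitz ℝ hK) (norm_nonneg _))
    (ContinuousLinearMap.id ℝ F)
  exact ⟨Y, h0, hY⟩

/-- The variational equation of a flow. -/
lemma IsFlow.hasDerivAt_fderiv {X : F → F} {Φ : ℝ → F → F} (h : IsFlow X Φ)
    (hX : ContDiff ℝ 1 X) (hc : HasCompactSupport X) (x : F) (t : ℝ) :
    HasDerivAt (fun s => fderiv ℝ (Φ s) x) ((fderiv ℝ X (Φ t x)).comp (fderiv ℝ (Φ t) x)) t := by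
  obtain ⟨Y, h0, hY⟩ := h.exists_variational hX hc x
  have e : (fun s => fderiv ℝ (Φ s) x) = Y :=
    funext fun s => (h.hasStrictFDerivAt hX hc h0 hY s).hasFDerivAt.fderiv
  have e1 : fderiv ℝ (Φ t) x = Y t := congrFun e t
  rw [e, e1]
  exact hY t

lemma IsFlow.contDiff_apply {X : F → F} {Φ : ℝ → F → F} (h : IsFlow X Φ)
    (hX : ContDiff ℝ 1 X) (hc : HasCompactSupport X) (t : ℝ) : ContDiff ℝ 1 (Φ t) := by
  choose Y h0 hY using h.exists_variational hX hc
  exact contDiff_one_of_hasStrictFDerivAt fun x => h.hasStrictFDerivAt hX hc (h0 x) (hY x) t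

/-- The flow of a compactly supported `C¹` vector field is jointly `C¹`. -/
lemma IsFlow.contDiff {X : F → F} {Φ : ℝ → F → F} (h : IsFlow X Φ)
    (hX : ContDiff ℝ 1 X) (hc : HasCompactSupport X) :
    ContDiff ℝ 1 (fun q : ℝ × F => Φ q.1 q.2) := by
  obtain ⟨K, hK⟩ := hX.lipschitzWith_of_hasCompactSupport hc (by norm_num)
  rw [contDiff_iff_contDiffAt]
  rintro ⟨t₀, x₀⟩
  let β : ContDiffBump (0 : ℝ) := ⟨|t₀| + 1, |t₀| + 2, by positivity, by linarith⟩
  -- Time becomes a parameter: the time-one map of this field on ℝ × F is Φ (β t · t) in the second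
  -- component, which is Φ t where β = 1. Joint C¹ dependence thus reduces to the dependence on the
  -- initial point; β only ensures compact support.
  let Z : ℝ × F → ℝ × F := fun q => (0, (β q.1 * q.1) • X q.2)
  have hZ : ContDiff ℝ 1 Z := by
    refine contDiff_const.prodMk (ContDiff.smul ?_ (hX.comp contDiff_snd))
    exact (β.contDiff.comp contDiff_fst).mul contDiff_fst
  have hZc : HasCompactSupport Z := by
    refine HasCompactSupport.intro (K := tsupport β ×ˢ tsupport X)
      (β.hasCompactSupport.isCompact.prod hc.isCompact) ?_
    rintro ⟨t, x⟩ hq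
    rw [mem_prod, not_and_or] at hq
    rcases hq with hq | hq
    · simp [Z, image_eq_zero_of_notMem_tsupport hq]
    · simp [Z, image_eq_zero_of_notMem_tsupport hq]
  have hfl : IsFlow Z fun s q => (q.1, Φ (s * (β q.1 * q.1)) q.2) := by
    refine ⟨fun q => by simp [h.zero], fun q s => ?_⟩
    refine (hasDerivAt_const s q.1).prodMk ?_
    have := (h.deriv q.2 (s * (β q.1 * q.1))).scomp s ((hasDerivAt_id s).mul_const (β q.1 * q.1))
    simpa [Function.comp_def] using this
  have h1 : ContDiff ℝ 1 fun q : ℝ × F => Φ (1 * (β q.1 * q.1)) q.2 :=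
    contDiff_snd.comp (hfl.contDiff_apply hZ hZc 1)
  refine h1.contDiffAt.congr_of_eventuallyEq ?_
  have : ∀ᶠ q : ℝ × F in 𝓝 (t₀, x₀), q.1 ∈ Metric.closedBall (0 : ℝ) (|t₀| + 1) := by
    refine continuous_fst.continuousAt.eventually (Metric.closedBall_mem_nhds_of_mem ?_)
    simp
  filter_upwards [this] with q hq
  rw [β.one_of_mem_closedBall hq, one_mul, one_mul]

end FiniteDim

end Flow

/-! ### Hamiltonian fields and flows of a C¹ Poisson tensor on an open set. -/

section LocalPoisson

open Filter

variable {F : Type*} [NormedAddCommGroup F] [NormedSpace ℝ F]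

/-- A `C¹` Poisson tensor on an open subset `Ω` of a vector space, as a map from covectors to
vectors. -/
structure IsLocalPoisson (Ω : Set F) (B : F → (F →L[ℝ] ℝ) →L[ℝ] F) : Prop where
  isOpen : IsOpen Ω
  contDiffOn : ContDiffOn ℝ 1 B Ω
  skew : ∀ x ∈ Ω, ∀ ξ η : F →L[ℝ] ℝ, ξ (B x η) = -η (B x ξ)
  jacobi : ∀ x ∈ Ω, ∀ α β η : F →L[ℝ] ℝ, β (fderiv ℝ B x (B x α) η) +
    η (fderiv ℝ B x (B x β) α) + α (fderiv ℝ B x (B x η) β) = 0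

/-- The Hamiltonian vector field of `f` for the tensor `B`. -/
def hamField (B : F → (F →L[ℝ] ℝ) →L[ℝ] F) (f : F → ℝ) (x : F) : F := B x (fderiv ℝ f x)

variable {Ω : Set F} {B : F → (F →L[ℝ] ℝ) →L[ℝ] F}

lemma hamField_eq_zero_of_notMem_tsupport {f : F → ℝ} {x : F} (hx : x ∉ tsupport f) :
    hamField B f x = 0 := by
  have : fderiv ℝ f x = 0 := image_eq_zero_of_notMem_tsupport fun h =>
    hx (tsupport_fderiv_subset ℝ h)
  simp [hamField, this]

lemma hasCompactSupport_hamField {f : F → ℝ} (hf : HasCompactSupport f) :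
    HasCompactSupport (hamField B f) :=
  HasCompactSupport.intro hf fun _ hx => hamField_eq_zero_of_notMem_tsupport hx

namespace IsLocalPoisson

lemma contDiffAt (h : IsLocalPoisson Ω B) {x : F} (hx : x ∈ Ω) : ContDiffAt ℝ 1 B x :=
  h.contDiffOn.contDiffAt (h.isOpen.mem_nhds hx)

lemma contDiff_hamField (h : IsLocalPoisson Ω B) {f : F → ℝ} (hf : ContDiff ℝ 2 f)
    (hfΩ : tsupport f ⊆ Ω) : ContDiff ℝ 1 (hamField B f) := by
  rw [contDiff_iff_contDiffAt]
  intro x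
  by_cases hx : x ∈ tsupport f
  · exact (h.contDiffAt (hfΩ hx)).clm_apply (hf.contDiffAt.fderiv_right (by norm_num))
  · have : ∀ᶠ y in 𝓝 x, hamField B f y = 0 := by
      filter_upwards [(isClosed_tsupport f).isOpen_compl.mem_nhds hx] with y hy
      exact hamField_eq_zero_of_notMem_tsupport hy
    exact (contDiffAt_const (c := (0 : F))).congr_of_eventuallyEq this

lemma hasFDerivAt_hamField (h : IsLocalPoisson Ω B) {f : F → ℝ} {x : F} (hx : x ∈ Ω)
    (hf : ContDiffAt ℝ 2 f x) : HasFDerivAt (hamField B f)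
      ((B x).comp (fderiv ℝ (fderiv ℝ f) x) + (fderiv ℝ B x).flip (fderiv ℝ f x)) x := by
  have h1 := ((h.contDiffAt hx).differentiableAt (by norm_num)).hasFDerivAt
  have h2 : HasFDerivAt (fderiv ℝ f) (fderiv ℝ (fderiv ℝ f) x) x :=
    ((hf.fderiv_right (m := 1) (by norm_num)).differentiableAt (by norm_num)).hasFDerivAt
  exact h1.clm_apply h2

lemma apply_hamField_self (h : IsLocalPoisson Ω B) (f : F → ℝ) {x : F} (hx : x ∈ Ω) :
    fderiv ℝ f x (hamField B f x) = 0 := by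
  have := h.skew x hx (fderiv ℝ f x) (fderiv ℝ f x)
  unfold hamField
  linarith

lemma skew_fderiv (h : IsLocalPoisson Ω B) {x : F} (hx : x ∈ Ω) (u : F) (ξ η : F →L[ℝ] ℝ) :
    ξ (fderiv ℝ B x u η) = -η (fderiv ℝ B x u ξ) := by
  have hd := ((h.contDiffAt hx).differentiableAt (by norm_num)).hasFDerivAt
  have h1 : ∀ ξ η : F →L[ℝ] ℝ, HasFDerivAt (fun y => ξ (B y η))
      (ξ.comp ((fderiv ℝ B x).flip η)) x := fun ξ η => by
    have := ξ.hasFDerivAt.comp x (hd.clm_apply (hasFDerivAt_const η x))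
    simpa [Function.comp_def] using! this
  have h2 : (fun y => ξ (B y η)) =ᶠ[𝓝 x] fun y => -η (B y ξ) := by
    filter_upwards [h.isOpen.mem_nhds hx] with y hy using h.skew y hy ξ η
  have h3 := (h1 ξ η).unique ((h1 η ξ).neg.congr_of_eventuallyEq h2)
  simpa using congrArg (fun L : F →L[ℝ] ℝ => L u) h3

/-- This is the vanishing of the Lie derivative of the Poisson tensor along a Hamiltonian field.
After pairing with a covector it follows from the Jacobi identity, the skewness of B and of its
derivative, and the symmetry of the second derivative of f. -/
lemma fderiv_hamField_apply (h : IsLocalPoisson Ω B) {f : F → ℝ} {x : F} (hx : x ∈ Ω)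
    (hf : ContDiffAt ℝ 2 f x) (ξ : F →L[ℝ] ℝ) :
    fderiv ℝ B x (hamField B f x) ξ - B x (ξ.comp (fderiv ℝ (hamField B f) x)) =
      fderiv ℝ (hamField B f) x (B x ξ) := by
  have hsymm : ∀ u v, fderiv ℝ (fderiv ℝ f) x u v = fderiv ℝ (fderiv ℝ f) x v u :=
    hf.isSymmSndFDerivAt (by simp)
  rw [(h.hasFDerivAt_hamField hx hf).fderiv]
  set α := fderiv ℝ f x with hα
  refine (SeparatingDual.eq_iff_forall_dual_eq (R := ℝ)).2 fun η => ?_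
  have hJ := h.jacobi x hx α η ξ
  have e1 := h.skew x hx η (ξ.comp ((B x).comp (fderiv ℝ (fderiv ℝ f) x) + (fderiv ℝ B x).flip α))
  have e2 := h.skew x hx ξ (fderiv ℝ (fderiv ℝ f) x (B x η))
  have e3 := h.skew x hx η (fderiv ℝ (fderiv ℝ f) x (B x ξ))
  have e4 := hsymm (B x η) (B x ξ)
  have e5 := h.skew_fderiv hx (B x ξ) α η
  simp only [map_sub, add_apply, ContinuousLinearMap.comp_apply, map_add,
    ContinuousLinearMap.flip_apply, hamField] at *
  linarith

variable {f : F → ℝ} {Φ : ℝ → F → F}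

lemma exists_flow [FiniteDimensional ℝ F] (h : IsLocalPoisson Ω B) (hf : ContDiff ℝ 2 f) (hfc : HasCompactSupport f)
    (hfΩ : tsupport f ⊆ Ω) : ∃ Φ, IsFlow (hamField B f) Φ :=
  exists_isFlow (h.contDiff_hamField hf hfΩ) (hasCompactSupport_hamField hfc)

lemma contDiff_flow [FiniteDimensional ℝ F] (h : IsLocalPoisson Ω B) (hf : ContDiff ℝ 2 f) (hfc : HasCompactSupport f)
    (hfΩ : tsupport f ⊆ Ω) (hΦ : IsFlow (hamField B f) Φ) :
    ContDiff ℝ 1 (fun q : ℝ × F => Φ q.1 q.2) :=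
  hΦ.contDiff (h.contDiff_hamField hf hfΩ) (hasCompactSupport_hamField hfc)

lemma flow_add (h : IsLocalPoisson Ω B) (hf : ContDiff ℝ 2 f) (hfc : HasCompactSupport f)
    (hfΩ : tsupport f ⊆ Ω) (hΦ : IsFlow (hamField B f) Φ) (s t : ℝ) (x : F) :
    Φ (s + t) x = Φ s (Φ t x) := by
  obtain ⟨K, hK⟩ := (h.contDiff_hamField hf hfΩ).lipschitzWith_of_hasCompactSupport
    (hasCompactSupport_hamField hfc) (by norm_num)
  exact hΦ.add hK s t x

/-- Points outside Ω lie outside the support of f and are stationary, so by uniqueness no orbit from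
Ω can reach them. -/
lemma flow_mem (h : IsLocalPoisson Ω B) (hf : ContDiff ℝ 2 f) (hfc : HasCompactSupport f)
    (hfΩ : tsupport f ⊆ Ω) (hΦ : IsFlow (hamField B f) Φ) {x : F} (hx : x ∈ Ω) (t : ℝ) :
    Φ t x ∈ Ω := by
  obtain ⟨K, hK⟩ := (h.contDiff_hamField hf hfΩ).lipschitzWith_of_hasCompactSupport
    (hasCompactSupport_hamField hfc) (by norm_num)
  by_contra hn
  have hz : hamField B f (Φ t x) = 0 :=
    hamField_eq_zero_of_notMem_tsupport fun hm => hn (hfΩ hm)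
  have h1 := hΦ.eq_of_hasDerivAt hK (c := fun _ => Φ t x) (fun s => by
    rw [hz]; exact hasDerivAt_const s _) (-t)
  replace h1 : Φ t x = Φ (-t) (Φ t x) := h1
  have h2 : Φ (-t) (Φ t x) = x := by
    rw [← hΦ.add hK, neg_add_cancel, hΦ.zero]
  rw [h1, h2] at hn
  exact hn hx

lemma apply_flow (h : IsLocalPoisson Ω B) (hf : ContDiff ℝ 2 f) (hfΩ : tsupport f ⊆ Ω)
    (hΦ : IsFlow (hamField B f) Φ) (x : F) (t : ℝ) : f (Φ t x) = f x := by
  have hd : ∀ s, HasDerivAt (fun s => f (Φ s x)) 0 s := fun s => by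
    have := ((hf.differentiable (by norm_num)) (Φ s x)).hasFDerivAt.comp_hasDerivAt s (hΦ.deriv x s)
    have e : fderiv ℝ f (Φ s x) (hamField B f (Φ s x)) = 0 := by
      by_cases hm : Φ s x ∈ tsupport f
      · exact h.apply_hamField_self f (hfΩ hm)
      · rw [hamField_eq_zero_of_notMem_tsupport hm, map_zero]
    rwa [e] at this
  have := is_const_of_deriv_eq_zero (fun s => (hd s).differentiableAt) (fun s => (hd s).deriv) t 0
  simpa [hΦ.zero] using this

lemma fderiv_flow_comp [FiniteDimensional ℝ F] (h : IsLocalPoisson Ω B) (hf : ContDiff ℝ 2 f) (hfc : HasCompactSupport f)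
    (hfΩ : tsupport f ⊆ Ω) (hΦ : IsFlow (hamField B f) Φ) (x : F) (t : ℝ) :
    (fderiv ℝ (Φ (-t)) (Φ t x)).comp (fderiv ℝ (Φ t) x) = ContinuousLinearMap.id ℝ F := by
  have hd : ∀ t, Differentiable ℝ (Φ t) := fun t =>
    (hΦ.contDiff_apply (h.contDiff_hamField hf hfΩ) (hasCompactSupport_hamField hfc) t).differentiable
      (by norm_num)
  rw [← fderiv_comp x (hd _ _) (hd _ _)]
  have : Φ (-t) ∘ Φ t = id := by
    ext y
    simp [← h.flow_add hf hfc hfΩ hΦ, hΦ.zero]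
  rw [this, fderiv_id]

lemma fderiv_flow_comp' [FiniteDimensional ℝ F] (h : IsLocalPoisson Ω B) (hf : ContDiff ℝ 2 f) (hfc : HasCompactSupport f)
    (hfΩ : tsupport f ⊆ Ω) (hΦ : IsFlow (hamField B f) Φ) (x : F) (t : ℝ) :
    (fderiv ℝ (Φ t) x).comp (fderiv ℝ (Φ (-t)) (Φ t x)) = ContinuousLinearMap.id ℝ F := by
  have := h.fderiv_flow_comp hf hfc hfΩ hΦ (Φ t x) (-t)
  rwa [neg_neg, ← h.flow_add hf hfc hfΩ hΦ, neg_add_cancel, hΦ.zero] at this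

/-- The Hamiltonian flow transports covectors to solutions of the variational equation. -/
lemma fderiv_flow_sharp [FiniteDimensional ℝ F] (h : IsLocalPoisson Ω B) (hf : ContDiff ℝ 2 f) (hfc : HasCompactSupport f)
    (hfΩ : tsupport f ⊆ Ω) (hΦ : IsFlow (hamField B f) Φ) {x : F} (hx : x ∈ Ω) (t : ℝ)
    (ξ : F →L[ℝ] ℝ) :
    B (Φ t x) (ξ.comp (fderiv ℝ (Φ (-t)) (Φ t x))) = fderiv ℝ (Φ t) x (B x ξ) := by
  have := FiniteDimensional.complete ℝ F
  have hXc := hasCompactSupport_hamField (B := B) hfc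
  have hX := h.contDiff_hamField hf hfΩ
  obtain ⟨K, hK⟩ := hX.lipschitzWith_of_hasCompactSupport hXc (by norm_num)
  set Y : ℝ → F →L[ℝ] F := fun s => fderiv ℝ (Φ s) x with hYdef
  set Z : ℝ → F →L[ℝ] F := fun s => fderiv ℝ (Φ (-s)) (Φ s x) with hZdef
  have hZY : ∀ s, Z s * Y s = 1 := fun s => h.fderiv_flow_comp hf hfc hfΩ hΦ x s
  have hYZ : ∀ s, Y s * Z s = 1 := fun s => h.fderiv_flow_comp' hf hfc hfΩ hΦ x s
  let u : ℝ → (F →L[ℝ] F)ˣ := fun s => ⟨Y s, Z s, hYZ s, hZY s⟩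
  have hZi : Z = fun s => Ring.inverse (Y s) := by
    ext1 s
    exact (Ring.inverse_unit (u s)).symm
  have hY : ∀ s, HasDerivAt Y (fderiv ℝ (hamField B f) (Φ s x) * Y s) s :=
    fun s => hΦ.hasDerivAt_fderiv hX hXc x s
  have hZ : ∀ s, HasDerivAt Z (-(Z s * fderiv ℝ (hamField B f) (Φ s x))) s := by
    intro s
    have h1 := (hasFDerivAt_ringInverse (𝕜 := ℝ) (u s)).comp_hasDerivAt s (hY s)
    rw [hZi]
    convert! h1 using 1
    have e : ((u s)⁻¹ : (F →L[ℝ] F)ˣ).1 = Z s := rfl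
    simp only [neg_apply, ContinuousLinearMap.mulLeftRight_apply, e, mul_assoc,
      hYZ, mul_one]
    simp [hZi]
  -- Differentiating gives one term from the motion of the base point of B and one from Z' = -Z DX.
  -- `fderiv_hamField_apply` combines them into DX applied to the curve itself, so both sides of the
  -- claim solve the variational equation with initial value B x ξ.
  have hcomp : ∀ s, HasDerivAt (fun s => B (Φ s x) (ξ.comp (Z s)))
      (fderiv ℝ (hamField B f) (Φ s x) (B (Φ s x) (ξ.comp (Z s)))) s := by
    intro s
    have hm := h.flow_mem hf hfc hfΩ hΦ hx s
    have h1 := ((h.contDiffAt hm).differentiableAt (by norm_num)).hasFDerivAt.comp_hasDerivAt s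
      (hΦ.deriv x s)
    have h2 : HasDerivAt (fun s => ξ.comp (Z s))
        (ξ.comp (-(Z s * fderiv ℝ (hamField B f) (Φ s x)))) s :=
      ((ContinuousLinearMap.compL ℝ F F ℝ) ξ).hasFDerivAt.comp_hasDerivAt s (hZ s)
    have h3 := h1.clm_apply h2
    rw [← h.fderiv_hamField_apply hm hf.contDiffAt]
    convert! h3 using 1
    rw [sub_eq_add_neg, ← map_neg]
    congr 2
    ext w
    simp
  have huniq := ODE_solution_unique_univ (K := K)
    (v := fun s w => fderiv ℝ (hamField B f) (Φ s x) w) (s := fun _ => univ) (t₀ := 0)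
    (f := fun s => B (Φ s x) (ξ.comp (Z s))) (g := fun s => Y s (B x ξ))
    (fun s => ((fderiv ℝ (hamField B f) (Φ s x)).lipschitz.weaken
      (norm_fderiv_le_of_lipschitz ℝ hK)).lipschitzOnWith)
    (fun s => ⟨hcomp s, mem_univ _⟩)
    (fun s => ⟨by simpa using (hY s).clm_apply (hasDerivAt_const s (B x ξ)), mem_univ _⟩) (by
      have e : Φ 0 = id := funext hΦ.zero
      simp [hYdef, hZdef, e])
  exact congrFun huniq t

/-- The previous identity with the covector prescribed at the end point: the time-t map is a Poisson
map. -/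
lemma sharp_flow [FiniteDimensional ℝ F] (h : IsLocalPoisson Ω B) (hf : ContDiff ℝ 2 f) (hfc : HasCompactSupport f)
    (hfΩ : tsupport f ⊆ Ω) (hΦ : IsFlow (hamField B f) Φ) {x : F} (hx : x ∈ Ω) (t : ℝ)
    (η : F →L[ℝ] ℝ) :
    B (Φ t x) η = fderiv ℝ (Φ t) x (B x (η.comp (fderiv ℝ (Φ t) x))) := by
  rw [← h.fderiv_flow_sharp hf hfc hfΩ hΦ hx, ContinuousLinearMap.comp_assoc,
    h.fderiv_flow_comp' hf hfc hfΩ hΦ, ContinuousLinearMap.comp_id]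

end IsLocalPoisson

end LocalPoisson

/-! ### Local Casimir maps of a tensor of constant rank. -/

section Foliation

open Filter

variable {F : Type*} [NormedAddCommGroup F] [NormedSpace ℝ F] [FiniteDimensional ℝ F]
  {Ω : Set F} {B : F → (F →L[ℝ] ℝ) →L[ℝ] F}

namespace IsLocalPoisson

/-- Composition of the flows of finitely many Hamiltonians, as a function of the times and the
initial point. -/
lemma exists_composed_flow (h : IsLocalPoisson Ω B) (k : ℕ) (f : Fin k → F → ℝ)
    (hf : ∀ i, ContDiff ℝ 2 (f i)) (hfc : ∀ i, HasCompactSupport (f i))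
    (hfΩ : ∀ i, tsupport (f i) ⊆ Ω) :
    ∃ Ψ : (Fin k → ℝ) × F → F, ContDiff ℝ 1 Ψ ∧ (∀ x, Ψ (0, x) = x) ∧
      (∀ t, ∀ x ∈ Ω, Ψ (t, x) ∈ Ω ∧
        ∀ τ, fderiv ℝ Ψ (t, x) (τ, 0) ∈ LinearMap.range (B (Ψ (t, x))).toLinearMap) ∧
      ∀ x τ, fderiv ℝ Ψ (0, x) (τ, 0) = ∑ i, τ i • hamField B (f i) x := by
  induction k with
  | zero =>
    refine ⟨Prod.snd, contDiff_snd, fun _ => rfl, fun t x hx => ⟨hx, fun τ => ?_⟩, fun x τ => ?_⟩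
    · rw [fderiv_snd]; exact Submodule.zero_mem _
    · rw [fderiv_snd]; simp
  | succ k ih =>
    obtain ⟨Ψ, hΨ, hΨ0, hΨr, hΨd⟩ := ih (fun i => f i.succ) (fun i => hf _) (fun i => hfc _)
      (fun i => hfΩ _)
    obtain ⟨Φ, hΦ⟩ := h.exists_flow (hf 0) (hfc 0) (hfΩ 0)
    have hΦc := h.contDiff_flow (hf 0) (hfc 0) (hfΩ 0) hΦ
    let tl : (Fin (k + 1) → ℝ) →L[ℝ] (Fin k → ℝ) :=
      ContinuousLinearMap.pi fun i => ContinuousLinearMap.proj i.succ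
    let hd : (Fin (k + 1) → ℝ) →L[ℝ] ℝ := ContinuousLinearMap.proj 0
    let A : (Fin (k + 1) → ℝ) × F →L[ℝ] (Fin k → ℝ) × F :=
      (tl.comp (ContinuousLinearMap.fst ℝ _ _)).prod (ContinuousLinearMap.snd ℝ _ _)
    let a0 : (Fin (k + 1) → ℝ) × F →L[ℝ] ℝ := hd.comp (ContinuousLinearMap.fst ℝ _ _)
    have hdiffΦ : ∀ q : ℝ × F, HasFDerivAt (fun q : ℝ × F => Φ q.1 q.2)
        (((1 : ℝ →L[ℝ] ℝ).smulRight (hamField B (f 0) (Φ q.1 q.2))).coprod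
          (fderiv ℝ (Φ q.1) q.2)) q := by
      intro q
      have h0 := ((hΦc.differentiable (by norm_num)) q).hasFDerivAt
      convert! h0 using 1
      ext1 <;> ext1
      · have h1 := h0.comp_hasDerivAt q.1 ((hasDerivAt_id q.1).prodMk (hasDerivAt_const q.1 q.2))
        have := (hΦ.deriv q.2 q.1).unique h1
        simpa using this
      · rename_i w
        have h1 : HasFDerivAt (fun x : F => (q.1, x)) (ContinuousLinearMap.inr ℝ ℝ F) q.2 :=
          hasFDerivAt_prodMk_right q.1 q.2
        have h2 : HasFDerivAt (Φ q.1) _ q.2 := HasFDerivAt.comp q.2 (f := fun x : F => (q.1, x)) h0 h1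
        rw [h2.fderiv]
        simp
    have hder : ∀ p : (Fin (k + 1) → ℝ) × F, ∀ τ : Fin (k + 1) → ℝ,
        fderiv ℝ (fun p => Φ (a0 p) (Ψ (A p))) p (τ, 0) =
          τ 0 • hamField B (f 0) (Φ (a0 p) (Ψ (A p))) +
            fderiv ℝ (Φ (a0 p)) (Ψ (A p)) (fderiv ℝ Ψ (A p) (tl τ, 0)) := by
      intro p τ
      have h1 : HasFDerivAt (fun p => (a0 p, Ψ (A p)))
          (a0.prod ((fderiv ℝ Ψ (A p)).comp A)) p :=
        a0.hasFDerivAt.prodMk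
          (((hΨ.differentiable (by norm_num)) (A p)).hasFDerivAt.comp p A.hasFDerivAt)
      have h2 : HasFDerivAt (fun p => Φ (a0 p) (Ψ (A p))) _ p :=
        HasFDerivAt.comp p (f := fun p => (a0 p, Ψ (A p)))
          (g := fun q : ℝ × F => Φ q.1 q.2) (hdiffΦ (a0 p, Ψ (A p))) h1
      rw [h2.fderiv]
      simp [A, a0, hd]
    refine ⟨fun p => Φ (a0 p) (Ψ (A p)), ?_, ?_, ?_, ?_⟩
    · exact hΦc.comp (a0.contDiff.prodMk (hΨ.comp A.contDiff))
    · intro x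
      have e1 : a0 (0, x) = 0 := rfl
      have e2 : A (0, x) = (0, x) := rfl
      simp only [e1, e2]
      rw [hΨ0, hΦ.zero]
    · intro t x hx
      obtain ⟨hm, hr⟩ := hΨr (tl t) x hx
      refine ⟨h.flow_mem (hf 0) (hfc 0) (hfΩ 0) hΦ hm _, fun τ => ?_⟩
      rw [hder]
      -- The outermost time contributes a Hamiltonian vector. The inner times contribute vectors of
      -- im B pushed forward by a Hamiltonian flow, which carries im B to im B by
      -- `fderiv_flow_sharp`.
      refine Submodule.add_mem _ (Submodule.smul_mem _ _ ⟨_, rfl⟩) ?_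
      obtain ⟨ξ, hξ⟩ := hr (tl τ)
      have e2 : A (t, x) = (tl t, x) := rfl
      rw [e2, ← hξ]
      exact ⟨_, h.fderiv_flow_sharp (hf 0) (hfc 0) (hfΩ 0) hΦ hm _ ξ⟩
    · intro x τ
      rw [hder]
      have e1 : a0 (0, x) = 0 := rfl
      have e2 : A (0, x) = (0, x) := rfl
      have e3 : Φ 0 = id := funext hΦ.zero
      rw [e1, e2, hΨ0, e3, hΨd, fderiv_id, Fin.sum_univ_succ]
      simp [tl]

lemma exists_cutoff_linear (h : IsLocalPoisson Ω B) {m : F} (hm : m ∈ Ω) (ξ : F →L[ℝ] ℝ) :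
    ∃ f : F → ℝ, ContDiff ℝ 2 f ∧ HasCompactSupport f ∧ tsupport f ⊆ Ω ∧
      hamField B f m = B m ξ := by
  obtain ⟨r, hr, hrΩ⟩ := Metric.isOpen_iff.1 h.isOpen m hm
  let β : ContDiffBump m := ⟨r / 4, r / 2, by linarith, by linarith⟩
  have hts : tsupport (fun x => β x * ξ x) ⊆ Metric.closedBall m (r / 2) := by
    refine (tsupport_mul_subset_left (f := β) (g := ξ)).trans ?_
    rw [β.tsupport_eq]
  refine ⟨fun x => β x * ξ x, β.contDiff.mul ξ.contDiff, β.hasCompactSupport.mul_right,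
    hts.trans ((Metric.closedBall_subset_ball (by linarith)).trans hrΩ), ?_⟩
  have : (fun x => β x * ξ x) =ᶠ[𝓝 m] ξ := by
    filter_upwards [β.eventuallyEq_one] with x hx
    rw [hx]; simp
  rw [hamField, this.fderiv_eq, ξ.fderiv]

/-- Local Casimir functions of a Poisson tensor of constant rank, in the form of a `C¹` map `v`
with kernel `im B`; near each point the level sets of `v` are connected, so that any other map
which is constant along `im B` factors through `v`. -/
theorem exists_casimirs (h : IsLocalPoisson Ω B) {r : ℕ}
    (hr : ∀ x ∈ Ω, Module.finrank ℝ (LinearMap.range (B x).toLinearMap) = r) {m : F}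
    (hm : m ∈ Ω) :
    ∃ O : Set F, IsOpen O ∧ m ∈ O ∧ O ⊆ Ω ∧ ∃ v : F → F, ContDiffOn ℝ 1 v O ∧
      (∀ x ∈ O, ∀ u, fderiv ℝ v x u = 0 ↔ u ∈ LinearMap.range (B x).toLinearMap) ∧
      ∀ x ∈ O, ∀ v' : F → F, ∀ O' ∈ 𝓝 x, (∀ y ∈ O', DifferentiableAt ℝ v' y ∧
        ∀ ξ, fderiv ℝ v' y (B y ξ) = 0) →
        ∀ᶠ y in 𝓝 x, v y = v x → v' y = v' x := by
  have := FiniteDimensional.complete ℝ F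
  let R := LinearMap.range (B m).toLinearMap
  let bR := Module.finBasisOfFinrankEq ℝ R (hr m hm)
  have hex : ∀ i, ∃ ξ, B m ξ = bR i := fun i => (bR i).2
  choose ξ hξ using hex
  choose f hf hfc hfΩ hfm using fun i => h.exists_cutoff_linear hm (ξ i)
  obtain ⟨Ψ, hΨ, hΨ0, hΨr, hΨd⟩ := h.exists_composed_flow r f hf hfc hfΩ
  obtain ⟨C, hC⟩ := R.exists_isCompl
  let J : (Fin r → ℝ) × C →L[ℝ] (Fin r → ℝ) × F :=
    (ContinuousLinearMap.fst ℝ _ _).prod (C.subtypeL.comp (ContinuousLinearMap.snd ℝ _ _))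
  -- Foliated coordinates: start at w + m with w in a complement C of im B m, then flow for times t
  -- along r Hamiltonian fields that span im B at m. The Casimir map v will be the coordinate w,
  -- viewed in F.
  let G : (Fin r → ℝ) × C → F := fun q => Ψ (J q + (0, m))
  have hG : ContDiff ℝ 1 G := hΨ.comp (J.contDiff.add contDiff_const)
  have hGd : ∀ q τ, fderiv ℝ G q (τ, 0) = fderiv ℝ Ψ (J q + (0, m)) (τ, 0) := by
    intro q τ
    have h1 : HasFDerivAt G _ q :=
      ((hΨ.differentiable (by norm_num)) (J q + (0, m))).hasFDerivAt.comp q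
        (J.hasFDerivAt.add_const (0, m))
    rw [h1.fderiv]
    simp [J]
  have hG0 : ∀ w : C, G (0, w) = w + m := by
    intro w
    have : J (0, w) + (0, m) = (0, w + m) := by simp [J]
    simp only [G, this, hΨ0]
  have hGd0 : ∀ w : C, fderiv ℝ G 0 (0, w) = w := by
    intro w
    have h1 := ((hG.differentiable (by norm_num)) 0).hasFDerivAt.comp (0 : C)
      (f := fun w : C => ((0 : Fin r → ℝ), w)) (hasFDerivAt_prodMk_right (0 : Fin r → ℝ) (0 : C))
    have h2 : HasFDerivAt (fun w : C => G (0, w)) C.subtypeL 0 := by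
      simp only [hG0]
      exact C.subtypeL.hasFDerivAt.add_const m
    have := congrArg (fun L : C →L[ℝ] F => L w) (h1.unique h2)
    simpa using this
  have hGd1 : ∀ τ w, fderiv ℝ G 0 (τ, w) = ∑ i, τ i • (bR i : F) + w := by
    intro τ w
    have : ((τ, w) : (Fin r → ℝ) × C) = (τ, 0) + (0, w) := by simp
    rw [this, map_add, hGd0, hGd]
    have e : J 0 + (0, m) = (0, m) := by simp
    rw [e, hΨd]
    simp [hfm, hξ]
  have hinj : Function.Injective (fderiv ℝ G 0) := by
    rw [injective_iff_map_eq_zero]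
    rintro ⟨τ, w⟩ hq
    rw [hGd1] at hq
    have hs : (∑ i, τ i • (bR i : F)) ∈ R := Submodule.sum_mem _ fun i _ =>
      R.smul_mem _ (bR i).2
    have hw : (w : F) ∈ R := by
      have : (w : F) = -∑ i, τ i • (bR i : F) := by rw [eq_neg_iff_add_eq_zero, add_comm]; exact hq
      rw [this]; exact R.neg_mem hs
    have hw0 : (w : F) = 0 := (Submodule.disjoint_def.1 hC.disjoint) _ hw w.2
    rw [hw0, add_zero] at hq
    have hq' : ∑ i, τ i • bR i = 0 := by
      apply Subtype.ext
      simpa using hq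
    have hτ : τ = 0 := funext fun i => Fintype.linearIndependent_iff.1 bR.linearIndependent τ hq' i
    rw [hτ, show w = 0 from Subtype.ext hw0]; rfl
  have hdim : Module.finrank ℝ ((Fin r → ℝ) × C) = Module.finrank ℝ F := by
    rw [Module.finrank_prod, Module.finrank_fin_fun, ← hr m hm]
    exact Submodule.finrank_add_eq_of_isCompl hC
  let L : ((Fin r → ℝ) × C) ≃L[ℝ] F :=
    (LinearEquiv.ofInjectiveOfFinrankEq (fderiv ℝ G 0).toLinearMap hinj hdim).toContinuousLinearEquiv
  have hL : HasFDerivAt G (L : ((Fin r → ℝ) × C) →L[ℝ] F) 0 := by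
    convert! ((hG.differentiable (by norm_num)) 0).hasFDerivAt using 1
  let e := hG.contDiffAt.toOpenPartialHomeomorph G hL (by norm_num)
  have he : ∀ q, e q = G q := fun q => rfl
  have h0e : (0 : (Fin r → ℝ) × C) ∈ e.source :=
    hG.contDiffAt.mem_toOpenPartialHomeomorph_source hL (by norm_num)
  have hem : e 0 = m := by
    have h1 : G (0, 0) = m := by simpa using hG0 0
    exact h1
  have hsymm : ContDiffAt ℝ 1 e.symm m := by
    have := hG.contDiffAt.to_localInverse hL (by norm_num)
    have hm' : G 0 = m := hem
    rw [hm'] at this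
    exact this
  obtain ⟨O₁, hO₁, hO₁o, hmO₁⟩ := eventually_nhds_iff.1 (hsymm.eventually (by simp))
  have hsnd : ∀ y ∈ e.target ∩ O₁, HasFDerivAt (fun y => ((e.symm y).2 : F))
      (C.subtypeL.comp ((ContinuousLinearMap.snd ℝ _ _).comp (fderiv ℝ e.symm y))) y := by
    intro y hy
    have h1 := ((hO₁ y hy.2).differentiableAt (by norm_num)).hasFDerivAt
    exact C.subtypeL.hasFDerivAt.comp y
      ((ContinuousLinearMap.snd ℝ (Fin r → ℝ) C).hasFDerivAt.comp y h1)
  have hinv1 : ∀ y ∈ e.target ∩ O₁, ∀ q, fderiv ℝ e.symm y (fderiv ℝ G (e.symm y) q) = q := by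
    intro y hy q
    have h1 := ((hO₁ y hy.2).differentiableAt (by norm_num)).hasFDerivAt
    have hGy : G (e.symm y) = y := e.right_inv hy.1
    have h2 := ((hG.differentiable (by norm_num)) (e.symm y)).hasFDerivAt
    rw [← hGy] at h1
    have h3 := h1.comp (e.symm y) h2
    have h4 : (e.symm ∘ G) =ᶠ[𝓝 (e.symm y)] id := by
      filter_upwards [e.open_source.mem_nhds (e.map_target hy.1)] with q hq using e.left_inv hq
    have h5 := congrArg (fun L : _ →L[ℝ] _ => L q)
      (h3.unique ((hasFDerivAt_id (e.symm y)).congr_of_eventuallyEq h4))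
    rw [hGy] at h5
    exact h5
  have hinv2 : ∀ y ∈ e.target ∩ O₁, ∀ u, fderiv ℝ G (e.symm y) (fderiv ℝ e.symm y u) = u := by
    intro y hy u
    have h1 := ((hO₁ y hy.2).differentiableAt (by norm_num)).hasFDerivAt
    have h2 := ((hG.differentiable (by norm_num)) (e.symm y)).hasFDerivAt
    have h3 := h2.comp y h1
    have h4 : (G ∘ e.symm) =ᶠ[𝓝 y] id := by
      filter_upwards [e.open_target.mem_nhds hy.1] with q hq using e.right_inv hq
    exact congrArg (fun L : _ →L[ℝ] _ => L u)
      (h3.unique ((hasFDerivAt_id y).congr_of_eventuallyEq h4))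
  have hJΩ : IsOpen {y | y ∈ e.target ∧ (e.symm y).2.1 + m ∈ Ω} := by
    have : {y | y ∈ e.target ∧ (e.symm y).2.1 + m ∈ Ω} =
        e.target ∩ e.symm ⁻¹' {q | (q.2 : F) + m ∈ Ω} := rfl
    rw [this]
    exact e.isOpen_inter_preimage_symm (h.isOpen.preimage (by fun_prop))
  have hemt : m ∈ e.target := hem ▸ e.map_source h0e
  have hem0 : e.symm m = 0 := by rw [← hem, e.left_inv h0e]
  refine ⟨(e.target ∩ O₁) ∩ ({y | y ∈ e.target ∧ (e.symm y).2.1 + m ∈ Ω} ∩ Ω),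
    (e.open_target.inter hO₁o).inter (hJΩ.inter h.isOpen),
    ⟨⟨hemt, hmO₁⟩, ⟨hemt, by simpa [hem0] using hm⟩, hm⟩, fun y hy => hy.2.2,
    fun y => ((e.symm y).2 : F), fun y hy => ?_, fun y hy u => ?_, ?_⟩
  · have : ContDiffAt ℝ 1 (fun y => ((e.symm y).2 : F)) y :=
      C.subtypeL.contDiff.contDiffAt.comp y (contDiff_snd.contDiffAt.comp y (hO₁ y hy.1.2))
    exact this.contDiffWithinAt
  · rw [(hsnd y hy.1).fderiv]
    have hJq : J (e.symm y) + (0, m) = ((e.symm y).1, (e.symm y).2.1 + m) := by simp [J]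
    have hGy : G (e.symm y) = y := e.right_inv hy.1.1
    have hΨy : Ψ ((e.symm y).1, (e.symm y).2.1 + m) = y := by rw [← hJq]; exact hGy
    have hsub : ∀ τ, fderiv ℝ G (e.symm y) (τ, 0) ∈ LinearMap.range (B y).toLinearMap := by
      intro τ
      have := (hΨr (e.symm y).1 _ hy.2.1.2).2 τ
      rw [hΨy] at this
      rwa [hGd, hJq]
    have hker : ∀ u, (C.subtypeL.comp ((ContinuousLinearMap.snd ℝ _ _).comp
        (fderiv ℝ e.symm y))) u = 0 ↔ (fderiv ℝ e.symm y u).2 = 0 := fun u => by simp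
    rw [hker]
    have hfwd : ∀ u, (fderiv ℝ e.symm y u).2 = 0 → u = fderiv ℝ G (e.symm y)
        ((fderiv ℝ e.symm y u).1, 0) := by
      intro u hu
      conv_lhs => rw [← hinv2 y hy.1 u]
      rw [← hu]
    refine ⟨fun hu => by rw [hfwd u hu]; exact hsub _, fun hu => ?_⟩
    let T : (Fin r → ℝ) →ₗ[ℝ] F := (fderiv ℝ G (e.symm y)).toLinearMap.comp (LinearMap.inl ℝ _ _)
    have hTinj : Function.Injective T := by
      intro a b hab
      have : fderiv ℝ e.symm y (T a) = fderiv ℝ e.symm y (T b) := by rw [hab]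
      have h1 := hinv1 y hy.1 (a, 0)
      have h2 := hinv1 y hy.1 (b, 0)
      have h3 : ((a, 0) : (Fin r → ℝ) × C) = (b, 0) := by
        rw [← h1, ← h2]; exact this
      exact congrArg Prod.fst h3
    -- The t-directions always lie in im B y and span an r-dimensional space. Constant rank forces
    -- equality away from m as well, which identifies the kernel of the derivative of v.
    have hTr : LinearMap.range T = LinearMap.range (B y).toLinearMap := by
      refine Submodule.eq_of_le_of_finrank_eq ?_ ?_
      · rintro _ ⟨τ, rfl⟩; exact hsub τ
      · rw [LinearMap.finrank_range_of_inj hTinj, hr y hy.2.2, Module.finrank_fin_fun]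
    rw [← hTr] at hu
    obtain ⟨τ, rfl⟩ := hu
    have := hinv1 y hy.1 (τ, 0)
    change (fderiv ℝ e.symm y (fderiv ℝ G (e.symm y) (τ, 0))).2 = 0
    rw [this]
  · intro x hx v' O' hO' hv'
    have hGx : G (e.symm x) = x := e.right_inv hx.1.1
    have hGO : G ⁻¹' (O' ∩ Ω) ∩ {q | (q.2 : F) + m ∈ Ω} ∈ 𝓝 (e.symm x) := by
      refine inter_mem (hG.continuous.continuousAt.preimage_mem_nhds ?_) ?_
      · rw [hGx]; exact inter_mem hO' (h.isOpen.mem_nhds hx.2.2)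
      · exact (h.isOpen.preimage (by fun_prop : Continuous fun q : (Fin r → ℝ) × C =>
          (q.2 : F) + m)).mem_nhds hx.2.1.2
    obtain ⟨ρ, hρ, hball⟩ := Metric.mem_nhds_iff.1 hGO
    have hnear : ∀ᶠ y in 𝓝 x, e.symm y ∈ Metric.ball (e.symm x) ρ :=
      (e.symm.continuousAt hx.1.1).eventually (Metric.ball_mem_nhds _ hρ)
    filter_upwards [hnear, e.open_target.mem_nhds hx.1.1] with y hy hyt hvy
    have hw : (e.symm y).2 = (e.symm x).2 := Subtype.ext hvy
    set w := (e.symm x).2 with hwdef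
    have hin : ∀ t ∈ Metric.ball (e.symm x).1 ρ, ((t, w) : (Fin r → ℝ) × C) ∈
        Metric.ball (e.symm x) ρ := by
      intro t ht
      rw [Metric.mem_ball, Prod.dist_eq]
      simpa [hwdef, hρ] using ht
    -- The level of v through x is near x the image of a ball of times, which is connected. A map
    -- killed by im B is constant along it, since the t-derivatives of G lie in im B.
    have hder : ∀ t ∈ Metric.ball (e.symm x).1 ρ,
        HasFDerivAt (fun t => v' (G (t, w))) (0 : (Fin r → ℝ) →L[ℝ] F) t := by
      intro t ht
      have hq := hball (hin t ht)
      have hd := hv' _ hq.1.1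
      have h1 := ((hG.differentiable (by norm_num)) (t, w)).hasFDerivAt.comp t
        (f := fun t : Fin r → ℝ => (t, w)) (hasFDerivAt_prodMk_left t w)
      have h2 := hd.1.hasFDerivAt.comp t h1
      convert! h2 using 1
      ext1 τ
      have hmem := (hΨr t _ hq.2).2 τ
      have e1 : J (t, w) + (0, m) = (t, w + m) := by simp [J]
      have e2 : fderiv ℝ G (t, w) (τ, 0) = fderiv ℝ Ψ (t, (w : F) + m) (τ, 0) := by rw [hGd, e1]
      obtain ⟨ζ, hζ⟩ := hmem
      have e3 : Ψ (t, (w : F) + m) = G (t, w) := by simp only [G, e1]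
      have h4 := hd.2 ζ
      rw [← e3] at h4
      simp only [ContinuousLinearMap.comp_apply, ContinuousLinearMap.inl_apply, zero_apply]
      rw [e2, ← hζ, ← e3]
      exact h4.symm
    have hconst := (convex_ball (e.symm x).1 ρ).is_const_of_fderivWithin_eq_zero (𝕜 := ℝ)
      (f := fun t => v' (G (t, w)))
      (fun t ht => (hder t ht).differentiableAt.differentiableWithinAt)
      (fun t ht => ((hder t ht).hasFDerivWithinAt.fderivWithin
        (Metric.isOpen_ball.uniqueDiffWithinAt ht)))
      (x := (e.symm y).1) (y := (e.symm x).1) (by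
        rw [Metric.mem_ball, Prod.dist_eq] at hy
        exact (le_max_left _ _).trans_lt hy) (Metric.mem_ball_self hρ)
    have ey : G ((e.symm y).1, w) = y := by
      rw [← hw]; exact e.right_inv hyt
    have ex : G ((e.symm x).1, w) = x := hGx
    simpa only [ey, ex] using hconst

end IsLocalPoisson

end Foliation

/-! ### Derivatives of charts and extension of functions from a chart. -/

section Charts

open Filter

variable {E : Type*} [NormedAddCommGroup E] [NormedSpace ℝ E]
  {M : Type*} [TopologicalSpace M] [ChartedSpace E M]

/-- The derivative of a chart, with the tangent spaces of `M` identified with the model space. -/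
def chartDeriv (e : OpenPartialHomeomorph M E) (x : M) : E →L[ℝ] E :=
  mfderiv 𝓘(ℝ, E) 𝓘(ℝ, E) e x

/-- The derivative of the inverse of a chart. -/
def chartDerivSymm (e : OpenPartialHomeomorph M E) (y : E) : E →L[ℝ] E :=
  mfderiv 𝓘(ℝ, E) 𝓘(ℝ, E) e.symm y

variable {e : OpenPartialHomeomorph M E} {x : M} {k : WithTop ℕ∞}

section C1

variable [IsManifold 𝓘(ℝ, E) 1 M]

lemma hasMFDerivAt_chart (he : e ∈ IsManifold.maximalAtlas 𝓘(ℝ, E) 1 M) (hx : x ∈ e.source) :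
    HasMFDerivAt 𝓘(ℝ, E) 𝓘(ℝ, E) e x (chartDeriv (E := E) e x) :=
  (((contMDiffOn_of_mem_maximalAtlas he).contMDiffAt (e.open_source.mem_nhds hx)).mdifferentiableAt
    (by norm_num)).hasMFDerivAt

lemma hasMFDerivAt_chart_symm (he : e ∈ IsManifold.maximalAtlas 𝓘(ℝ, E) 1 M) {y : E}
    (hy : y ∈ e.target) : HasMFDerivAt 𝓘(ℝ, E) 𝓘(ℝ, E) e.symm y (chartDerivSymm (E := E) e y) :=
  (((contMDiffOn_symm_of_mem_maximalAtlas he).contMDiffAt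
    (e.open_target.mem_nhds hy)).mdifferentiableAt (by norm_num)).hasMFDerivAt

lemma chartDeriv_symm_apply (he : e ∈ IsManifold.maximalAtlas 𝓘(ℝ, E) 1 M) (hx : x ∈ e.source)
    (u : E) : chartDeriv e x (chartDerivSymm e (e x) u) = u := by
  have h1 := hasMFDerivAt_chart_symm he (e.map_source hx)
  have h2 : HasMFDerivAt 𝓘(ℝ, E) 𝓘(ℝ, E) e (e.symm (e x)) (chartDeriv (E := E) e x) := by
    rw [e.left_inv hx]; exact hasMFDerivAt_chart he hx
  have h3 := (h2.comp (e x) h1).congr_of_eventuallyEq (f₁ := id) (by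
    filter_upwards [e.open_target.mem_nhds (e.map_source hx)] with y hy
    exact (e.right_inv hy).symm)
  have h4 := hasMFDerivAt_unique (hasMFDerivAt_id (I := 𝓘(ℝ, E)) (e x)) h3
  exact (congrArg (fun L : E →L[ℝ] E => L u) h4).symm

lemma chartDerivSymm_apply (he : e ∈ IsManifold.maximalAtlas 𝓘(ℝ, E) 1 M) (hx : x ∈ e.source)
    (u : E) : chartDerivSymm e (e x) (chartDeriv e x u) = u := by
  have h1 := hasMFDerivAt_chart_symm he (e.map_source hx)
  have h2 := hasMFDerivAt_chart he hx
  have h3 := (h1.comp x h2).congr_of_eventuallyEq (f₁ := id) (by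
    filter_upwards [e.open_source.mem_nhds hx] with y hy
    exact (e.left_inv hy).symm)
  have h4 := hasMFDerivAt_unique (hasMFDerivAt_id (I := 𝓘(ℝ, E)) x) h3
  exact (congrArg (fun L : E →L[ℝ] E => L u) h4).symm

/-- The derivative of a chart as an equivalence. -/
def chartDerivEquiv (he : e ∈ IsManifold.maximalAtlas 𝓘(ℝ, E) 1 M) (hx : x ∈ e.source) :
    E ≃L[ℝ] E :=
  ContinuousLinearEquiv.equivOfInverse (chartDeriv e x) (chartDerivSymm e (e x))
    (chartDerivSymm_apply he hx) (chartDeriv_symm_apply he hx)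

lemma chartDeriv_injective (he : e ∈ IsManifold.maximalAtlas 𝓘(ℝ, E) 1 M) (hx : x ∈ e.source) :
    Function.Injective (chartDeriv e x) := (chartDerivEquiv he hx).injective

lemma hasFDerivAt_comp_symm (he : e ∈ IsManifold.maximalAtlas 𝓘(ℝ, E) 1 M) (hx : x ∈ e.source)
    {G : Type*} [NormedAddCommGroup G] [NormedSpace ℝ G] {f : M → G} {f' : E →L[ℝ] G}
    (hf : HasMFDerivAt 𝓘(ℝ, E) 𝓘(ℝ, G) f x f') :
    HasFDerivAt (f ∘ e.symm) (f'.comp (chartDerivSymm e (e x))) (e x) := by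
  have h1 : HasMFDerivAt 𝓘(ℝ, E) 𝓘(ℝ, G) f (e.symm (e x)) f' := by rwa [e.left_inv hx]
  exact (h1.comp (e x) (hasMFDerivAt_chart_symm he (e.map_source hx))).hasFDerivAt

lemma mfderiv_eq_comp_chartDeriv (he : e ∈ IsManifold.maximalAtlas 𝓘(ℝ, E) 1 M)
    (hx : x ∈ e.source) {G : Type*} [NormedAddCommGroup G] [NormedSpace ℝ G] {f : M → G}
    (hf : MDifferentiableAt 𝓘(ℝ, E) 𝓘(ℝ, G) f x) (u : E) :
    (mfderiv 𝓘(ℝ, E) 𝓘(ℝ, G) f x : E →L[ℝ] G) u =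
      fderiv ℝ (f ∘ e.symm) (e x) (chartDeriv e x u) := by
  rw [(hasFDerivAt_comp_symm he hx hf.hasMFDerivAt).fderiv]
  exact congrArg (mfderiv 𝓘(ℝ, E) 𝓘(ℝ, G) f x : E →L[ℝ] G) (chartDerivSymm_apply he hx u).symm

/-- Integral curves in a chart. -/
lemma IsMIntegralCurveOn.hasDerivWithinAt_chart
    (he : e ∈ IsManifold.maximalAtlas 𝓘(ℝ, E) 1 M) {c : ℝ → M}
    {X : ∀ x : M, TangentSpace 𝓘(ℝ, E) x} {s : Set ℝ} (hc : IsMIntegralCurveOn c X s) {t : ℝ}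
    (ht : t ∈ s) (hx : c t ∈ e.source) :
    HasDerivWithinAt (e ∘ c) (chartDeriv e (c t) (X (c t))) s t := by
  have h1 := ((hasMFDerivAt_chart he hx).comp_hasMFDerivWithinAt t (hc t ht)).hasFDerivWithinAt
  let w : E := X (c t)
  have h2 : HasFDerivWithinAt (e ∘ c)
    ((chartDeriv e (c t)).comp ((1 : ℝ →L[ℝ] ℝ).smulRight w)) s t := h1
  have h3 := h2.hasDerivWithinAt
  simpa using h3

lemma hasMFDerivWithinAt_symm_comp (he : e ∈ IsManifold.maximalAtlas 𝓘(ℝ, E) 1 M) {u : ℝ → E}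
    {X : ∀ x : M, TangentSpace 𝓘(ℝ, E) x} {s : Set ℝ} {t : ℝ} (hx : u t ∈ e.target)
    (hu : HasDerivWithinAt u (chartDeriv e (e.symm (u t)) (X (e.symm (u t)))) s t) :
    HasMFDerivWithinAt 𝓘(ℝ, ℝ) 𝓘(ℝ, E) (fun t => e.symm (u t)) s t
      ((1 : ℝ →L[ℝ] ℝ).smulRight (X (e.symm (u t)))) := by
  have h1 := (hasMFDerivAt_chart_symm he hx).comp_hasMFDerivWithinAt t
    hu.hasFDerivWithinAt.hasMFDerivWithinAt
  have h2 := chartDerivSymm_apply he (e.map_target hx) (X (e.symm (u t)))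
  rw [e.right_inv hx] at h2
  let w : E := X (e.symm (u t))
  have h3 : (chartDerivSymm e (u t)).comp
      (ContinuousLinearMap.toSpanSingleton ℝ (chartDeriv e (e.symm (u t)) w)) =
        (1 : ℝ →L[ℝ] ℝ).smulRight w := by
    ext1
    have h4 : chartDerivSymm e (u t) (chartDeriv e (e.symm (u t)) w) = w := h2
    simp [h4]
  exact h3 ▸ h1

end C1

lemma mem_maximalAtlas_one (he : e ∈ IsManifold.maximalAtlas 𝓘(ℝ, E) ∞ M) :
    e ∈ IsManifold.maximalAtlas 𝓘(ℝ, E) 1 M :=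
  IsManifold.maximalAtlas_subset_of_le (by norm_num) he

/-- Extension by zero of a function given in a chart. -/
def liftFun (e : OpenPartialHomeomorph M E) (u : E → ℝ) : M → ℝ := e.source.indicator (u ∘ e)

lemma liftFun_of_mem (u : E → ℝ) (hx : x ∈ e.source) : liftFun e u x = u (e x) :=
  indicator_of_mem hx _

lemma isClosed_symm_image [T2Space M] {K : Set E} (hK : IsCompact K) (hKe : K ⊆ e.target) :
    IsClosed (e.symm '' K) :=
  (hK.image_of_continuousOn (e.continuousOn_symm.mono hKe)).isClosed

lemma liftFun_eq_zero {u : E → ℝ} (hx : x ∉ e.symm '' tsupport u) : liftFun e u x = 0 := by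
  by_cases hs : x ∈ e.source
  · rw [liftFun_of_mem u hs]
    by_contra h
    exact hx ⟨e x, subset_tsupport u h, e.left_inv hs⟩
  · exact indicator_of_notMem hs _

lemma liftFun_eventuallyEq_zero [T2Space M] {u : E → ℝ} (hu : HasCompactSupport u)
    (hue : tsupport u ⊆ e.target) (hx : x ∉ e.symm '' tsupport u) : liftFun e u =ᶠ[𝓝 x] 0 := by
  filter_upwards [(isClosed_symm_image hu hue).isOpen_compl.mem_nhds hx] with y hy
  exact liftFun_eq_zero hy

lemma liftFun_comp_symm (u : E → ℝ) : EqOn (liftFun e u ∘ e.symm) u e.target := fun y hy => by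
  rw [Function.comp_apply, liftFun_of_mem u (e.map_target hy), e.right_inv hy]

lemma contMDiff_liftFun [T2Space M] [IsManifold 𝓘(ℝ, E) k M]
    (he : e ∈ IsManifold.maximalAtlas 𝓘(ℝ, E) k M) {u : E → ℝ} (hu : ContDiff ℝ k u)
    (huc : HasCompactSupport u) (hue : tsupport u ⊆ e.target) :
    ContMDiff 𝓘(ℝ, E) 𝓘(ℝ, ℝ) k (liftFun e u) := by
  intro x
  by_cases hx : x ∈ e.source
  · have h1 : ContMDiffAt 𝓘(ℝ, E) 𝓘(ℝ, ℝ) k (u ∘ e) x :=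
      hu.contMDiff.contMDiffAt.comp x
        ((contMDiffOn_of_mem_maximalAtlas he).contMDiffAt (e.open_source.mem_nhds hx))
    refine h1.congr_of_eventuallyEq ?_
    filter_upwards [e.open_source.mem_nhds hx] with y hy using liftFun_of_mem u hy
  · refine (contMDiffAt_const (c := (0 : ℝ))).congr_of_eventuallyEq
      (liftFun_eventuallyEq_zero huc hue ?_)
    rintro ⟨y, hy, rfl⟩
    exact hx (e.map_target (hue hy))

lemma contDiffOn_comp_symm [IsManifold 𝓘(ℝ, E) k M]
    (he : e ∈ IsManifold.maximalAtlas 𝓘(ℝ, E) k M) {G : Type*} [NormedAddCommGroup G]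
    [NormedSpace ℝ G] {f : M → G} (hf : ContMDiff 𝓘(ℝ, E) 𝓘(ℝ, G) k f) :
    ContDiffOn ℝ k (f ∘ e.symm) e.target :=
  (hf.comp_contMDiffOn (contMDiffOn_symm_of_mem_maximalAtlas he)).contDiffOn

/-- A `C^k` function on an open set agrees near a given compactly contained ball with a globally
defined compactly supported function. -/
lemma exists_cutoff [FiniteDimensional ℝ E] {G : Type*} [NormedAddCommGroup G] [NormedSpace ℝ G]
    {n : ℕ∞} {Ω : Set E} (hΩ : IsOpen Ω) {y : E} (hy : y ∈ Ω) {u : E → G}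
    (hu : ContDiffOn ℝ n u Ω) :
    ∃ w : E → G, ContDiff ℝ n w ∧ HasCompactSupport w ∧ tsupport w ⊆ Ω ∧
      ∃ V, IsOpen V ∧ y ∈ V ∧ V ⊆ Ω ∧ EqOn w u V := by
  obtain ⟨r, hr, hrΩ⟩ := Metric.isOpen_iff.1 hΩ y hy
  let β : ContDiffBump y := ⟨r / 4, r / 2, by linarith, by linarith⟩
  have hts : tsupport (fun x => β x • u x) ⊆ Metric.closedBall y (r / 2) := by
    refine (tsupport_smul_subset_left β u).trans ?_
    rw [β.tsupport_eq]
  have hsub : tsupport (fun x => β x • u x) ⊆ Ω :=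
    hts.trans ((Metric.closedBall_subset_ball (by linarith)).trans hrΩ)
  refine ⟨fun x => β x • u x, ?_, β.hasCompactSupport.smul_right, hsub,
    Metric.ball y (r / 4), Metric.isOpen_ball, Metric.mem_ball_self (by linarith),
    (Metric.ball_subset_ball (by linarith)).trans hrΩ, fun x hx => ?_⟩
  · rw [contDiff_iff_contDiffAt]
    intro x
    by_cases hx : x ∈ tsupport (fun x => β x • u x)
    · exact β.contDiff.contDiffAt.smul (hu.contDiffAt (hΩ.mem_nhds (hsub hx)))
    · exact contDiffAt_const.congr_of_eventuallyEq (notMem_tsupport_iff_eventuallyEq.1 hx)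
  · simp only
    rw [β.one_of_mem_closedBall (Metric.ball_subset_closedBall hx), one_smul]

end Charts

/-! ### The Poisson tensor of the manifold in a chart. -/

section Tensor

open Filter

variable {E : Type*} [NormedAddCommGroup E] [NormedSpace ℝ E] [FiniteDimensional ℝ E]
  {M : Type*} [TopologicalSpace M] [ChartedSpace E M]
  {e : OpenPartialHomeomorph M E} {x : M} (π : PoissonStructure E M)

/-- The bundle map of a Poisson structure, with tangent spaces identified with the model space. -/
def PoissonStructure.sharpE (x : M) : (E →L[ℝ] ℝ) →ₗ[ℝ] E := π.sharp x

/-- The Poisson tensor in a chart. -/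
def PoissonStructure.tensor (e : OpenPartialHomeomorph M E) (y : E) : (E →L[ℝ] ℝ) →L[ℝ] E :=
  LinearMap.toContinuousLinearMap ((chartDeriv e (e.symm y)).toLinearMap ∘ₗ
    π.sharpE (e.symm y) ∘ₗ (ContinuousLinearMap.precomp ℝ (chartDeriv e (e.symm y))).toLinearMap)

lemma PoissonStructure.tensor_apply (hx : x ∈ e.source) (η : E →L[ℝ] ℝ) :
    π.tensor e (e x) η = chartDeriv e x (π.sharpE x (η.comp (chartDeriv e x))) := by
  have h : ∀ z, z = x → (chartDeriv e z (π.sharpE z (η.comp (chartDeriv e z)))) =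
    chartDeriv e x (π.sharpE x (η.comp (chartDeriv e x))) := by rintro z rfl; rfl
  exact h _ (e.left_inv hx)

lemma dAt_eq_comp [IsManifold 𝓘(ℝ, E) 1 M] (he : e ∈ IsManifold.maximalAtlas 𝓘(ℝ, E) 1 M)
    (hx : x ∈ e.source) {f : M → ℝ} (hf : MDifferentiableAt 𝓘(ℝ, E) 𝓘(ℝ, ℝ) f x) :
    (dAt (E := E) f x : E →L[ℝ] ℝ) = (fderiv ℝ (f ∘ e.symm) (e x)).comp (chartDeriv e x) := by
  refine ContinuousLinearMap.ext fun u => ?_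
  exact mfderiv_eq_comp_chartDeriv he hx hf u

lemma PoissonStructure.chartDeriv_hamVF [IsManifold 𝓘(ℝ, E) 1 M]
    (he : e ∈ IsManifold.maximalAtlas 𝓘(ℝ, E) 1 M)
    (hx : x ∈ e.source) {f : M → ℝ} (hf : MDifferentiableAt 𝓘(ℝ, E) 𝓘(ℝ, ℝ) f x) :
    chartDeriv e x (π.hamVF f x) = hamField (π.tensor e) (f ∘ e.symm) (e x) := by
  rw [hamField, π.tensor_apply hx, ← dAt_eq_comp he hx hf]
  rfl

lemma PoissonStructure.bracket_eq [IsManifold 𝓘(ℝ, E) 1 M]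
    (he : e ∈ IsManifold.maximalAtlas 𝓘(ℝ, E) 1 M)
    (hx : x ∈ e.source) {f g : M → ℝ} (hf : MDifferentiableAt 𝓘(ℝ, E) 𝓘(ℝ, ℝ) f x)
    (hg : MDifferentiableAt 𝓘(ℝ, E) 𝓘(ℝ, ℝ) g x) :
    dAt (E := E) f x (π.sharp x (dAt (E := E) g x)) =
      fderiv ℝ (f ∘ e.symm) (e x) (π.tensor e (e x) (fderiv ℝ (g ∘ e.symm) (e x))) := by
  have h1 := π.chartDeriv_hamVF he hx hg
  have h2 := dAt_eq_comp he hx hf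
  rw [hamField] at h1
  rw [← h1]
  exact congrArg (fun L : E →L[ℝ] ℝ => L (π.hamVF g x)) h2

variable [T2Space M] [IsManifold 𝓘(ℝ, E) ∞ M]

lemma isManifold_one : IsManifold 𝓘(ℝ, E) 1 M := IsManifold.of_le (n := ∞) (by norm_num)

lemma isManifold_two : IsManifold 𝓘(ℝ, E) 2 M := IsManifold.of_le (n := ∞) (by norm_cast)

/-- Smooth functions on `M` with prescribed linear germ in a chart. -/
lemma exists_lift_linear (he : e ∈ IsManifold.maximalAtlas 𝓘(ℝ, E) ∞ M) {y : E}
    (hy : y ∈ e.target) (α : E →L[ℝ] ℝ) :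
    ∃ f : M → ℝ, ContMDiff 𝓘(ℝ, E) 𝓘(ℝ, ℝ) ∞ f ∧ (f ∘ e.symm) =ᶠ[𝓝 y] α := by
  obtain ⟨w, hw, hwc, hwe, V, hV, hyV, hVe, hVw⟩ :=
    exists_cutoff (n := ⊤) e.open_target hy (u := α) α.contDiff.contDiffOn
  refine ⟨liftFun e w, contMDiff_liftFun he hw hwc hwe, ?_⟩
  filter_upwards [hV.mem_nhds hyV] with z hz
  rw [liftFun_comp_symm w (hVe hz), hVw hz]

/-- The axioms of a Poisson structure speak only of brackets of globally smooth functions. Functions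
that are linear near a point in the chart have brackets equal there to the entries of the tensor,
which transfers smoothness and Jacobi. -/
lemma PoissonStructure.bracket_lift_eventuallyEq
    (he : e ∈ IsManifold.maximalAtlas 𝓘(ℝ, E) ∞ M) {y : E}
    (hy : y ∈ e.target) {α β : E →L[ℝ] ℝ} {f g : M → ℝ} (hf : ContMDiff 𝓘(ℝ, E) 𝓘(ℝ, ℝ) ∞ f)
    (hg : ContMDiff 𝓘(ℝ, E) 𝓘(ℝ, ℝ) ∞ g) (hfα : (f ∘ e.symm) =ᶠ[𝓝 y] α)
    (hgβ : (g ∘ e.symm) =ᶠ[𝓝 y] β) :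
    ((fun x => dAt (E := E) f x (π.sharp x (dAt (E := E) g x))) ∘ e.symm) =ᶠ[𝓝 y]
      fun z => α (π.tensor e z β) := by
  have := isManifold_one (E := E) (M := M)
  filter_upwards [hfα.eventuallyEq_nhds, hgβ.eventuallyEq_nhds, e.open_target.mem_nhds hy]
    with z h1 h2 hz
  have h3 := π.bracket_eq (mem_maximalAtlas_one he) (e.map_target hz)
    ((hf (e.symm z)).mdifferentiableAt (by norm_num))
    ((hg (e.symm z)).mdifferentiableAt (by norm_num))
  rw [e.right_inv hz, h1.fderiv_eq, h2.fderiv_eq, α.fderiv, β.fderiv] at h3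
  exact h3

lemma contDiffOn_of_forall_dual {G : Type*} [NormedAddCommGroup G] [NormedSpace ℝ G]
    {n : WithTop ℕ∞} {f : G → (E →L[ℝ] ℝ) →L[ℝ] E} {s : Set G}
    (h : ∀ α β : E →L[ℝ] ℝ, ContDiffOn ℝ n (fun z => α (f z β)) s) : ContDiffOn ℝ n f s := by
  let b := Module.finBasis ℝ E
  rw [contDiffOn_clm_apply]
  intro β
  rw [← b.equivFunL.comp_contDiffOn_iff, contDiffOn_pi]
  exact fun i => h ((ContinuousLinearMap.proj i).comp b.equivFunL.toContinuousLinearMap) β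

/-- The Poisson tensor of `M` in a chart is a local Poisson tensor. -/
theorem PoissonStructure.isLocalPoisson_tensor
    (he : e ∈ IsManifold.maximalAtlas 𝓘(ℝ, E) ∞ M) : IsLocalPoisson e.target (π.tensor e) := by
  have := isManifold_one (E := E) (M := M)
  have he1 := mem_maximalAtlas_one he
  have hsm' : ContDiffOn ℝ 1 (π.tensor e) e.target := by
    refine contDiffOn_of_forall_dual fun α β y hy => ContDiffAt.contDiffWithinAt ?_
    obtain ⟨f, hf, hfα⟩ := exists_lift_linear he hy α
    obtain ⟨g, hg, hgβ⟩ := exists_lift_linear he hy β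
    have h1 := ((contDiffOn_comp_symm he (π.smooth f g hf hg)).contDiffAt
      (e.open_target.mem_nhds hy)).congr_of_eventuallyEq
      (π.bracket_lift_eventuallyEq he hy hf hg hfα hgβ).symm
    exact h1.of_le (by norm_num)
  have hsm := fun (y : E) (hy : y ∈ e.target) => hsm'.contDiffAt (e.open_target.mem_nhds hy)
  have hskew : ∀ y ∈ e.target, ∀ ξ η : E →L[ℝ] ℝ,
      ξ (π.tensor e y η) = -η (π.tensor e y ξ) := by
    intro y hy ξ η
    have h1 := e.map_target hy
    have h2 := π.tensor_apply h1 η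
    have h3 := π.tensor_apply h1 ξ
    rw [e.right_inv hy] at h2 h3
    rw [h2, h3]
    exact π.skew (e.symm y) (ξ.comp (chartDeriv (E := E) e (e.symm y)))
      (η.comp (chartDeriv (E := E) e (e.symm y)))
  refine ⟨e.open_target, hsm', hskew, ?_⟩
  intro y hy α β η
  obtain ⟨f, hf, hfα⟩ := exists_lift_linear he hy α
  obtain ⟨g, hg, hgβ⟩ := exists_lift_linear he hy β
  obtain ⟨k, hk, hkη⟩ := exists_lift_linear he hy η
  -- For functions with linear germs the inner bracket is b (B c) with b and c constant, so the
  -- outer bracket only differentiates B. Skewness then puts the term in the form used by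
  -- `IsLocalPoisson`.
  have key : ∀ {a b c : E →L[ℝ] ℝ} {u v w : M → ℝ}, ContMDiff 𝓘(ℝ, E) 𝓘(ℝ, ℝ) ∞ u →
      ContMDiff 𝓘(ℝ, E) 𝓘(ℝ, ℝ) ∞ v → ContMDiff 𝓘(ℝ, E) 𝓘(ℝ, ℝ) ∞ w →
      (u ∘ e.symm) =ᶠ[𝓝 y] a → (v ∘ e.symm) =ᶠ[𝓝 y] b → (w ∘ e.symm) =ᶠ[𝓝 y] c →
      dAt (E := E) u (e.symm y) (π.sharp (e.symm y) (dAt (E := E)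
        (fun z => dAt (E := E) v z (π.sharp z (dAt (E := E) w z))) (e.symm y))) =
      -b (fderiv ℝ (π.tensor e) y (π.tensor e y a) c) := by
    intro a b c u v w hu hv hw hua hvb hwc
    have h1 := π.bracket_eq he1 (e.map_target hy) ((hu (e.symm y)).mdifferentiableAt (by norm_num))
      ((π.smooth v w hv hw (e.symm y)).mdifferentiableAt (by norm_num))
    rw [h1, e.right_inv hy, hua.fderiv_eq, a.fderiv,
      (π.bracket_lift_eventuallyEq he hy hv hw hvb hwc).fderiv_eq, hskew y hy]
    have hd : HasFDerivAt (fun z => b (π.tensor e z c))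
        (b.comp ((fderiv ℝ (π.tensor e) y).flip c)) y := by
      have h2 := ((hsm y hy).differentiableAt (by norm_num)).hasFDerivAt
      have := b.hasFDerivAt.comp y (h2.clm_apply (hasFDerivAt_const c y))
      simpa [Function.comp_def] using! this
    rw [hd.fderiv]
    rfl
  have hj := π.jacobi f g k hf hg hk (e.symm y)
  rw [key hf hg hk hfα hgβ hkη, key hg hk hf hgβ hkη hfα, key hk hf hg hkη hfα hgβ] at hj
  linarith

lemma PoissonStructure.finrank_range_tensor {r : ℕ} (hπ : π.IsRegular r)
    (he : e ∈ IsManifold.maximalAtlas 𝓘(ℝ, E) ∞ M) {y : E} (hy : y ∈ e.target) :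
    Module.finrank ℝ (LinearMap.range (π.tensor e y).toLinearMap) = 2 * r := by
  have := isManifold_one (E := E) (M := M)
  have hx := e.map_target hy
  let D := chartDerivEquiv (mem_maximalAtlas_one he) hx
  have h1 : LinearMap.range (π.tensor e y).toLinearMap =
      (LinearMap.range (π.sharpE (e.symm y))).map D.toLinearEquiv.toLinearMap := by
    ext u
    constructor
    · rintro ⟨η, rfl⟩
      exact ⟨_, ⟨_, rfl⟩, rfl⟩
    · rintro ⟨_, ⟨ξ, rfl⟩, rfl⟩
      refine ⟨ξ.comp D.symm.toContinuousLinearMap, ?_⟩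
      have h2 := π.tensor_apply hx (ξ.comp D.symm.toContinuousLinearMap)
      rw [e.right_inv hy] at h2
      have h3 : (ξ.comp D.symm.toContinuousLinearMap).comp (chartDeriv e (e.symm y)) = ξ := by
        ext u
        exact congrArg ξ (D.symm_apply_apply u)
      rw [h3] at h2
      exact h2
  rw [h1, LinearEquiv.finrank_map_eq]
  exact hπ (e.symm y)

end Tensor

/-! ### Symplectic leaves meet a chart in countably many levels of the Casimirs. -/

section Leaves

open Filter

/-- A locally constant predicate on an interval is constant. -/
lemma forall_Icc_of_eventually_iff {a b : ℝ} {q : ℝ → Prop}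
    (h : ∀ t ∈ Icc a b, ∀ᶠ s in 𝓝[Icc a b] t, (q s ↔ q t)) (ha : q a) : ∀ t ∈ Icc a b, q t := by
  classical
  intro t ht
  have hab : a ≤ b := ht.1.trans ht.2
  have := isPreconnected_Icc.constant (f := fun s => decide (q s)) (s := Icc a b)
    (fun s hs => by
      refine (continuousWithinAt_const (b := decide (q s))).congr_of_eventuallyEq ?_ rfl
      filter_upwards [h s hs] with r hr
      simp [hr]) (left_mem_Icc.2 hab) ht
  simpa [ha] using this

variable {E : Type*} [NormedAddCommGroup E] [NormedSpace ℝ E] [FiniteDimensional ℝ E]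
  {M : Type*} [TopologicalSpace M] [ChartedSpace E M]
  (π : PoissonStructure E M)

/-- `v` is differentiable at `x` and constant to first order along the characteristic
distribution. -/
def PoissonStructure.Kills (v : M → E) (x : M) : Prop :=
  MDifferentiableAt 𝓘(ℝ, E) 𝓘(ℝ, E) v x ∧
    ∀ ξ, (mfderiv 𝓘(ℝ, E) 𝓘(ℝ, E) v x : E →L[ℝ] E) (π.sharpE x ξ) = 0

/-- `v` defines the symplectic foliation on the open set `O`. -/
structure PoissonStructure.IsFoliatedMap (O : Set M) (v : M → E) : Prop where
  isOpen : IsOpen O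
  kills : ∀ x ∈ O, π.Kills v x
  factor : ∀ x ∈ O, ∀ v' : M → E, (∀ᶠ y in 𝓝 x, π.Kills v' y) →
    ∀ᶠ y in 𝓝 x, v y = v x → v' y = v' x

variable {π}

lemma PoissonStructure.Kills.hasDerivWithinAt {v : M → E} {h : M → ℝ} {c : ℝ → M} {s : Set ℝ}
    (hc : IsMIntegralCurveOn c (π.hamVF h) s) {t : ℝ} (ht : t ∈ s) (hv : π.Kills v (c t)) :
    HasDerivWithinAt (v ∘ c) 0 s t := by
  have h1 := (hv.1.hasMFDerivAt.comp_hasMFDerivWithinAt t (hc t ht)).hasFDerivWithinAt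
  let w : E := π.hamVF h (c t)
  let D : E →L[ℝ] E := mfderiv 𝓘(ℝ, E) 𝓘(ℝ, E) v (c t)
  have h2 : HasFDerivWithinAt (v ∘ c) (D.comp ((1 : ℝ →L[ℝ] ℝ).smulRight w)) s t := h1
  have h3 := h2.hasDerivWithinAt
  have h4 : D w = 0 := hv.2 _
  simpa [h4] using h3

/-- The velocity of a Hamiltonian curve lies in im ♯, so v has zero derivative along it as long as
it stays in O. -/
lemma PoissonStructure.IsFoliatedMap.eventually_eq_of_curve {O : Set M} {v : M → E}
    (hv : π.IsFoliatedMap O v) {h : M → ℝ} {c : ℝ → M} {a b : ℝ}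
    (hc : IsMIntegralCurveOn c (π.hamVF h) (Icc a b)) {t : ℝ} (ht : t ∈ Icc a b)
    (hct : c t ∈ O) : ∀ᶠ s in 𝓝[Icc a b] t, c s ∈ O ∧ v (c s) = v (c t) := by
  have h1 : ∀ᶠ s in 𝓝[Icc a b] t, c s ∈ O :=
    (hc.continuousWithinAt ht).eventually (hv.isOpen.mem_nhds hct)
  rw [eventually_nhdsWithin_iff, Metric.eventually_nhds_iff_ball] at h1
  obtain ⟨ε, hε, h2⟩ := h1
  have hcv : Convex ℝ (Metric.ball t ε ∩ Icc a b) := (convex_ball t ε).inter (convex_Icc a b)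
  have hmem : t ∈ Metric.ball t ε ∩ Icc a b := ⟨Metric.mem_ball_self hε, ht⟩
  rw [eventually_nhdsWithin_iff]
  filter_upwards [Metric.ball_mem_nhds t hε] with s hs hsI
  refine ⟨h2 s hs hsI, ?_⟩
  have hd : ∀ r ∈ Metric.ball t ε ∩ Icc a b,
      HasDerivWithinAt (v ∘ c) 0 (Metric.ball t ε ∩ Icc a b) r := fun r hr =>
    (PoissonStructure.Kills.hasDerivWithinAt hc hr.2 (hv.kills _ (h2 r hr.1 hr.2))).mono
      inter_subset_right
  have h3 := hcv.norm_image_sub_le_of_norm_hasDerivWithin_le (C := 0) hd (by simp)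
    hmem ⟨hs, hsI⟩
  simpa [sub_eq_zero] using h3

variable [T2Space M] [IsManifold 𝓘(ℝ, E) ∞ M]

lemma PoissonStructure.kills_comp_iff {e : OpenPartialHomeomorph M E}
    (he : e ∈ IsManifold.maximalAtlas 𝓘(ℝ, E) ∞ M) {v : E → E} {x : M} (hx : x ∈ e.source)
    (hv : DifferentiableAt ℝ v (e x)) (hk : ∀ ξ, fderiv ℝ v (e x) (π.tensor e (e x) ξ) = 0) :
    π.Kills (v ∘ e) x := by
  have := isManifold_one (E := E) (M := M)
  have he1 := mem_maximalAtlas_one he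
  have h1 := hv.hasFDerivAt.hasMFDerivAt.comp x (hasMFDerivAt_chart he1 hx)
  refine ⟨h1.mdifferentiableAt, fun ξ => ?_⟩
  have h2 := hk (ξ.comp (chartDerivSymm e (e x)))
  rw [π.tensor_apply hx] at h2
  have h3 : (ξ.comp (chartDerivSymm e (e x))).comp (chartDeriv e x) = ξ := by
    ext u
    exact congrArg ξ (chartDerivSymm_apply he1 hx u)
  rw [h3] at h2
  rw [h1.mfderiv]
  exact h2

lemma PoissonStructure.Kills.comp_symm {e : OpenPartialHomeomorph M E}
    (he : e ∈ IsManifold.maximalAtlas 𝓘(ℝ, E) ∞ M) {v : M → E} {x : M} (hx : x ∈ e.source)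
    (hv : π.Kills v x) : DifferentiableAt ℝ (v ∘ e.symm) (e x) ∧
      ∀ ξ, fderiv ℝ (v ∘ e.symm) (e x) (π.tensor e (e x) ξ) = 0 := by
  have := isManifold_one (E := E) (M := M)
  have he1 := mem_maximalAtlas_one he
  refine ⟨(hasFDerivAt_comp_symm he1 hx hv.1.hasMFDerivAt).differentiableAt, fun ξ => ?_⟩
  rw [π.tensor_apply hx, ← mfderiv_eq_comp_chartDeriv he1 hx hv.1]
  exact hv.2 _

variable (π) in
/-- Around each point of a regular Poisson manifold there are `C¹` Casimir maps defining the
symplectic foliation. -/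
theorem PoissonStructure.exists_isFoliatedMap {r : ℕ} (hπ : π.IsRegular r)
    {e : OpenPartialHomeomorph M E} (he : e ∈ IsManifold.maximalAtlas 𝓘(ℝ, E) ∞ M) {m : M}
    (hm : m ∈ e.source) :
    ∃ (O : Set E) (v : E → E), IsOpen O ∧ e m ∈ O ∧ O ⊆ e.target ∧ ContDiffOn ℝ 1 v O ∧
      (∀ y ∈ O, ∀ u, fderiv ℝ v y u = 0 ↔ u ∈ LinearMap.range (π.tensor e y).toLinearMap) ∧
      π.IsFoliatedMap (e.source ∩ e ⁻¹' O) (v ∘ e) := by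
  have hB := π.isLocalPoisson_tensor he
  obtain ⟨O, hO, hmO, hOe, v, hv, hk, hf⟩ := hB.exists_casimirs
    (fun y hy => π.finrank_range_tensor hπ he hy) (e.map_source hm)
  have hd : ∀ y ∈ O, DifferentiableAt ℝ v y := fun y hy =>
    (hv.contDiffAt (hO.mem_nhds hy)).differentiableAt (by norm_num)
  refine ⟨O, v, hO, hmO, hOe, hv, hk, e.isOpen_inter_preimage hO, fun x hx => ?_,
    fun x hx v' hv' => ?_⟩
  · exact PoissonStructure.kills_comp_iff he hx.1 (hd _ hx.2) fun ξ => (hk _ hx.2 _).2 ⟨ξ, rfl⟩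
  · have h1 : ∀ᶠ y in 𝓝 (e x), y ∈ e.target ∧ π.Kills v' (e.symm y) := by
      refine (show ∀ᶠ y in 𝓝 (e x), y ∈ e.target from
        e.open_target.mem_nhds (e.map_source hx.1)).and ?_
      have h2 := e.continuousAt_symm (e.map_source hx.1)
      rw [ContinuousAt, e.left_inv hx.1] at h2
      exact h2.eventually hv'
    have h3 := hf (e x) hx.2 (v' ∘ e.symm) _ h1 fun y hy => by
      have h4 := hy.2.comp_symm he (e.map_target hy.1)
      rwa [e.right_inv hy.1] at h4
    filter_upwards [(e.continuousAt hx.1).eventually h3, e.open_source.mem_nhds hx.1]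
      with y hy hys hvy
    have h5 := hy hvy
    simpa [e.left_inv hys, e.left_inv hx.1] using h5

variable [SecondCountableTopology M]

/-- On the overlap, v' is locally constant on a level of v by the factorization property. The
Lindelöf property leaves countably many values. -/
lemma PoissonStructure.IsFoliatedMap.countable_image {O O' : Set M} {v v' : M → E}
    (hv : π.IsFoliatedMap O v) (hv' : π.IsFoliatedMap O' v') (a : E) :
    (v' '' {x | x ∈ O ∧ x ∈ O' ∧ v x = a}).Countable := by
  set S := {x | x ∈ O ∧ x ∈ O' ∧ v x = a} with hS
  have h1 : ∀ x ∈ S, {y | v' y = v' x} ∈ 𝓝[S] x := by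
    intro x hx
    have h2 := hv.factor x hx.1 v' (by
      filter_upwards [hv'.isOpen.mem_nhds hx.2.1] with y hy using hv'.kills y hy)
    rw [mem_nhdsWithin_iff_eventually]
    filter_upwards [h2] with y hy hyS
    exact hy (hyS.2.2.trans hx.2.2.symm)
  obtain ⟨t, -, htc, hst⟩ := TopologicalSpace.countable_cover_nhdsWithin h1
  refine (htc.image v').mono ?_
  rintro _ ⟨x, hx, rfl⟩
  obtain ⟨y, hy, hxy⟩ := mem_iUnion₂.1 (hst hx)
  exact ⟨y, hy, (hxy : v' x = v' y).symm⟩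

variable (π) in
/-- A symplectic leaf meets the domain of a foliated map in countably many level sets. -/
theorem PoissonStructure.countable_image_leaf {r : ℕ} (hπ : π.IsRegular r) (p : M) {O : Set M}
    {v : M → E} (hv : π.IsFoliatedMap O v) : (v '' (π.leaf p ∩ O)).Countable := by
  have hex : ∀ m : M, ∃ (O : Set M) (v : M → E), π.IsFoliatedMap O v ∧ m ∈ O := fun m => by
    obtain ⟨O, v, -, hmO, -, -, -, h⟩ := π.exists_isFoliatedMap hπ
      (IsManifold.chart_mem_maximalAtlas (I := 𝓘(ℝ, E)) (n := ∞) m) (mem_chart_source E m)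
    exact ⟨_, _, h, mem_chart_source E m, hmO⟩
  choose O₁ v₁ hv₁ hmO using hex
  obtain ⟨S, hS, hScov⟩ := TopologicalSpace.countable_cover_nhds fun m =>
    (hv₁ m).isOpen.mem_nhds (hmO m)
  -- A pair (j, a) labels the level v₁ j = a in O₁ j. From a label one passes to the labels of all
  -- levels that meet it, and `Pl k` collects what k such passages reach, starting from p. Only the
  -- countable cover S is used, so every `Pl k` is countable; the union `Reach` of these levels
  -- contains the leaf.
  let step : M × E → Set (M × E) := fun q =>
    ⋃ j ∈ S, (fun b => (j, b)) '' (v₁ j '' {x | x ∈ O₁ q.1 ∧ x ∈ O₁ j ∧ v₁ q.1 x = q.2})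
  let Pl : ℕ → Set (M × E) := fun k => Nat.rec ((fun j => (j, v₁ j p)) '' {j ∈ S | p ∈ O₁ j})
    (fun _ Q => ⋃ q ∈ Q, step q) k
  have hPl : ∀ k, (Pl k).Countable := by
    intro k
    induction k with
    | zero => exact (hS.mono (sep_subset _ _)).image _
    | succ k ih =>
      exact ih.biUnion fun q _ => hS.biUnion fun j _ =>
        ((hv₁ q.1).countable_image (hv₁ j) q.2).image _
  let Reach : Set M := {x | ∃ k, ∃ q ∈ Pl k, x ∈ O₁ q.1 ∧ v₁ q.1 x = q.2}
  have hnext : ∀ x ∈ Reach, ∀ j ∈ S, x ∈ O₁ j → ∃ k, (j, v₁ j x) ∈ Pl k := by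
    rintro x ⟨k, q, hq, hxq, hvq⟩ j hj hxj
    exact ⟨k + 1, mem_biUnion hq (mem_biUnion hj ⟨_, ⟨x, ⟨hxq, hxj, hvq⟩, rfl⟩, rfl⟩)⟩
  have hcov : ∀ x : M, ∃ j ∈ S, x ∈ O₁ j := fun x => by
    have : x ∈ ⋃ j ∈ S, O₁ j := hScov ▸ mem_univ x
    simpa using this
  have hp : p ∈ Reach := by
    obtain ⟨j, hj, hpj⟩ := hcov p
    exact ⟨0, (j, v₁ j p), ⟨j, ⟨hj, hpj⟩, rfl⟩, hpj, rfl⟩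
  have hstep : ∀ x y, x ∈ Reach → π.HamStep x y → y ∈ Reach := by
    rintro x y hx ⟨h, c, -, hc, rfl, rfl⟩
    -- Locally in time a Hamiltonian curve stays in one level of one v₁ j, so membership in `Reach`
    -- is locally constant along it.
    refine forall_Icc_of_eventually_iff (q := fun t => c t ∈ Reach) (fun t ht => ?_) hx 1
      (right_mem_Icc.2 zero_le_one)
    obtain ⟨j, hj, htj⟩ := hcov (c t)
    filter_upwards [(hv₁ j).eventually_eq_of_curve hc ht htj] with s ⟨hsj, hsv⟩
    constructor
    · intro hs
      obtain ⟨k, hk⟩ := hnext _ hs j hj hsj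
      exact ⟨k, _, hk, htj, hsv.symm⟩
    · intro hs
      obtain ⟨k, hk⟩ := hnext _ hs j hj htj
      exact ⟨k, _, hk, hsj, hsv⟩
  have hleaf : π.leaf p ⊆ Reach := by
    intro q hq
    induction hq with
    | refl => exact hp
    | tail _ hbc ih => exact hstep _ _ ih hbc
  have hcount : (⋃ k, ⋃ q ∈ Pl k, v '' {x | x ∈ O₁ q.1 ∧ x ∈ O ∧ v₁ q.1 x = q.2}).Countable :=
    countable_iUnion fun k => (hPl k).biUnion fun q _ => (hv₁ q.1).countable_image hv q.2
  refine hcount.mono ?_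
  rintro _ ⟨x, ⟨hxl, hxO⟩, rfl⟩
  obtain ⟨k, q, hq, hxq, hvq⟩ := hleaf hxl
  exact mem_iUnion.2 ⟨k, mem_biUnion hq ⟨x, ⟨hxq, hxO, hvq⟩, rfl⟩⟩

/-- A submanifold contained in a leaf is locally contained in a level set of a foliated map. -/
theorem IsC1Submanifold.eventually_eq {r k : ℕ} (hπ : π.IsRegular r) {N : Set M} {p : M}
    (hN : IsC1Submanifold E k N) (hp : p ∈ N) (hNl : N ⊆ π.leaf p) {O : Set M} {v : M → E}
    (hv : π.IsFoliatedMap O v) (hpO : p ∈ O) : ∀ᶠ x in 𝓝 p, x ∈ N → v x = v p := by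
  obtain ⟨e, he, hpe, L, -, hL⟩ := hN p hp
  have h1 : e.target ∩ e.symm ⁻¹' O ∈ 𝓝 (e p) := by
    refine (e.isOpen_inter_preimage_symm hv.isOpen).mem_nhds ⟨e.map_source hpe, ?_⟩
    simpa [e.left_inv hpe] using hpO
  obtain ⟨ρ, hρ, hball⟩ := Metric.mem_nhds_iff.1 h1
  have hLN : ∀ y ∈ e.target, y ∈ L → e.symm y ∈ N := fun y hy hyL => by
    have : e.symm y ∈ e.source ∩ e ⁻¹' (L : Set E) :=
      ⟨e.map_target hy, by simpa [e.right_inv hy] using hyL⟩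
    rw [← hL] at this
    exact this.2
  have hNL : ∀ x ∈ e.source, x ∈ N → e x ∈ L := fun x hx hxN => by
    have : x ∈ e.source ∩ N := ⟨hx, hxN⟩
    rw [hL] at this
    exact this.2
  let S : Set E := (L : Set E) ∩ Metric.ball (e p) ρ
  have hSc : Convex ℝ S := L.convex.inter (convex_ball _ _)
  have hcont : ContinuousOn (v ∘ e.symm) S := by
    intro y hy
    have hyO := hball hy.2
    refine ContinuousAt.continuousWithinAt (ContinuousAt.comp ?_ (e.continuousAt_symm hyO.1))
    exact (hv.kills _ hyO.2).1.continuousAt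
  have hcount : ((v ∘ e.symm) '' S).Countable := by
    refine (π.countable_image_leaf hπ p hv).mono ?_
    rintro _ ⟨y, hy, rfl⟩
    exact ⟨e.symm y, ⟨hNl (hLN y (hball hy.2).1 hy.1), (hball hy.2).2⟩, rfl⟩
  -- The slice S is convex, so its image under v is connected; it is also countable, because the
  -- slice lies in the leaf. A countable connected set here is a single point.
  have hsub := hcount.isTotallyDisconnected _ Subset.rfl (hSc.isPreconnected.image _ hcont)
  filter_upwards [e.open_source.mem_nhds hpe,
    (e.continuousAt hpe).eventually (Metric.ball_mem_nhds (e p) hρ)] with x hx hxb hxN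
  have h2 := hsub ⟨e x, ⟨hNL x hx hxN, hxb⟩, rfl⟩
    ⟨e p, ⟨hNL p hpe hp, Metric.mem_ball_self hρ⟩, rfl⟩
  simpa [e.left_inv hx, e.left_inv hpe] using h2

end Leaves

/-! ### Comparison of orbits on the manifold with flows in charts. -/

section Transport

open Filter

/-- Compactness gives a finite subdivision of [a, b] whose pieces each lie in one good
neighbourhood, and transitivity chains them. This patches statements about flows over several
charts. -/
lemma rel_of_local {R : ℝ → ℝ → Prop} {a b : ℝ} (hab : a ≤ b)
    (htrans : ∀ x y z, x ≤ y → y ≤ z → R x y → R y z → R x z)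
    (hloc : ∀ t ∈ Icc a b, ∃ η > 0, ∀ x ∈ Icc a b, ∀ y ∈ Icc a b, |x - t| < η → |y - t| < η →
      x ≤ y → R x y) : R a b := by
  choose! η hη hR using hloc
  obtain ⟨t, ht0, htm, ⟨m, hm⟩, hti⟩ := exists_monotone_Icc_subset_open_cover_Icc hab
    (c := fun i : Icc a b => {s : Icc a b | |s.1 - i.1| < η i}) (fun i =>
      isOpen_lt (by fun_prop) continuous_const) (fun s _ => mem_iUnion.2 ⟨s, by
        simpa using hη s s.2⟩)
  have hstep : ∀ n, R (t n) (t (n + 1)) := by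
    intro n
    obtain ⟨i, hi⟩ := hti n
    have hle := htm (Nat.le_succ n)
    exact hR i i.2 _ (t n).2 _ (t (n + 1)).2 (hi ⟨le_rfl, hle⟩) (hi ⟨hle, le_rfl⟩) hle
  have key : ∀ n, R (t 0) (t (n + 1)) := by
    intro n
    induction n with
    | zero => exact hstep 0
    | succ n ih =>
      exact htrans _ _ _ (htm (Nat.zero_le _)) (htm (Nat.le_succ _)) ih (hstep _)
  have := key m
  rw [ht0, hm (m + 1) (Nat.le_succ m)] at this
  exact this

section Vector

variable {F : Type*} [NormedAddCommGroup F] [NormedSpace ℝ F]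

lemma IsFlow.eq_of_hasDerivWithinAt {X : F → F} {Φ : ℝ → F → F} (h : IsFlow X Φ) {K : NNReal}
    (hX : LipschitzWith K X) {a b : ℝ} {u : ℝ → F}
    (hu : ∀ t ∈ Icc a b, HasDerivWithinAt u (X (u t)) (Icc a b) t) {t s : ℝ} (ht : t ∈ Icc a b)
    (hs : s ∈ Icc a b) : u s = Φ (s - t) (u t) := by
  have hd : ∀ r, HasDerivAt (fun r => Φ (r - t) (u t)) (X (Φ (r - t) (u t))) r := fun r => by
    simpa using (h.deriv (u t) (r - t)).comp_sub_const r t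
  have hcu : ContinuousOn u (Icc a b) := fun r hr => (hu r hr).continuousWithinAt
  rcases le_total t s with hts | hts
  · refine ODE_solution_unique_of_mem_Icc_right (v := fun _ => X) (s := fun _ => univ) (K := K)
      (a := t) (b := s) (f := u) (g := fun r => Φ (r - t) (u t)) (fun _ _ => hX.lipschitzOnWith)
      (hcu.mono (Icc_subset_Icc ht.1 hs.2)) (fun r hr => ?_) (fun _ _ => mem_univ _)
      (fun r _ => (hd r).continuousAt.continuousWithinAt) (fun r _ => (hd r).hasDerivWithinAt)
      (fun _ _ => mem_univ _) (by simp [h.zero]) ⟨hts, le_rfl⟩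
    refine (hu r ⟨ht.1.trans hr.1, hr.2.le.trans hs.2⟩).mono_of_mem_nhdsWithin ?_
    exact mem_of_superset (Icc_mem_nhdsGE (hr.2.trans_le hs.2))
      (Icc_subset_Icc_left (ht.1.trans hr.1))
  · refine ODE_solution_unique_of_mem_Icc_left (v := fun _ => X) (s := fun _ => univ) (K := K)
      (a := s) (b := t) (f := u) (g := fun r => Φ (r - t) (u t)) (fun _ _ => hX.lipschitzOnWith)
      (hcu.mono (Icc_subset_Icc hs.1 ht.2)) (fun r hr => ?_) (fun _ _ => mem_univ _)
      (fun r _ => (hd r).continuousAt.continuousWithinAt) (fun r _ => (hd r).hasDerivWithinAt)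
      (fun _ _ => mem_univ _) (by simp [h.zero]) ⟨le_rfl, hts⟩
    refine (hu r ⟨hs.1.trans hr.1.le, hr.2.trans ht.2⟩).mono_of_mem_nhdsWithin ?_
    exact mem_of_superset (Icc_mem_nhdsLE (hs.1.trans_lt hr.1))
      (Icc_subset_Icc_right (hr.2.trans ht.2))

end Vector

variable {E : Type*} [NormedAddCommGroup E] [NormedSpace ℝ E] [FiniteDimensional ℝ E]
  {M : Type*} [TopologicalSpace M] [ChartedSpace E M]
  (π : PoissonStructure E M)

/-- The Hamiltonian vector field with values in the model space. -/
def PoissonStructure.hamE (H : M → ℝ) (x : M) : E := π.hamVF H x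

/-- A linear map between tangent spaces which preserves the Poisson tensor and the Hamiltonian
vector field. -/
structure PoissonStructure.IsPoissonLin (H : M → ℝ) (x y : M) (A : E →L[ℝ] E) : Prop where
  injective : Function.Injective A
  sharp : ∀ ξ : E →L[ℝ] ℝ, π.sharpE y ξ = A (π.sharpE x (ξ.comp A))
  ham : A (π.hamE H x) = π.hamE H y

variable {π}

lemma PoissonStructure.IsPoissonLin.comp {H : M → ℝ} {x y z : M} {A A' : E →L[ℝ] E}
    (h' : π.IsPoissonLin H y z A') (h : π.IsPoissonLin H x y A) :
    π.IsPoissonLin H x z (A'.comp A) :=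
  ⟨h'.injective.comp h.injective, fun ξ => by
    rw [h'.sharp, h.sharp]; rfl, by
    rw [ContinuousLinearMap.comp_apply, h.ham, h'.ham]⟩

variable (π) in
/-- A compactly supported Hamiltonian `f` in the chart `e` which represents `H` on `V`, together
with its flow. -/
structure PoissonStructure.ChartFlow (H : M → ℝ) (e : OpenPartialHomeomorph M E) (f : E → ℝ)
    (V : Set E) (Φ : ℝ → E → E) : Prop where
  mem_atlas : e ∈ IsManifold.maximalAtlas 𝓘(ℝ, E) ∞ M
  contDiff : ContDiff ℝ 2 f
  hasCompactSupport : HasCompactSupport f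
  tsupport_subset : tsupport f ⊆ e.target
  isOpen : IsOpen V
  subset : V ⊆ e.target
  eqOn : EqOn f (H ∘ e.symm) V
  isFlow : IsFlow (hamField (π.tensor e) f) Φ

lemma IsMIntegralCurveOn.congr {X : ∀ x : M, TangentSpace 𝓘(ℝ, E) x} {c c' : ℝ → M}
    {s : Set ℝ} (h : IsMIntegralCurveOn c X s) (hc : EqOn c' c s) :
    IsMIntegralCurveOn c' X s := by
  intro t ht
  have h1 := HasMFDerivWithinAt.congr_mono (h t ht) hc (hc ht) Subset.rfl
  have h3 : ∀ z, z = c' t → HasMFDerivWithinAt 𝓘(ℝ, ℝ) 𝓘(ℝ, E) c' s t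
    ((1 : ℝ →L[ℝ] ℝ).smulRight (X z : E)) → HasMFDerivWithinAt 𝓘(ℝ, ℝ) 𝓘(ℝ, E) c' s t
    ((1 : ℝ →L[ℝ] ℝ).smulRight (X (c' t))) := by rintro z rfl h; exact h
  exact h3 _ (hc ht).symm h1

/-- Concatenation of integral curves. -/
lemma IsMIntegralCurveOn.concat {X : ∀ x : M, TangentSpace 𝓘(ℝ, E) x} {c₁ c₂ : ℝ → M}
    {a b d : ℝ} (hab : a ≤ b) (hbd : b ≤ d) (h₁ : IsMIntegralCurveOn c₁ X (Icc a b))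
    (h₂ : IsMIntegralCurveOn c₂ X (Icc b d)) (hb : c₁ b = c₂ b) :
    IsMIntegralCurveOn (fun t => if t ≤ b then c₁ t else c₂ t) X (Icc a d) := by
  set c := fun t => if t ≤ b then c₁ t else c₂ t with hc
  have e1 : ∀ t ≤ b, c t = c₁ t := fun t ht => if_pos ht
  have e2 : ∀ t, b ≤ t → c t = c₂ t := fun t ht => by
    rcases ht.eq_or_lt with rfl | h
    · rw [e1 _ le_rfl, hb]
    · exact if_neg h.not_ge
  have k1 : IsMIntegralCurveOn c X (Icc a b) := IsMIntegralCurveOn.congr h₁ fun t ht => e1 t ht.2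
  have k2 : IsMIntegralCurveOn c X (Icc b d) := IsMIntegralCurveOn.congr h₂ fun t ht => e2 t ht.1
  intro t ht
  rcases lt_trichotomy t b with h | rfl | h
  · refine (k1 t ⟨ht.1, h.le⟩).mono_of_mem_nhdsWithin ?_
    have : Iio b ∩ Icc a d ∈ 𝓝[Icc a d] t :=
      inter_mem (mem_nhdsWithin_of_mem_nhds (Iio_mem_nhds h)) self_mem_nhdsWithin
    exact mem_of_superset this fun s hs => ⟨hs.2.1, hs.1.le⟩
  · have := (k1 t ⟨hab, le_rfl⟩).union (k2 t ⟨le_rfl, hbd⟩)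
    rwa [Icc_union_Icc_eq_Icc hab hbd] at this
  · refine (k2 t ⟨h.le, ht.2⟩).mono_of_mem_nhdsWithin ?_
    have : Ioi b ∩ Icc a d ∈ 𝓝[Icc a d] t :=
      inter_mem (mem_nhdsWithin_of_mem_nhds (Ioi_mem_nhds h)) self_mem_nhdsWithin
    exact mem_of_superset this fun s hs => ⟨hs.1.le, hs.2.2⟩

variable [T2Space M] [IsManifold 𝓘(ℝ, E) ∞ M]

variable (π) in
lemma PoissonStructure.exists_chartFlow {H : M → ℝ} (hH : ContMDiff 𝓘(ℝ, E) 𝓘(ℝ, ℝ) 2 H)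
    {e : OpenPartialHomeomorph M E} (he : e ∈ IsManifold.maximalAtlas 𝓘(ℝ, E) ∞ M) {m : M}
    (hm : m ∈ e.source) : ∃ f V Φ, π.ChartFlow H e f V Φ ∧ e m ∈ V := by
  have := isManifold_two (E := E) (M := M)
  have h2 : e ∈ IsManifold.maximalAtlas 𝓘(ℝ, E) 2 M :=
    IsManifold.maximalAtlas_subset_of_le (by norm_cast) he
  obtain ⟨f, hf, hfc, hfe, V, hV, hmV, hVe, hfV⟩ := exists_cutoff (n := 2) e.open_target
    (e.map_source hm) (u := H ∘ e.symm) (contDiffOn_comp_symm h2 hH)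
  obtain ⟨Φ, hΦ⟩ := (π.isLocalPoisson_tensor he).exists_flow hf hfc hfe
  exact ⟨f, V, Φ, ⟨he, hf, hfc, hfe, hV, hVe, hfV, hΦ⟩, hmV⟩

namespace PoissonStructure.ChartFlow

variable {H : M → ℝ} {e : OpenPartialHomeomorph M E} {f : E → ℝ} {V : Set E} {Φ : ℝ → E → E}

lemma isLocalPoisson (h : π.ChartFlow H e f V Φ) : IsLocalPoisson e.target (π.tensor e) :=
  π.isLocalPoisson_tensor h.mem_atlas

lemma exists_lipschitz (h : π.ChartFlow H e f V Φ) :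
    ∃ K, LipschitzWith K (hamField (π.tensor e) f) :=
  (h.isLocalPoisson.contDiff_hamField h.contDiff h.tsupport_subset).lipschitzWith_of_hasCompactSupport
    (hasCompactSupport_hamField h.hasCompactSupport) (by norm_num)

lemma contDiff_flow (h : π.ChartFlow H e f V Φ) : ContDiff ℝ 1 (fun q : ℝ × E => Φ q.1 q.2) :=
  h.isLocalPoisson.contDiff_flow h.contDiff h.hasCompactSupport h.tsupport_subset h.isFlow

lemma flow_add (h : π.ChartFlow H e f V Φ) (s t : ℝ) (y : E) : Φ (s + t) y = Φ s (Φ t y) :=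
  h.isLocalPoisson.flow_add h.contDiff h.hasCompactSupport h.tsupport_subset h.isFlow s t y

lemma hamField_eq (h : π.ChartFlow H e f V Φ) (hH : ContMDiff 𝓘(ℝ, E) 𝓘(ℝ, ℝ) 2 H) {x : M}
    (hx : x ∈ e.source) (hxV : e x ∈ V) :
    hamField (π.tensor e) f (e x) = chartDeriv e x (π.hamE H x) := by
  have := isManifold_one (E := E) (M := M)
  have h1 : f =ᶠ[𝓝 (e x)] H ∘ e.symm := by
    filter_upwards [h.isOpen.mem_nhds hxV] with y hy using h.eqOn hy
  have h2 := π.chartDeriv_hamVF (mem_maximalAtlas_one h.mem_atlas) hx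
    ((hH x).mdifferentiableAt (by norm_num))
  rw [hamE, h2, hamField, hamField, h1.fderiv_eq]

/-- Orbits of the chart flow inside `V` are orbits of `H`. -/
lemma isMIntegralCurveOn (h : π.ChartFlow H e f V Φ) (hH : ContMDiff 𝓘(ℝ, E) 𝓘(ℝ, ℝ) 2 H)
    {s : Set ℝ} {a : ℝ} {y : E} (hs : ∀ t ∈ s, Φ (t - a) y ∈ V) :
    IsMIntegralCurveOn (fun t => e.symm (Φ (t - a) y)) (π.hamVF H) s := by
  have := isManifold_one (E := E) (M := M)
  intro t ht
  have hV := hs t ht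
  have hT := h.subset hV
  have h1 : HasDerivAt (fun t => Φ (t - a) y) (hamField (π.tensor e) f (Φ (t - a) y)) t := by
    simpa using (h.isFlow.deriv y (t - a)).comp_sub_const t a
  have h2 := h.hamField_eq hH (e.map_target hT) (by rwa [e.right_inv hT])
  rw [e.right_inv hT] at h2
  rw [h2] at h1
  exact hasMFDerivWithinAt_symm_comp (mem_maximalAtlas_one h.mem_atlas) (u := fun t => Φ (t - a) y)
    hT h1.hasDerivWithinAt

/-- Orbits of `H` inside `V` are orbits of the chart flow. -/
lemma eq_flow (h : π.ChartFlow H e f V Φ) (hH : ContMDiff 𝓘(ℝ, E) 𝓘(ℝ, ℝ) 2 H) {c : ℝ → M}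
    {a b : ℝ} (hc : IsMIntegralCurveOn c (π.hamVF H) (Icc a b))
    (hcV : ∀ t ∈ Icc a b, c t ∈ e.source ∩ e ⁻¹' V) {t s : ℝ} (ht : t ∈ Icc a b)
    (hs : s ∈ Icc a b) : e (c s) = Φ (s - t) (e (c t)) := by
  have := isManifold_one (E := E) (M := M)
  obtain ⟨K, hK⟩ := h.exists_lipschitz
  refine h.isFlow.eq_of_hasDerivWithinAt hK (u := e ∘ c) (fun r hr => ?_) ht hs
  have h1 := IsMIntegralCurveOn.hasDerivWithinAt_chart (mem_maximalAtlas_one h.mem_atlas) hc hr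
    (hcV r hr).1
  have h2 := h.hamField_eq hH (hcV r hr).1 (hcV r hr).2
  rw [Function.comp_apply, h2]
  exact h1

lemma isPoissonLin (h : π.ChartFlow H e f V Φ) (hH : ContMDiff 𝓘(ℝ, E) 𝓘(ℝ, ℝ) 2 H) {x : M}
    (hx : x ∈ e.source) (hxV : e x ∈ V) {t : ℝ} (ht : Φ t (e x) ∈ V) :
    π.IsPoissonLin H x (e.symm (Φ t (e x)))
      ((chartDerivSymm e (Φ t (e x))).comp ((fderiv ℝ (Φ t) (e x)).comp (chartDeriv e x))) := by
  have := isManifold_one (E := E) (M := M)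
  have he := mem_maximalAtlas_one h.mem_atlas
  have hT := h.subset ht
  set y := e.symm (Φ t (e x)) with hy
  have hys : y ∈ e.source := e.map_target hT
  have hey : e y = Φ t (e x) := e.right_inv hT
  have hB := h.isLocalPoisson
  have hex := e.map_source hx
  have hinj : Function.Injective (fderiv ℝ (Φ t) (e x)) := by
    intro u v huv
    have h1 := hB.fderiv_flow_comp h.contDiff h.hasCompactSupport h.tsupport_subset h.isFlow (e x) t
    have h2 := congrArg (fun L : E →L[ℝ] E => L u) h1
    have h3 := congrArg (fun L : E →L[ℝ] E => L v) h1
    simp only [ContinuousLinearMap.comp_apply, ContinuousLinearMap.id_apply] at h2 h3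
    rw [← h2, ← h3, huv]
  have hinj2 : Function.Injective (chartDerivSymm e (Φ t (e x))) := by
    rw [← hey]
    exact (chartDerivEquiv he hys).symm.injective
  have hsharp : ∀ η, π.tensor e (Φ t (e x)) η =
      fderiv ℝ (Φ t) (e x) (π.tensor e (e x) (η.comp (fderiv ℝ (Φ t) (e x)))) := fun η =>
    hB.sharp_flow h.contDiff h.hasCompactSupport h.tsupport_subset h.isFlow hex t η
  refine ⟨hinj2.comp (hinj.comp (chartDeriv_injective he hx)), fun ξ => ?_, ?_⟩
  · have h1 := hsharp (ξ.comp (chartDerivSymm e (Φ t (e x))))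
    rw [← hey, π.tensor_apply hys, π.tensor_apply hx, hey] at h1
    have h3 : (ξ.comp (chartDerivSymm e (Φ t (e x)))).comp (chartDeriv e y) = ξ := by
      ext u
      have := chartDerivSymm_apply he hys u
      rw [hey] at this
      exact congrArg ξ this
    rw [h3] at h1
    have h4 := congrArg (chartDerivSymm e (Φ t (e x))) h1
    rw [← hey, chartDerivSymm_apply he hys, hey] at h4
    exact h4
  · have h1 := h.hamField_eq hH hx hxV
    have h2 := h.hamField_eq hH hys (by rwa [hey])
    rw [hey] at h2
    -- The flow preserves f and the tensor, hence also the Hamiltonian field of f.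
    have h3 : hamField (π.tensor e) f (Φ t (e x)) =
        fderiv ℝ (Φ t) (e x) (hamField (π.tensor e) f (e x)) := by
      have h4 : f ∘ Φ t = f := funext fun z =>
        hB.apply_flow h.contDiff h.tsupport_subset h.isFlow z t
      have hd : DifferentiableAt ℝ (Φ t) (e x) :=
        (h.isFlow.contDiff_apply (hB.contDiff_hamField h.contDiff h.tsupport_subset)
          (hasCompactSupport_hamField h.hasCompactSupport) t).differentiable (by norm_num) _
      have h5 := fderiv_comp (e x) (h.contDiff.differentiable (by norm_num) (Φ t (e x))) hd
      rw [h4] at h5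
      rw [hamField, hamField, hsharp, ← h5]
    rw [ContinuousLinearMap.comp_apply, ContinuousLinearMap.comp_apply, ← h1, ← h3, h2, ← hey,
      chartDerivSymm_apply he hys]

end PoissonStructure.ChartFlow

/-- Uniqueness of integral curves of Hamiltonian vector fields. -/
theorem PoissonStructure.eqOn_of_isMIntegralCurveOn {H : M → ℝ}
    (hH : ContMDiff 𝓘(ℝ, E) 𝓘(ℝ, ℝ) 2 H) {c₁ c₂ : ℝ → M} {a b : ℝ}
    (h₁ : IsMIntegralCurveOn c₁ (π.hamVF H) (Icc a b))
    (h₂ : IsMIntegralCurveOn c₂ (π.hamVF H) (Icc a b)) (ha : c₁ a = c₂ a) :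
    EqOn c₁ c₂ (Icc a b) := by
  refine fun t ht => forall_Icc_of_eventually_iff (q := fun t => c₁ t = c₂ t) (fun t ht => ?_) ha t
    ht
  -- Agreement is open in time by uniqueness for the chart flow, and disagreement is open because M
  -- is Hausdorff.
  by_cases heq : c₁ t = c₂ t
  · obtain ⟨f, V, Φ, hΦ, hV⟩ := π.exists_chartFlow hH
      (IsManifold.chart_mem_maximalAtlas (I := 𝓘(ℝ, E)) (n := ∞) (c₁ t)) (mem_chart_source E (c₁ t))
    set e := chartAt E (c₁ t)
    have hO : IsOpen (e.source ∩ e ⁻¹' V) := e.isOpen_inter_preimage hΦ.isOpen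
    have hm : c₁ t ∈ e.source ∩ e ⁻¹' V := ⟨mem_chart_source E (c₁ t), hV⟩
    have hev : ∀ᶠ s in 𝓝[Icc a b] t, c₁ s ∈ e.source ∩ e ⁻¹' V ∧ c₂ s ∈ e.source ∩ e ⁻¹' V :=
      ((h₁.continuousWithinAt ht).eventually (hO.mem_nhds hm)).and
        ((h₂.continuousWithinAt ht).eventually (hO.mem_nhds (heq ▸ hm)))
    rw [eventually_nhdsWithin_iff, Metric.eventually_nhds_iff_ball] at hev
    obtain ⟨ε, hε, hball⟩ := hev
    rw [eventually_nhdsWithin_iff]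
    filter_upwards [Metric.ball_mem_nhds t hε] with s hs hsI
    simp only [heq, iff_true]
    have hsub : Icc (min s t) (max s t) ⊆ Metric.ball t ε ∩ Icc a b := by
      intro r hr
      refine ⟨?_, (le_min hsI.1 ht.1).trans hr.1, hr.2.trans (max_le hsI.2 ht.2)⟩
      rw [Metric.mem_ball, Real.dist_eq] at hs ⊢
      refine lt_of_le_of_lt ?_ hs
      rcases le_total s t with h | h
      · rw [min_eq_left h, max_eq_right h] at hr
        rw [abs_of_nonpos (by linarith [hr.2]), abs_of_nonpos (by linarith)]
        linarith [hr.1]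
      · rw [min_eq_right h, max_eq_left h] at hr
        rw [abs_of_nonneg (by linarith [hr.1]), abs_of_nonneg (by linarith)]
        linarith [hr.2]
    have k1 := hΦ.eq_flow hH (h₁.mono fun r hr => (hsub hr).2)
      (fun r hr => (hball r (hsub hr).1 (hsub hr).2).1) (t := t) (s := s)
      ⟨min_le_right _ _, le_max_right _ _⟩ ⟨min_le_left _ _, le_max_left _ _⟩
    have k2 := hΦ.eq_flow hH (h₂.mono fun r hr => (hsub hr).2)
      (fun r hr => (hball r (hsub hr).1 (hsub hr).2).2) (t := t) (s := s)
      ⟨min_le_right _ _, le_max_right _ _⟩ ⟨min_le_left _ _, le_max_left _ _⟩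
    rw [heq, ← k2] at k1
    exact e.injOn (hball s hs hsI).1.1 (hball s hs hsI).2.1 k1
  · have hev : ∀ᶠ s in 𝓝[Icc a b] t, c₁ s ≠ c₂ s :=
      ((h₁.continuousWithinAt ht).prodMk_nhds (h₂.continuousWithinAt ht)).eventually
        (isOpen_ne_fun continuous_fst continuous_snd |>.mem_nhds heq)
    filter_upwards [hev] with s hs
    simp [hs, heq]

end Transport

/-! ### Differentiability of Poincaré maps. -/

section Orbits

open Filter

variable {E : Type*} [NormedAddCommGroup E] [NormedSpace ℝ E] [FiniteDimensional ℝ E]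
  {M : Type*} [TopologicalSpace M] [ChartedSpace E M]
  {π : PoissonStructure E M}

variable (π) in
/-- The Hamiltonian flow of `H` from time `a` to time `b` is defined near `γ a`, stays close to
`γ`, and is differentiable at `γ a` with a Poisson derivative. -/
def PoissonStructure.Transports (H : M → ℝ) (γ : ℝ → M) (a b : ℝ) : Prop :=
  ∃ (F : M → M) (A : E →L[ℝ] E), F (γ a) = γ b ∧
    HasMFDerivAt 𝓘(ℝ, E) 𝓘(ℝ, E) F (γ a) A ∧ π.IsPoissonLin H (γ a) (γ b) A ∧
    ∀ O : Set (ℝ × M), IsOpen O → (∀ s ∈ Icc a b, (s, γ s) ∈ O) →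
      ∀ᶠ x in 𝓝 (γ a), ∃ c : ℝ → M, IsMIntegralCurveOn c (π.hamVF H) (Icc a b) ∧ c a = x ∧
        c b = F x ∧ ∀ s ∈ Icc a b, (s, c s) ∈ O

lemma PoissonStructure.Transports.trans {H : M → ℝ} {γ : ℝ → M} {a b d : ℝ} (hab : a ≤ b)
    (hbd : b ≤ d) (h₁ : π.Transports H γ a b) (h₂ : π.Transports H γ b d) :
    π.Transports H γ a d := by
  obtain ⟨F, A, hF, hA, hP, hc⟩ := h₁
  obtain ⟨F', A', hF', hA', hP', hc'⟩ := h₂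
  have hA'' : HasMFDerivAt 𝓘(ℝ, E) 𝓘(ℝ, E) F' (F (γ a)) A' := by rw [hF]; exact hA'
  refine ⟨F' ∘ F, A'.comp A, by simp [hF, hF'], hA''.comp (γ a) hA, hP'.comp hP, ?_⟩
  intro O hO hγ
  have hcont := hA.continuousAt
  rw [ContinuousAt, hF] at hcont
  filter_upwards [hc O hO fun s hs => hγ s ⟨hs.1, hs.2.trans hbd⟩,
    hcont.eventually (hc' O hO fun s hs => hγ s ⟨hab.trans hs.1, hs.2⟩)]
  rintro x ⟨c, hc1, hca, hcb, hcO⟩ ⟨c', hc1', hca', hcb', hcO'⟩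
  refine ⟨_, IsMIntegralCurveOn.concat hab hbd hc1 hc1' (hcb.trans hca'.symm), ?_, ?_, ?_⟩
  · rw [if_pos hab, hca]
  · split_ifs with h
    · obtain rfl := le_antisymm hbd h
      rw [hcb, ← hca', hcb']; rfl
    · exact hcb'
  · intro s hs
    split_ifs with h
    · exact hcO s ⟨hs.1, h⟩
    · exact hcO' s ⟨(not_le.1 h).le, hs.2⟩

variable [T2Space M] [IsManifold 𝓘(ℝ, E) ∞ M]

lemma PoissonStructure.ChartFlow.transports {H : M → ℝ} (hH : ContMDiff 𝓘(ℝ, E) 𝓘(ℝ, ℝ) 2 H)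
    {e : OpenPartialHomeomorph M E} {f : E → ℝ} {V : Set E} {Φ : ℝ → E → E}
    (h : π.ChartFlow H e f V Φ) {γ : ℝ → M} {a b : ℝ} (hab : a ≤ b)
    (hγ : IsMIntegralCurveOn γ (π.hamVF H) (Icc a b))
    (hγV : ∀ t ∈ Icc a b, γ t ∈ e.source ∩ e ⁻¹' V) : π.Transports H γ a b := by
  have := isManifold_one (E := E) (M := M)
  have he := mem_maximalAtlas_one h.mem_atlas
  have hfl : ∀ s ∈ Icc a b, e (γ s) = Φ (s - a) (e (γ a)) := fun s hs =>
    h.eq_flow hH hγ hγV (left_mem_Icc.2 hab) hs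
  have hma := hγV a (left_mem_Icc.2 hab)
  have hmb := hγV b (right_mem_Icc.2 hab)
  have hb := hfl b (right_mem_Icc.2 hab)
  have hFa : e.symm (Φ (b - a) (e (γ a))) = γ b := by rw [← hb, e.left_inv hmb.1]
  have hpl := h.isPoissonLin hH hma.1 hma.2 (t := b - a) (by rw [← hb]; exact hmb.2)
  rw [hFa] at hpl
  have hd : DifferentiableAt ℝ (Φ (b - a)) (e (γ a)) :=
    (h.isFlow.contDiff_apply (h.isLocalPoisson.contDiff_hamField h.contDiff h.tsupport_subset)
      (hasCompactSupport_hamField h.hasCompactSupport) _).differentiable (by norm_num) _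
  refine ⟨fun x => e.symm (Φ (b - a) (e x)), _, hFa, ?_, hpl, ?_⟩
  · have h1 := hd.hasFDerivAt.hasMFDerivAt.comp (γ a) (hasMFDerivAt_chart he hma.1)
    exact (hasMFDerivAt_chart_symm he (y := Φ (b - a) (e (γ a)))
      (by rw [← hb]; exact e.map_source hmb.1)).comp (γ a) h1
  · intro O hO hγO
    let Q : Set (ℝ × M) := {q | Φ (q.1 - a) (e q.2) ∈ V ∧ (q.1, e.symm (Φ (q.1 - a) (e q.2))) ∈ O}
    have hQ : ∀ s ∈ Icc a b, ∀ᶠ q : M × ℝ in 𝓝 (γ a, s), (q.2, q.1) ∈ Q := by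
      intro s hs
      have hV := (hγV s hs).2
      rw [mem_preimage, hfl s hs] at hV
      have hc1 : ContinuousAt (fun q : M × ℝ => Φ (q.2 - a) (e q.1)) (γ a, s) := by
        have h1 : ContinuousAt (fun q : M × ℝ => (q.2 - a, e q.1)) (γ a, s) := by
          refine ContinuousAt.prodMk (by fun_prop) ?_
          exact (e.continuousAt hma.1).comp (f := fun q : M × ℝ => q.1) continuousAt_fst
        exact (h.contDiff_flow.continuous.continuousAt).comp h1
      have hc2 : ContinuousAt (fun q : M × ℝ => e.symm (Φ (q.2 - a) (e q.1))) (γ a, s) :=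
        ContinuousAt.comp (f := fun q : M × ℝ => Φ (q.2 - a) (e q.1))
          (e.continuousAt_symm (h.subset hV)) hc1
      refine (hc1.eventually (h.isOpen.mem_nhds hV)).and
        ((continuousAt_snd.prodMk hc2).eventually (hO.mem_nhds ?_))
      simp only
      rw [← hfl s hs, e.left_inv (hγV s hs).1]
      exact hγO s hs
    have h1 := isCompact_Icc.eventually_forall_of_forall_eventually (P := fun x s => (s, x) ∈ Q) hQ
    filter_upwards [h1, e.open_source.mem_nhds hma.1] with x hx hxs
    refine ⟨fun t => e.symm (Φ (t - a) (e x)), h.isMIntegralCurveOn hH fun t ht => (hx t ht).1,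
      ?_, rfl, fun s hs => (hx s hs).2⟩
    simp [h.isFlow.zero, e.left_inv hxs]

theorem PoissonStructure.transports {H : M → ℝ} (hH : ContMDiff 𝓘(ℝ, E) 𝓘(ℝ, ℝ) 2 H)
    {γ : ℝ → M} {a b : ℝ} (hab : a ≤ b) (hγ : IsMIntegralCurveOn γ (π.hamVF H) (Icc a b)) :
    π.Transports H γ a b := by
  refine rel_of_local hab (fun x y z hxy hyz h₁ h₂ => h₁.trans hxy hyz h₂) fun t ht => ?_
  obtain ⟨f, V, Φ, hΦ, hV⟩ := π.exists_chartFlow hH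
    (IsManifold.chart_mem_maximalAtlas (I := 𝓘(ℝ, E)) (n := ∞) (γ t)) (mem_chart_source E (γ t))
  have hev := (hγ.continuousWithinAt ht).eventually
    (((chartAt E (γ t)).isOpen_inter_preimage hΦ.isOpen).mem_nhds ⟨mem_chart_source E (γ t), hV⟩)
  rw [eventually_nhdsWithin_iff, Metric.eventually_nhds_iff_ball] at hev
  obtain ⟨η, hη, hball⟩ := hev
  refine ⟨η, hη, fun x hx y hy hxt hyt hxy => ?_⟩
  refine hΦ.transports hH hxy (hγ.mono (Icc_subset_Icc hx.1 hy.2)) fun s hs => hball s ?_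
    ⟨hx.1.trans hs.1, hs.2.trans hy.2⟩
  rw [Metric.mem_ball, Real.dist_eq, abs_lt]
  rw [abs_lt] at hxt hyt
  constructor <;> linarith [hs.1, hs.2, hxt.1, hyt.2]

/-- Integral curves on a compact interval can be extended. -/
theorem PoissonStructure.exists_extension {H : M → ℝ} (hH : ContMDiff 𝓘(ℝ, E) 𝓘(ℝ, ℝ) 2 H)
    {γ : ℝ → M} {a b : ℝ} (hab : a ≤ b) (hγ : IsMIntegralCurveOn γ (π.hamVF H) (Icc a b)) :
    ∃ b' > b, ∃ γ' : ℝ → M, EqOn γ' γ (Icc a b) ∧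
      IsMIntegralCurveOn γ' (π.hamVF H) (Icc a b') := by
  obtain ⟨f, V, Φ, h, hV⟩ := π.exists_chartFlow hH
    (IsManifold.chart_mem_maximalAtlas (I := 𝓘(ℝ, E)) (n := ∞) (γ b)) (mem_chart_source E (γ b))
  set e := chartAt E (γ b)
  have hc : ContinuousAt (fun t => Φ (t - b) (e (γ b))) b := by
    have := h.contDiff_flow.continuous
    exact (this.comp (f := fun t : ℝ => (t - b, e (γ b))) (by fun_prop)).continuousAt
  have hev := hc.eventually (h.isOpen.mem_nhds (by simpa [h.isFlow.zero] using hV))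
  obtain ⟨η, hη, hball⟩ := Metric.eventually_nhds_iff_ball.1 hev
  have h2 := h.isMIntegralCurveOn hH (s := Icc b (b + η / 2)) (a := b) (y := e (γ b))
    fun t ht => hball t (by
      rw [Metric.mem_ball, Real.dist_eq, abs_lt]; constructor <;> linarith [ht.1, ht.2])
  refine ⟨b + η / 2, by linarith, _,
    fun t ht => ?_, IsMIntegralCurveOn.concat hab (by linarith) hγ h2 ?_⟩
  · exact if_pos ht.2
  · simp [h.isFlow.zero, e, mem_chart_source]

lemma PoissonStructure.ChartFlow.hasFDerivAt_flow {H : M → ℝ}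
    {e : OpenPartialHomeomorph M E} {f : E → ℝ} {V : Set E} {Φ : ℝ → E → E}
    (h : π.ChartFlow H e f V Φ) (y : E) :
    HasFDerivAt (fun q : ℝ × E => Φ q.1 q.2)
      ((ContinuousLinearMap.fst ℝ ℝ E).smulRight (hamField (π.tensor e) f y) +
        ContinuousLinearMap.snd ℝ ℝ E) (0, y) := by
  have h1 := (h.contDiff_flow.differentiable (by norm_num) (0, y)).hasFDerivAt
  set D := fderiv ℝ (fun q : ℝ × E => Φ q.1 q.2) (0, y)
  have h2 : HasDerivAt (fun t : ℝ => (t, y)) (1, 0) 0 :=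
    (hasDerivAt_id 0).prodMk (hasDerivAt_const _ _)
  have h3 := (h1.comp_hasDerivAt (f := fun t : ℝ => (t, y)) (0 : ℝ) h2).unique
    (h.isFlow.deriv y 0)
  rw [h.isFlow.zero] at h3
  have h4 : HasFDerivAt (fun z : E => ((0 : ℝ), z)) (ContinuousLinearMap.inr ℝ ℝ E) y :=
    (hasFDerivAt_const _ _).prodMk (hasFDerivAt_id _)
  have h5 := (h1.comp y h4)
  have h6 : (fun q : ℝ × E => Φ q.1 q.2) ∘ (fun z : E => ((0 : ℝ), z)) = id :=
    funext fun z => h.isFlow.zero z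
  rw [h6] at h5
  have h7 := h5.unique (hasFDerivAt_id y)
  have h8 : D = (ContinuousLinearMap.fst ℝ ℝ E).smulRight (hamField (π.tensor e) f y) +
      ContinuousLinearMap.snd ℝ ℝ E := by
    refine ContinuousLinearMap.ext fun u => ?_
    have h9 : D (0, u.2) = u.2 := congrArg (fun L : E →L[ℝ] E => L u.2) h7
    have h10 : u = u.1 • ((1 : ℝ), (0 : E)) + (0, u.2) := by ext <;> simp
    conv_lhs => rw [h10, map_add, map_smul, h3, h9]
    simp
  rw [← h8]
  exact h1

/-- Orbits which start near `γ 0` in the domain of a Poincaré map stay close to `γ`. -/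
theorem IsPoincareMap.eventually_orbit {H : M → ℝ} (hH : ContMDiff 𝓘(ℝ, E) 𝓘(ℝ, ℝ) 2 H)
    {T T' : ℝ} (hT : 0 < T) (hTT' : T < T') {γ : ℝ → M}
    (hγ : IsMIntegralCurveOn γ (π.hamVF H) (Icc 0 T'))  {N : Set M} {τ : M → ℝ}
    (hτ : ContinuousWithinAt τ N (γ 0)) (hτT : τ (γ 0) = T)
    (O : Set (ℝ × M)) (hO : IsOpen O) (hγO : ∀ s ∈ Icc 0 T, (s, γ s) ∈ O) :
    ∀ᶠ x in 𝓝[N] (γ 0), ∀ c : ℝ → M, IsMIntegralCurveOn c (π.hamVF H) (Icc 0 (τ x)) →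
      c 0 = x → ∀ s ∈ Icc 0 (τ x), (s, c s) ∈ O := by
  have hTm : T ∈ Icc 0 T' := ⟨hT.le, hTT'.le⟩
  have h1 : ContinuousWithinAt (fun s => (s, γ s)) (Icc 0 T') T :=
    continuousWithinAt_id.prodMk (hγ.continuousWithinAt hTm)
  have h2 := h1.eventually (hO.mem_nhds (hγO T ⟨hT.le, le_rfl⟩))
  rw [eventually_nhdsWithin_iff, Metric.eventually_nhds_iff_ball] at h2
  obtain ⟨η, hη, hball⟩ := h2
  -- The transition time of a nearby point may exceed T, so γ is followed slightly beyond T, but not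
  -- so far that its extension leaves O.
  set T₂ := min T' (T + η / 2) with hT₂
  have hTT₂ : T < T₂ := lt_min hTT' (by linarith)
  have hT₂' : T₂ ≤ T' := min_le_left _ _
  have hT₂η : T₂ ≤ T + η / 2 := min_le_right _ _
  obtain ⟨F, A, -, -, -, hF⟩ := PoissonStructure.transports hH (hT.le.trans hTT₂.le)
    (hγ.mono (Icc_subset_Icc_right hT₂'))
  have h3 := hF O hO fun s hs => by
    rcases le_total s T with h | h
    · exact hγO s ⟨hs.1, h⟩
    · refine hball s ?_ ⟨hs.1, hs.2.trans hT₂'⟩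
      rw [Metric.mem_ball, Real.dist_eq, abs_lt]; constructor <;> linarith [hs.2]
  have h4 : ∀ᶠ x in 𝓝[N] (γ 0), τ x < T₂ := hτ.eventually (by rw [hτT]; exact Iio_mem_nhds hTT₂)
  filter_upwards [nhdsWithin_le_nhds h3, h4]
  rintro x ⟨c', hc', hc'0, -, hc'O⟩ hx c hc hc0 s hs
  have h5 := PoissonStructure.eqOn_of_isMIntegralCurveOn hH hc
    (hc'.mono (Icc_subset_Icc_right hx.le)) (hc0.trans hc'0.symm) hs
  rw [h5]
  exact hc'O s ⟨hs.1, hs.2.trans hx.le⟩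

/-- A Poincaré map is differentiable at the base point of the orbit. -/
theorem IsPoincareMap.exists_hasMFDerivWithinAt {H : M → ℝ}
    (hH : ContMDiff 𝓘(ℝ, E) 𝓘(ℝ, ℝ) 2 H) {T : ℝ} (hT : 0 < T) {γ : ℝ → M}
    (hγ : IsMIntegralCurveOn γ (π.hamVF H) (Icc 0 T)) {N N' : Set M} (hN : γ 0 ∈ N) {P : M → M}
    (hP : IsPoincareMap π H N N' (γ 0) (γ T) T P) :
    ∃ (A : E →L[ℝ] E) (τ' : E →L[ℝ] ℝ), π.IsPoissonLin H (γ 0) (γ T) A ∧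
      HasMFDerivWithinAt 𝓘(ℝ, E) 𝓘(ℝ, E) P N (γ 0) (A + τ'.smulRight (π.hamE H (γ T))) := by
  have := isManifold_one (E := E) (M := M)
  obtain ⟨hPp, U, hU, τ, hτT, hτ, hPx⟩ := hP
  obtain ⟨T', hTT', γ', hγ', hγ'i⟩ := PoissonStructure.exists_extension hH hT.le hγ
  have hγ0 : γ' 0 = γ 0 := hγ' ⟨le_rfl, hT.le⟩
  have hγT : γ' T = γ T := hγ' ⟨hT.le, le_rfl⟩
  have hTm : T ∈ Icc 0 T' := ⟨hT.le, hTT'.le⟩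
  obtain ⟨f, V, Φ, h, hV⟩ := π.exists_chartFlow hH
    (IsManifold.chart_mem_maximalAtlas (I := 𝓘(ℝ, E)) (n := ∞) (γ T)) (mem_chart_source E (γ T))
  set e := chartAt E (γ T) with he'
  have hes : γ T ∈ e.source := mem_chart_source E (γ T)
  have he := mem_maximalAtlas_one h.mem_atlas
  have hO : IsOpen (e.source ∩ e ⁻¹' V) := e.isOpen_inter_preimage h.isOpen
  have h1 := (hγ'i.continuousWithinAt hTm).eventually
    (hO.mem_nhds (by rw [hγT]; exact ⟨hes, hV⟩))
  rw [eventually_nhdsWithin_iff, Metric.eventually_nhds_iff_ball] at h1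
  obtain ⟨η, hη, hball⟩ := h1
  set r := min (η / 2) (min (T' - T) T) with hr
  have hr0 : 0 < r := lt_min (by linarith) (lt_min (by linarith) hT)
  have hrη : r ≤ η / 2 := min_le_left _ _
  have hrT' : r ≤ T' - T := (min_le_right _ _).trans (min_le_left _ _)
  have hrT : r ≤ T := (min_le_right _ _).trans (min_le_right _ _)
  obtain ⟨F, A, hFT, hFA, hA, hF⟩ := PoissonStructure.transports hH hT.le hγ
  obtain ⟨F', -, -, -, -, hF'⟩ := PoissonStructure.transports hH (b := T + r) (by linarith)
    (hγ'i.mono (Icc_subset_Icc_right (by linarith)))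
  have hFe := hF univ isOpen_univ fun _ _ => mem_univ _
  -- No condition before time T - r, and the chart domain afterwards: nearby orbits are inside the
  -- chart during all of [T - r, T + r], where their transition times fall.
  have hFe' := hF' {q | q.1 < T - r ∨ q.2 ∈ e.source ∩ e ⁻¹' V}
    ((isOpen_lt continuous_fst continuous_const).union (hO.preimage continuous_snd)) fun s hs => by
      rcases lt_or_ge s (T - r) with h | h
      · exact Or.inl h
      · refine Or.inr (hball s ?_ ⟨hs.1, hs.2.trans (by linarith)⟩)
        rw [Metric.mem_ball, Real.dist_eq, abs_lt]; constructor <;> linarith [hs.2]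
  rw [hγ0] at hFe'
  have hτd : MDifferentiableWithinAt 𝓘(ℝ, E) 𝓘(ℝ, ℝ) τ N (γ 0) := by
    have h2 := (hτ (γ 0) ⟨hN, mem_of_mem_nhds hU⟩).mdifferentiableWithinAt (by norm_num)
    exact (mdifferentiableWithinAt_inter hU).1 h2
  let τ' : E →L[ℝ] ℝ := mfderivWithin 𝓘(ℝ, E) 𝓘(ℝ, ℝ) τ N (γ 0)
  have hτ' : HasMFDerivWithinAt 𝓘(ℝ, E) 𝓘(ℝ, ℝ) τ N (γ 0) τ' := hτd.hasMFDerivWithinAt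
  have hτev : ∀ᶠ x in 𝓝[N] (γ 0), τ x ∈ Ioo (T - r) (T + r) :=
    hτd.continuousWithinAt.eventually (by
      rw [hτT]; exact Ioo_mem_nhds (by linarith) (by linarith))
  -- P is the time-T flow map F followed by a correction of duration τ - T in the chart at the end
  -- point. At the base point this gives the derivative A + τ' ⊗ X_H, where A is Poisson.
  have hPe : P =ᶠ[𝓝[N] (γ 0)] fun x => e.symm (Φ (τ x - T) (e (F x))) := by
    filter_upwards [nhdsWithin_le_nhds hFe, nhdsWithin_le_nhds hFe', nhdsWithin_le_nhds hU, hτev,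
      self_mem_nhdsWithin]
    rintro x ⟨c₁, hc₁, hc₁0, hc₁T, -⟩ ⟨c₂, hc₂, hc₂0, -, hc₂V⟩ hxU hxτ hxN
    obtain ⟨-, -, c, hc, hc0, hcτ, -⟩ := hPx x ⟨hxN, hxU⟩
    have k1 := PoissonStructure.eqOn_of_isMIntegralCurveOn hH hc
      (hc₂.mono (Icc_subset_Icc_right hxτ.2.le)) (hc0.trans hc₂0.symm)
      (right_mem_Icc.2 (by linarith [hxτ.1]))
    have k2 := PoissonStructure.eqOn_of_isMIntegralCurveOn hH hc₁
      (hc₂.mono (Icc_subset_Icc_right (by linarith))) (hc₁0.trans hc₂0.symm)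
      (right_mem_Icc.2 hT.le)
    have k3 : ∀ s ∈ Icc (T - r) (T + r), c₂ s ∈ e.source ∩ e ⁻¹' V := fun s hs =>
      (hc₂V s ⟨by linarith [hs.1], hs.2⟩).resolve_left (not_lt.2 hs.1)
    have k4 := h.eq_flow hH (hc₂.mono (Icc_subset_Icc_left (by linarith))) k3 (t := T) (s := τ x)
      ⟨by linarith, by linarith⟩ ⟨hxτ.1.le, hxτ.2.le⟩
    rw [← hcτ, k1, ← hc₁T, k2, ← k4, e.left_inv (k3 _ ⟨hxτ.1.le, hxτ.2.le⟩).1]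
  refine ⟨A, τ', hA, ?_⟩
  have hes' : F (γ 0) ∈ e.source := by rw [hFT]; exact hes
  have d1 : HasMFDerivWithinAt 𝓘(ℝ, E) 𝓘(ℝ, E) (fun x => e (F x)) N (γ 0)
      ((chartDeriv e (γ T)).comp A) := by
    have := (hasMFDerivAt_chart he hes').comp (γ 0) hFA
    rw [hFT] at this
    exact this.hasMFDerivWithinAt
  have d2 : HasMFDerivWithinAt 𝓘(ℝ, E) 𝓘(ℝ, ℝ × E) (fun x => (τ x - T, e (F x))) N (γ 0)
      (τ'.prod ((chartDeriv e (γ T)).comp A)) := by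
    have h3 : HasMFDerivWithinAt 𝓘(ℝ, E) 𝓘(ℝ, ℝ) (fun x => τ x - T) N (γ 0) τ' := by
      have := ((hasFDerivAt_id (𝕜 := ℝ) (τ (γ 0))).sub_const T).hasMFDerivAt.comp_hasMFDerivWithinAt
        (γ 0) hτ'
      exact this
    exact ⟨h3.1.prodMk d1.1, HasFDerivWithinAt.prodMk h3.2 d1.2⟩
  have hy : ((τ (γ 0) - T, e (F (γ 0))) : ℝ × E) = (0, e (γ T)) := by rw [hτT, hFT, sub_self]
  have d3 := h.hasFDerivAt_flow (e (γ T))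
  rw [← hy] at d3
  have d4 := d3.hasMFDerivAt.comp_hasMFDerivWithinAt (γ 0) d2
  have hz : Φ (τ (γ 0) - T) (e (F (γ 0))) = e (γ T) := by
    rw [hτT, hFT, sub_self, h.isFlow.zero]
  have d5 := (hasMFDerivAt_chart_symm he (e.map_source hes))
  rw [← hz] at d5
  have d6 := d5.comp_hasMFDerivWithinAt (γ 0) d4
  have hlin : (chartDerivSymm e (e (γ T))).comp
      (((ContinuousLinearMap.fst ℝ ℝ E).smulRight (hamField (π.tensor e) f (e (γ T))) +
        ContinuousLinearMap.snd ℝ ℝ E).comp (τ'.prod ((chartDeriv e (γ T)).comp A))) =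
      A + τ'.smulRight (π.hamE H (γ T)) := by
    ext u
    simp only [ContinuousLinearMap.comp_apply, add_apply,
      ContinuousLinearMap.smulRight_apply, ContinuousLinearMap.prod_apply,
      ContinuousLinearMap.coe_fst', ContinuousLinearMap.coe_snd', map_add, map_smul]
    rw [h.hamField_eq hH hes hV, chartDerivSymm_apply he hes, chartDerivSymm_apply he hes, add_comm]
  rw [← hlin]
  have d7 := d6.congr_of_eventuallyEq hPe (by
    simp only [Function.comp_apply]
    rw [hPp, hz, e.left_inv hes])
  rw [hz] at d7
  exact d7

end Orbits

/-! ### Tangent spaces of transversals, and symplecticity of the derivative. -/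

section DerivMatrix

open Filter

variable {E : Type*} [NormedAddCommGroup E] [NormedSpace ℝ E] [FiniteDimensional ℝ E]
  {M : Type*} [TopologicalSpace M] [ChartedSpace E M]
  {π : PoissonStructure E M}

/-- The tangent space as a subspace of the model space. -/
def tangentE (N : Set M) (x : M) : Submodule ℝ E := tangentAt (E := E) N x

lemma tangentE_le {N : Set M} {x : M} {Q : Submodule ℝ E}
    (h : ∀ (c : ℝ → M) (v : E), c 0 = x → (∀ᶠ t in 𝓝 (0 : ℝ), c t ∈ N) →
      HasMFDerivAt 𝓘(ℝ, ℝ) 𝓘(ℝ, E) c 0 ((1 : ℝ →L[ℝ] ℝ).smulRight v) → v ∈ Q) :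
    tangentE N x ≤ Q := by
  let q : TangentSpace 𝓘(ℝ, E) x → Prop := fun v => @Membership.mem E (Submodule ℝ E) _ Q v
  have h0 : (0 : E) ∈ Q := Q.zero_mem
  have hadd : ∀ a b : E, a ∈ Q → b ∈ Q → a + b ∈ Q := fun _ _ => Q.add_mem
  have hsmul : ∀ (a : ℝ) (b : E), b ∈ Q → a • b ∈ Q := fun a _ => Q.smul_mem a
  intro v hv
  refine Submodule.span_induction (p := fun v _ => q v) ?_ ?_ ?_ ?_ hv
  · rintro v ⟨c, -, h0, hcN, hc⟩
    exact h c v h0 hcN hc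
  · exact h0
  · exact fun a b _ _ h1 h2 => hadd a b h1 h2
  · exact fun a b _ h1 => hsmul a b h1

lemma mem_tangentE {N : Set M} {x : M} {c : ℝ → M} {v : E}
    (hc1 : ContMDiffAt 𝓘(ℝ, ℝ) 𝓘(ℝ, E) 1 c 0) (h0 : c 0 = x) (hN : ∀ᶠ t in 𝓝 (0 : ℝ), c t ∈ N)
    (hc : HasMFDerivAt 𝓘(ℝ, ℝ) 𝓘(ℝ, E) c 0 ((1 : ℝ →L[ℝ] ℝ).smulRight v)) :
    v ∈ tangentE N x := by
  have h : (show TangentSpace 𝓘(ℝ, E) x from v) ∈ tangentAt (E := E) N x :=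
    Submodule.subset_span ⟨c, hc1, h0, hN, hc⟩
  exact h

lemma exists_ker_eq (L : Submodule ℝ E) : ∃ q : E →L[ℝ] E, ∀ u, q u = 0 ↔ u ∈ L := by
  obtain ⟨L', hL'⟩ := L.exists_isCompl
  refine ⟨LinearMap.toContinuousLinearMap (L'.subtype ∘ₗ Submodule.projectionOnto L' L hL'.symm),
    fun u => ?_⟩
  simp

lemma mem_of_hasDerivAt {L : Submodule ℝ E} {u : ℝ → E} {v : E} {t : ℝ} (hu : HasDerivAt u v t)
    (hL : ∀ᶠ s in 𝓝 t, u s ∈ L) : v ∈ L := by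
  obtain ⟨q, hq⟩ := exists_ker_eq L
  have h1 := q.hasFDerivAt.comp_hasDerivAt t hu
  have h2 : HasDerivAt (q ∘ u) 0 t := (hasDerivAt_const t (0 : E)).congr_of_eventuallyEq (by
    filter_upwards [hL] with s hs using (hq _).2 hs)
  exact (hq _).1 (h1.unique h2)

lemma IsC1Submanifold.exists_chart {k : ℕ} {N : Set M} (hN : IsC1Submanifold E k N) {p : M}
    (hp : p ∈ N) : ∃ e ∈ IsManifold.maximalAtlas 𝓘(ℝ, E) 1 M, p ∈ e.source ∧
      ∃ L : Submodule ℝ E, Module.finrank ℝ L = k ∧ ∀ x ∈ e.source, x ∈ N ↔ e x ∈ L := by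
  obtain ⟨e, he, hpe, L, hk, hL⟩ := hN p hp
  refine ⟨e, he, hpe, L, hk, fun x hx => ?_⟩
  have := Set.ext_iff.1 hL x
  simpa [hx] using this

variable [T2Space M] [IsManifold 𝓘(ℝ, E) ∞ M]

lemma mem_of_curve {e : OpenPartialHomeomorph M E}
    (he : e ∈ IsManifold.maximalAtlas 𝓘(ℝ, E) 1 M) {L : Submodule ℝ E} {N : Set M}
    (hL : ∀ x ∈ e.source, x ∈ N ↔ e x ∈ L) {c : ℝ → M} {v : E} (hc0 : c 0 ∈ e.source)
    (hcN : ∀ᶠ t in 𝓝 (0 : ℝ), c t ∈ N)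
    (hc : HasMFDerivAt 𝓘(ℝ, ℝ) 𝓘(ℝ, E) c 0 ((1 : ℝ →L[ℝ] ℝ).smulRight v)) :
    chartDeriv e (c 0) v ∈ L := by
  have := isManifold_one (E := E) (M := M)
  have h1 := ((hasMFDerivAt_chart he hc0).comp (0 : ℝ) hc).hasFDerivAt
  have h2 : HasFDerivAt (e ∘ c) ((chartDeriv e (c 0)).comp ((1 : ℝ →L[ℝ] ℝ).smulRight v)) 0 := h1
  have h3 : HasDerivAt (e ∘ c) (chartDeriv e (c 0) v) 0 := by simpa using h2.hasDerivAt
  refine mem_of_hasDerivAt h3 ?_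
  filter_upwards [hcN, hc.continuousAt.eventually (e.open_source.mem_nhds hc0)] with t ht hts
  exact (hL _ hts).1 ht

/-- In a straightening chart, velocities of curves in N lie in L; conversely, for w in L the
straight line e p + t w stays in L because e p does. -/
lemma tangentE_eq {e : OpenPartialHomeomorph M E}
    (he : e ∈ IsManifold.maximalAtlas 𝓘(ℝ, E) 1 M) {L : Submodule ℝ E} {N : Set M} {p : M}
    (hpe : p ∈ e.source) (hp : p ∈ N) (hL : ∀ x ∈ e.source, x ∈ N ↔ e x ∈ L) :
    tangentE N p = L.comap (chartDeriv e p).toLinearMap := by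
  have := isManifold_one (E := E) (M := M)
  refine le_antisymm (tangentE_le ?_) fun v hv => ?_
  · rintro c v rfl hcN hc
    exact mem_of_curve he hL hpe hcN hc
  · let w : E := chartDeriv e p v
    have hline : ContDiff ℝ 1 (fun t : ℝ => e p + t • w) := by fun_prop
    have h0 : e p + (0 : ℝ) • w = e p := by simp
    have hd : HasDerivAt (fun t : ℝ => e p + t • w) w 0 := by
      simpa using ((hasDerivAt_id (0 : ℝ)).smul_const w).const_add (e p)
    have hev : ∀ᶠ t : ℝ in 𝓝 0, e p + t • w ∈ e.target :=
      hline.continuous.continuousAt.eventually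
        (e.open_target.mem_nhds (by simpa using e.map_source hpe))
    have h1 : HasMFDerivAt 𝓘(ℝ, E) 𝓘(ℝ, E) e.symm (e p + (0 : ℝ) • w)
        (chartDerivSymm (E := E) e (e p)) := by
      rw [h0]; exact hasMFDerivAt_chart_symm he (e.map_source hpe)
    have h2 : HasMFDerivAt 𝓘(ℝ, ℝ) 𝓘(ℝ, E) (fun t : ℝ => e.symm (e p + t • w)) 0
      ((chartDerivSymm e (e p)).comp (ContinuousLinearMap.toSpanSingleton ℝ w)) :=
      h1.comp (0 : ℝ) hd.hasFDerivAt.hasMFDerivAt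
    refine mem_tangentE (c := fun t => e.symm (e p + t • w)) ?_ ?_ ?_ ?_
    · have h3 := (contMDiffOn_symm_of_mem_maximalAtlas he).contMDiffAt
        (e.open_target.mem_nhds (e.map_source hpe))
      rw [← h0] at h3
      exact h3.comp (0 : ℝ) hline.contMDiff.contMDiffAt
    · simp [e.left_inv hpe]
    · filter_upwards [hev] with t ht
      rw [hL _ (e.map_target ht), e.right_inv ht]
      exact L.add_mem ((hL p hpe).1 hp) (L.smul_mem _ hv)
    · have h4 : (chartDerivSymm e (e p)).comp (ContinuousLinearMap.toSpanSingleton ℝ w) =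
        (1 : ℝ →L[ℝ] ℝ).smulRight v := by
        ext
        simp [w, chartDerivSymm_apply he hpe]
      exact h2.congr_mfderiv h4

/-- The derivative of a map between submanifolds maps tangent spaces to tangent spaces. -/
lemma map_tangentE_le {k : ℕ} {N N' : Set M} (hN' : IsC1Submanifold E k N') {p : M} {P : M → M}
    (hpN : p ∈ N) (hP : ∀ᶠ x in 𝓝[N] p, P x ∈ N') {D : E →L[ℝ] E}
    (hD : HasMFDerivWithinAt 𝓘(ℝ, E) 𝓘(ℝ, E) P N p D) {v : E} (hv : v ∈ tangentE N p) :
    D v ∈ tangentE N' (P p) := by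
  have := isManifold_one (E := E) (M := M)
  have hPp : P p ∈ N' := hP.self_of_nhdsWithin hpN
  obtain ⟨e, he, hpe, L, -, hL⟩ := hN'.exists_chart hPp
  suffices h : tangentE N p ≤ (tangentE N' (P p)).comap D.toLinearMap from h hv
  refine tangentE_le ?_
  rintro c v rfl hcN hc
  change D v ∈ tangentE N' (P (c 0))
  rw [tangentE_eq he hpe hPp hL]
  have h1 : HasMFDerivWithinAt 𝓘(ℝ, ℝ) 𝓘(ℝ, E) (P ∘ c) (c ⁻¹' N) 0
      (D.comp ((1 : ℝ →L[ℝ] ℝ).smulRight v)) :=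
    hD.comp (0 : ℝ) hc.hasMFDerivWithinAt Subset.rfl
  have h2 := h1.hasMFDerivAt hcN
  have h3 : D.comp ((1 : ℝ →L[ℝ] ℝ).smulRight v) = (1 : ℝ →L[ℝ] ℝ).smulRight (D v) := by
    ext; simp
  refine mem_of_curve (c := P ∘ c) he hL hpe ?_ (h2.congr_mfderiv h3)
  have h4 : Tendsto c (𝓝 0) (𝓝[N] (c 0)) :=
    tendsto_nhdsWithin_iff.2 ⟨hc.continuousAt, hcN⟩
  exact h4.eventually hP

lemma IsSymplecticBasis.exists_covectors {d : ℕ} {N : Set M} {p : M} {b : Fin d ⊕ Fin d → E}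
    (hb : IsSymplecticBasis π N p b) : ∃ ξ : Fin d ⊕ Fin d → (E →L[ℝ] ℝ),
      (∀ i, π.sharpE p (ξ i) = b i) ∧ ∀ i j, ξ i (b j) = Matrix.J (Fin d) ℝ j i := by
  obtain ⟨ξ, h1, h2⟩ := hb.symplectic
  refine ⟨ξ, h1, fun i j => ?_⟩
  rw [← h2 i j, h1]
  rfl

lemma IsSymplecticBasis.span_eq_tangentE {d : ℕ} {N : Set M} {p : M} {b : Fin d ⊕ Fin d → E}
    (hb : IsSymplecticBasis π N p b) : Submodule.span ℝ (range b) = tangentE N p := hb.span_eq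

lemma IsSymplecticBasis.mem {d : ℕ} {N : Set M} {p : M} {b : Fin d ⊕ Fin d → E}
    (hb : IsSymplecticBasis π N p b) (i : Fin d ⊕ Fin d) : b i ∈ tangentE N p := by
  rw [← hb.span_eq_tangentE]
  exact Submodule.subset_span ⟨i, rfl⟩

/-- The differential of `H` as a covector of the model space. -/
def dE (H : M → ℝ) (x : M) : E →L[ℝ] ℝ := dAt (E := E) H x

lemma PoissonStructure.hamE_eq (H : M → ℝ) (x : M) : π.hamE H x = π.sharpE x (dE H x) := rfl

lemma PoissonStructure.skewE (x : M) (ξ η : E →L[ℝ] ℝ) : ξ (π.sharpE x η) = -η (π.sharpE x ξ) :=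
  π.skew x ξ η

lemma IsTransversal.sup_eqE {H : M → ℝ} {d : ℕ} {N : Set M} {p : M}
    (hN : IsTransversal π H d N p) : tangentE N p ⊔ Submodule.span ℝ {π.hamE H p} =
      LinearMap.range (π.sharpE p) ⊓ LinearMap.ker (dE H p).toLinearMap := hN.sup_eq

lemma IsTransversal.disjointE {H : M → ℝ} {d : ℕ} {N : Set M} {p : M}
    (hN : IsTransversal π H d N p) :
    Disjoint (tangentE N p) (Submodule.span ℝ {π.hamE H p}) := hN.disjoint

lemma IsTransversal.dE_eq_zero {H : M → ℝ} {d : ℕ} {N : Set M} {p : M}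
    (hN : IsTransversal π H d N p) {v : E} (hv : v ∈ tangentE N p) : dE H p v = 0 := by
  have h : v ∈ LinearMap.range (π.sharpE p) ⊓ LinearMap.ker (dE H p).toLinearMap := by
    rw [← hN.sup_eqE]
    exact Submodule.mem_sup_left hv
  exact h.2

/-- By skewness ξ (X_H) = -dH (♯ ξ), and dH vanishes on the transversal. This removes the component
along X_H, which comes from the varying transition time, from every symplectic pairing. -/
lemma IsTransversal.apply_hamE {H : M → ℝ} {d : ℕ} {N : Set M} {p : M}
    (hN : IsTransversal π H d N p) {ξ : E →L[ℝ] ℝ} (hξ : π.sharpE p ξ ∈ tangentE N p) :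
    ξ (π.hamE H p) = 0 := by
  rw [π.hamE_eq, π.skewE, hN.dE_eq_zero hξ, neg_zero]

/-- The derivative of a Poincaré map is given by a symplectic matrix. -/
theorem IsPoincareMap.exists_isDerivMatrix {H : M → ℝ}
    (hH : ContMDiff 𝓘(ℝ, E) 𝓘(ℝ, ℝ) 2 H) {d : ℕ} {T : ℝ} (hT : 0 < T) {γ : ℝ → M}
    (hγ : IsMIntegralCurveOn γ (π.hamVF H) (Icc 0 T)) {N N' : Set M}
    (hN : IsTransversal π H d N (γ 0)) (hN' : IsTransversal π H d N' (γ T)) {P : M → M}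
    (hP : IsPoincareMap π H N N' (γ 0) (γ T) T P) {b b' : Fin d ⊕ Fin d → E}
    (hb : IsSymplecticBasis π N (γ 0) b) (hb' : IsSymplecticBasis π N' (γ T) b') :
    ∃ (L : Matrix (Fin d ⊕ Fin d) (Fin d ⊕ Fin d) ℝ) (D : E →L[ℝ] E),
      L ∈ Matrix.symplecticGroup (Fin d) ℝ ∧
      HasMFDerivWithinAt 𝓘(ℝ, E) 𝓘(ℝ, E) P N (γ 0) D ∧
      ∀ j, D (b j) = ∑ i, L i j • b' i := by
  obtain ⟨A, τ', hA, hD⟩ := IsPoincareMap.exists_hasMFDerivWithinAt hH hT hγ hN.mem hP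
  obtain ⟨hPp, U, hU, τ, -, -, hPx⟩ := hP
  set X' := π.hamE H (γ T) with hX'
  set D := A + τ'.smulRight X' with hDdef
  have hPev : ∀ᶠ x in 𝓝[N] (γ 0), P x ∈ N' := by
    filter_upwards [self_mem_nhdsWithin, nhdsWithin_le_nhds hU] with x hx hxU
    exact (hPx x ⟨hx, hxU⟩).2.1
  have hmem : ∀ j, D (b j) ∈ Submodule.span ℝ (range b') := fun j => by
    rw [hb'.span_eq_tangentE, ← hPp]
    exact map_tangentE_le hN'.submanifold hN.mem hPev hD (hb.mem j)
  have hex : ∀ j, ∃ l : Fin d ⊕ Fin d → ℝ, ∑ i, l i • b' i = D (b j) := fun j =>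
    (Submodule.mem_span_range_iff_exists_fun ℝ).1 (hmem j)
  choose l hl using hex
  refine ⟨Matrix.of fun i j => l j i, D, ?_, hD, fun j => (hl j).symm⟩
  obtain ⟨ξ, hξ, hξJ⟩ := hb.exists_covectors
  obtain ⟨ξ', hξ', hξJ'⟩ := hb'.exists_covectors
  -- The relation for D (b j) is pulled back by A, which is injective, carries X_H to X_H, and maps
  -- ♯ (A* ξ') to ♯ ξ'.
  have hbj : ∀ j, b j = ∑ k, l j k • π.sharpE (γ 0) ((ξ' k).comp A) -
      τ' (b j) • π.hamE H (γ 0) := by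
    intro j
    apply hA.injective
    have h1 : D (b j) = A (b j) + τ' (b j) • X' := rfl
    rw [map_sub, map_sum, map_smul, hA.ham, eq_sub_iff_add_eq, ← h1, ← hl j]
    refine Finset.sum_congr rfl fun k _ => ?_
    rw [map_smul, ← hA.sharp, hξ']
  have hAb : ∀ i k, (ξ' k) (A (b i)) = ∑ m, l i m * Matrix.J (Fin d) ℝ m k := by
    intro i k
    have h1 : A (b i) = ∑ m, l i m • b' m - τ' (b i) • X' := by
      rw [hl i, hDdef]; simp
    have h2 : ξ' k X' = 0 := hN'.apply_hamE (by rw [hξ']; exact hb'.mem k)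
    rw [h1, map_sub, map_sum, map_smul, h2, smul_zero, sub_zero]
    exact Finset.sum_congr rfl fun m _ => by rw [map_smul, hξJ', smul_eq_mul]
  -- The symplectic form on b i and b j is evaluated once directly and once through the images in
  -- the basis b'. Terms along X_H drop out at both ends, and equality of the two values is the
  -- symplectic relation for the matrix.
  have key : ∀ i j, Matrix.J (Fin d) ℝ j i =
      -∑ k, l j k * ∑ m, l i m * Matrix.J (Fin d) ℝ m k := by
    intro i j
    rw [← hξJ i j]
    conv_lhs => rw [hbj j]
    have h2 : ξ i (π.hamE H (γ 0)) = 0 := hN.apply_hamE (by rw [hξ]; exact hb.mem i)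
    rw [map_sub, map_sum, map_smul, h2, smul_zero, sub_zero, ← Finset.sum_neg_distrib]
    refine Finset.sum_congr rfl fun k _ => ?_
    rw [map_smul, π.skewE, hξ, smul_eq_mul, ← hAb i k, ContinuousLinearMap.comp_apply, mul_neg]
  rw [SymplecticGroup.mem_iff']
  ext j i
  rw [key i j, Matrix.mul_apply, ← Finset.sum_neg_distrib]
  simp only [Matrix.mul_apply, Matrix.transpose_apply, Matrix.of_apply, Finset.sum_mul]
  rw [Finset.sum_comm]
  refine Finset.sum_congr rfl fun k _ => ?_
  rw [Finset.mul_sum, ← Finset.sum_neg_distrib]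
  refine Finset.sum_congr rfl fun m _ => ?_
  have hJ : Matrix.J (Fin d) ℝ k m = -Matrix.J (Fin d) ℝ m k := by
    have := congrFun (congrFun (Matrix.J_transpose (Fin d) ℝ) m) k
    simpa using this
  rw [hJ]
  ring

lemma IsSymplecticBasis.finrank_tangentE {d : ℕ} {N : Set M} {p : M} {b : Fin d ⊕ Fin d → E}
    (hb : IsSymplecticBasis π N p b) : Module.finrank ℝ (tangentE (E := E) N p) = 2 * d := by
  have h : LinearIndependent ℝ b := hb.linearIndependent
  rw [← hb.span_eq_tangentE, finrank_span_eq_card h]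
  simp [two_mul]

/-- If X_H(p) = 0, then T_p N would be all of im ♯ ∩ ker dH. That space has dimension at least 2 (d
+ 1) - 1, more than 2 d. -/
lemma IsTransversal.hamE_ne_zero {H : M → ℝ} {d : ℕ} (hπ : π.IsRegular (d + 1)) {N : Set M}
    {p : M} (hN : IsTransversal π H d N p) {b : Fin d ⊕ Fin d → E}
    (hb : IsSymplecticBasis π N p b) : π.hamE H p ≠ 0 := by
  intro h0
  have h1 := hN.sup_eqE
  rw [h0, Submodule.span_zero_singleton, sup_bot_eq] at h1
  have h2 := hb.finrank_tangentE
  have h3 : Module.finrank ℝ (LinearMap.range (π.sharpE p)) = 2 * (d + 1) := hπ p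
  have h4 := Submodule.finrank_sup_add_finrank_inf_eq (LinearMap.range (π.sharpE p))
    (LinearMap.ker (dE H p).toLinearMap)
  have h5 := LinearMap.finrank_range_add_finrank_ker (dE (E := E) H p).toLinearMap
  have h6 : Module.finrank ℝ (LinearMap.range (dE (E := E) H p).toLinearMap) ≤ 1 := by
    simpa using Submodule.finrank_le (LinearMap.range (dE (E := E) H p).toLinearMap)
  have h7 := Submodule.finrank_le
    (LinearMap.range (π.sharpE p) ⊔ LinearMap.ker (dE (E := E) H p).toLinearMap)
  rw [← h1, h2, h3] at h4
  omega

end DerivMatrix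

/-! ### Projection along a flow onto a transversal in a level set. -/

section FlowSection

open Filter

variable {E : Type*} [NormedAddCommGroup E] [NormedSpace ℝ E] [FiniteDimensional ℝ E]
  {G : Type*} [NormedAddCommGroup G] [NormedSpace ℝ G]

lemma exists_projection (L : Submodule ℝ E) :
    ∃ q : E →L[ℝ] E, (∀ u, q u ∈ L) ∧ ∀ u ∈ L, q u = u := by
  obtain ⟨L', hL'⟩ := L.exists_isCompl
  refine ⟨LinearMap.toContinuousLinearMap (L.subtype ∘ₗ Submodule.projectionOnto L L' hL'),
    fun u => (Submodule.projectionOnto L L' hL' u).2, fun u hu => ?_⟩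
  have := Submodule.projectionOnto_apply_left hL' ⟨u, hu⟩
  exact congrArg Subtype.val this

/-- A subspace contained in a level set of `Q` is locally the whole level set of `(Q, l)`. -/
lemma eventually_mem_of_level {Q : E → G} {Q' : E →L[ℝ] G} {z₀ : E} {L : Submodule ℝ E}
    (hQ : HasStrictFDerivAt Q Q' z₀) (hz₀ : z₀ ∈ L)
    (hQL : ∀ᶠ z in 𝓝 z₀, z ∈ L → Q z = Q z₀) {l : E →L[ℝ] ℝ} (hl : ∀ u ∈ L, l u = 0)
    (hker : ∀ u, Q' u = 0 → l u = 0 → u ∈ L) :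
    ∀ᶠ z in 𝓝 z₀, l z = 0 → Q z = Q z₀ → z ∈ L := by
  obtain ⟨q, hqL, hq⟩ := exists_projection L
  -- A point z is compared with its projection q z in L. The difference lies in R, on which Q' is
  -- injective, hence bounded below.
  let R : Submodule ℝ E := LinearMap.ker q.toLinearMap ⊓ LinearMap.ker l.toLinearMap
  have hinj : LinearMap.ker (Q'.toLinearMap.domRestrict R) = ⊥ := by
    rw [LinearMap.ker_eq_bot']
    rintro ⟨w, hw1, hw2⟩ hw
    have h1 : w ∈ L := hker w hw hw2
    have h2 : q w = 0 := hw1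
    rw [hq w h1] at h2
    exact Subtype.ext h2
  obtain ⟨K, hK, hanti⟩ := (Q'.toLinearMap.domRestrict R).exists_antilipschitzWith hinj
  have hbound : ∀ w, q w = 0 → l w = 0 → ‖w‖ ≤ K * ‖Q' w‖ := fun w h1 h2 => by
    have := hanti.le_mul_dist (⟨w, h1, h2⟩ : R) 0
    simpa [dist_eq_norm] using this
  have hKr : (0 : ℝ) < K := hK
  -- K is the constant of the lower bound on R. Since Q z = Q (q z), strict differentiability with
  -- constant 1 / (2 K) gives ‖z - q z‖ ≤ ‖z - q z‖ / 2, so z = q z.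
  have h1 := hQ.isLittleO.def (c := 1 / (2 * K)) (by positivity)
  have hq0 : q z₀ = z₀ := hq z₀ hz₀
  have h2 : Tendsto (fun z => (z, q z)) (𝓝 z₀) (𝓝 (z₀, z₀)) := by
    have : ContinuousAt (fun z => (z, q z)) z₀ := by fun_prop
    rwa [ContinuousAt, hq0] at this
  have h3 : Tendsto q (𝓝 z₀) (𝓝 z₀) := by
    have : ContinuousAt q z₀ := by fun_prop
    rwa [ContinuousAt, hq0] at this
  filter_upwards [h2.eventually h1, h3.eventually hQL] with z hz hzq hlz hQz
  have h4 := hzq (hqL z)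
  simp only [hQz, h4, sub_self, zero_sub, norm_neg] at hz
  have h5 := hbound (z - q z) (by rw [map_sub, hq _ (hqL z), sub_self])
    (by rw [map_sub, hlz, hl _ (hqL z), sub_self])
  have h6 : (K : ℝ) * (1 / (2 * K) * ‖z - q z‖) = ‖z - q z‖ / 2 := by field_simp
  have h7 : ‖z - q z‖ ≤ ‖z - q z‖ / 2 := by
    rw [← h6]
    exact h5.trans (mul_le_mul_of_nonneg_left hz hKr.le)
  have h8 : z - q z = 0 := norm_le_zero_iff.1 (by linarith [norm_nonneg (z - q z)])
  rw [sub_eq_zero.1 h8]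
  exact hqL z

/-- A level set of a first integral `Q` of a flow is locally the union of the orbits through a
transversal submanifold, which is given as the preimage of `L` under the coordinate map `k`. -/
theorem exists_flow_section {Q : E → G} {Φ : ℝ → E → E} {k j : E → E} {y₀ X₀ : E}
    {L : Submodule ℝ E} (hΦ : ContDiff ℝ 1 fun q : ℝ × E => Φ q.1 q.2)
    (hΦd : HasFDerivAt (fun q : ℝ × E => Φ q.1 q.2)
      ((ContinuousLinearMap.fst ℝ ℝ E).smulRight X₀ + ContinuousLinearMap.snd ℝ ℝ E) (0, y₀))
    (hΦ0 : Φ 0 y₀ = y₀) (hk : ContDiffAt ℝ 1 k y₀) (hj : ContDiffAt ℝ 1 j (k y₀))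
    (hjk : ∀ᶠ y in 𝓝 y₀, j (k y) = y) (hkj : ∀ᶠ z in 𝓝 (k y₀), k (j z) = z)
    (hQ : ContDiffAt ℝ 1 Q y₀) (hkL : k y₀ ∈ L)
    (hQL : ∀ᶠ z in 𝓝 (k y₀), z ∈ L → Q (j z) = Q y₀)
    (hker : ∀ u, fderiv ℝ Q y₀ u = 0 → ∃ a : ℝ, fderiv ℝ k y₀ (u - a • X₀) ∈ L)
    (hX : fderiv ℝ k y₀ X₀ ∉ L)
    (hQΦ : ∀ᶠ q : ℝ × E in 𝓝 (0, y₀), Q (Φ q.1 q.2) = Q q.2) :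
    ∃ s : E → ℝ, ContDiffAt ℝ 1 s y₀ ∧ s y₀ = 0 ∧
      (∀ᶠ y in 𝓝 y₀, Q y = Q y₀ → k (Φ (-s y) y) ∈ L) ∧
      ∀ u, fderiv ℝ k y₀ u ∈ L → fderiv ℝ s y₀ u = 0 := by
  -- A functional that vanishes on L but not on the flow direction. The time s y is determined by
  -- requiring l to vanish at the point of the orbit of y at time -s y; its t-derivative is nonzero,
  -- so the implicit function theorem applies.
  obtain ⟨l', hl'X, hl'L⟩ := Submodule.exists_le_ker_of_notMem hX
  let l : E →L[ℝ] ℝ := LinearMap.toContinuousLinearMap l'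
  have hlL : ∀ u ∈ L, l u = 0 := fun u hu => hl'L hu
  have hlX : l (fderiv ℝ k y₀ X₀) ≠ 0 := hl'X
  have hkd := (hk.differentiableAt (by norm_num)).hasFDerivAt
  have hjd := (hj.differentiableAt (by norm_num)).hasFDerivAt
  have hjk0 : j (k y₀) = y₀ := hjk.self_of_nhds
  -- the implicit function
  let F : E × ℝ → ℝ := fun q => l (k (Φ (-q.2) q.1))
  have hswap : HasFDerivAt (fun q : E × ℝ => (-q.2, q.1))
      ((-ContinuousLinearMap.snd ℝ E ℝ).prod (ContinuousLinearMap.fst ℝ E ℝ)) (y₀, 0) :=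
    (hasFDerivAt_snd.neg).prodMk hasFDerivAt_fst
  have hΨ0 : Φ (-0) y₀ = y₀ := by rw [neg_zero, hΦ0]
  have hΨc : ContDiffAt ℝ 1 (fun q : E × ℝ => Φ (-q.2) q.1) (y₀, 0) := by
    have h : ContDiff ℝ 1 (fun q : E × ℝ => (-q.2, q.1)) := by fun_prop
    exact (hΦ.comp h).contDiffAt
  have hF : ContDiffAt ℝ 1 F (y₀, 0) := by
    refine l.contDiff.contDiffAt.comp (y₀, (0 : ℝ)) (ContDiffAt.comp (y₀, (0 : ℝ)) ?_ hΨc)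
    simpa only [hΨ0] using hk
  have hFd : HasFDerivAt F ((l.comp (fderiv ℝ k y₀)).comp
      (((ContinuousLinearMap.fst ℝ ℝ E).smulRight X₀ + ContinuousLinearMap.snd ℝ ℝ E).comp
      ((-ContinuousLinearMap.snd ℝ E ℝ).prod (ContinuousLinearMap.fst ℝ E ℝ)))) (y₀, 0) := by
    have h1 : HasFDerivAt (fun q : ℝ × E => Φ q.1 q.2)
      ((ContinuousLinearMap.fst ℝ ℝ E).smulRight X₀ + ContinuousLinearMap.snd ℝ ℝ E)
      ((fun q : E × ℝ => (-q.2, q.1)) (y₀, 0)) := by simpa using hΦd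
    have h2 := h1.comp (y₀, (0 : ℝ)) hswap
    have h3 : HasFDerivAt (fun y => l (k y)) (l.comp (fderiv ℝ k y₀))
        (((fun q : ℝ × E => Φ q.1 q.2) ∘ fun q : E × ℝ => (-q.2, q.1)) (y₀, 0)) := by
      have h4 : ((fun q : ℝ × E => Φ q.1 q.2) ∘ fun q : E × ℝ => (-q.2, q.1)) (y₀, 0) = y₀ := hΨ0
      rw [h4]
      exact l.hasFDerivAt.comp y₀ hkd
    exact h3.comp (y₀, (0 : ℝ)) h2
  have hinv : (fderiv ℝ F (y₀, 0) ∘L .inr ℝ E ℝ).IsInvertible := by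
    have h1 : fderiv ℝ F (y₀, 0) ∘L .inr ℝ E ℝ =
        ((ContinuousLinearEquiv.unitsEquivAut ℝ (Units.mk0 _ (neg_ne_zero.2 hlX)) : ℝ ≃L[ℝ] ℝ) :
          ℝ →L[ℝ] ℝ) := by
      rw [hFd.fderiv]
      ext
      simp
    rw [h1]
    exact ContinuousLinearMap.isInvertible_equiv
  refine ⟨hF.implicitFunction (by norm_num) hinv, hF.contDiffAt_implicitFunction (by norm_num) hinv,
    hF.implicitFunction_apply_self (by norm_num) hinv, ?_, fun u hu => ?_⟩
  · set s := hF.implicitFunction (by norm_num) hinv with hs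
    have hsc : ContinuousAt s y₀ :=
      (hF.contDiffAt_implicitFunction (by norm_num) hinv).continuousAt
    have hs0 : s y₀ = 0 := hF.implicitFunction_apply_self (by norm_num) hinv
    have hF0 : F (y₀, 0) = 0 := by
      simp only [F]; rw [hΨ0]; exact hlL _ hkL
    have hsF : ∀ᶠ y in 𝓝 y₀, l (k (Φ (-s y) y)) = 0 := by
      filter_upwards [hF.eventually_apply_implicitFunction (by norm_num) hinv] with y hy
      rw [hF0] at hy
      exact hy
    have hρ : ContinuousAt (fun y => Φ (-s y) y) y₀ :=
      ContinuousAt.comp (f := fun y => (-s y, y)) (g := fun q : ℝ × E => Φ q.1 q.2)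
        hΦ.continuous.continuousAt (hsc.neg.prodMk continuousAt_id)
    have hρt : Tendsto (fun y => Φ (-s y) y) (𝓝 y₀) (𝓝 y₀) := by
      rw [ContinuousAt, hs0, hΨ0] at hρ; exact hρ
    have hst : Tendsto (fun y => (-s y, y)) (𝓝 y₀) (𝓝 ((0 : ℝ), y₀)) := by
      have := hsc.neg.prodMk continuousAt_id (f := fun y => -s y) (g := fun y : E => y)
      rwa [ContinuousAt, hs0, neg_zero] at this
    have hQj : HasStrictFDerivAt (Q ∘ j) ((fderiv ℝ Q y₀).comp (fderiv ℝ j (k y₀))) (k y₀) := by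
      have h1 : HasStrictFDerivAt Q (fderiv ℝ Q y₀) (j (k y₀)) := by
        rw [hjk0]; exact hQ.hasStrictFDerivAt (by norm_num)
      exact h1.comp (k y₀) (hj.hasStrictFDerivAt (by norm_num))
    -- The single equation l = 0 does not cut out L. Within the level set of Q it does, since ker Q'
    -- is contained in the tangent directions of L plus the flow direction, and l excludes the
    -- latter.
    have hlev := eventually_mem_of_level hQj hkL (by
        filter_upwards [hQL] with z hz hzL
        simp only [Function.comp_apply]
        rw [hz hzL, hjk0]) hlL (fun w hw hlw => by
      obtain ⟨a, ha⟩ := hker _ hw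
      have h1 : fderiv ℝ k y₀ (fderiv ℝ j (k y₀) w) = w := by
        have h2 : HasFDerivAt k (fderiv ℝ k y₀) (j (k y₀)) := by rw [hjk0]; exact hkd
        have h3 := (h2.comp (k y₀) hjd).congr_of_eventuallyEq (f₁ := id)
          (by filter_upwards [hkj] with z hz using hz.symm)
        have h4 := h3.unique (hasFDerivAt_id _)
        exact congrArg (fun A : E →L[ℝ] E => A w) h4
      have h1' : fderiv ℝ k y₀ ((fderiv ℝ j (k y₀)).toLinearMap w) = w := h1
      rw [map_sub, map_smul] at ha
      replace ha : w - a • fderiv ℝ k y₀ X₀ ∈ L := by rw [← h1'] ; exact ha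
      have h5 := hlL _ ha
      rw [map_sub, map_smul, hlw, zero_sub, neg_eq_zero, smul_eq_mul, mul_eq_zero] at h5
      rw [h5.resolve_right hlX, zero_smul, sub_zero] at ha
      exact ha)
    have hkc : Tendsto k (𝓝 y₀) (𝓝 (k y₀)) := hk.continuousAt
    filter_upwards [hsF, hst.eventually hQΦ, (hkc.comp hρt).eventually hlev, hρt.eventually hjk]
      with y h1 h2 h3 h4 h5
    refine h3 h1 ?_
    simp only [Function.comp_apply]
    rw [h4, hjk0]
    exact h2.trans h5
  · rw [(hF.hasStrictFDerivAt_implicitFunction (by norm_num) hinv).hasFDerivAt.fderiv]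
    have h1 : (fderiv ℝ F (y₀, 0) ∘L .inl ℝ E ℝ) u = 0 := by
      rw [hFd.fderiv]
      simpa using hlL _ hu
    exact (congrArg (-(fderiv ℝ F (y₀, 0) ∘L .inr ℝ E ℝ).inverse) h1).trans
      (ContinuousLinearMap.map_zero _)

end FlowSection

/-! ### Functions vanishing on an arc and their uniform cutoffs. -/

section Perturbation

open Filter

variable {E : Type*} [NormedAddCommGroup E] [NormedSpace ℝ E] [FiniteDimensional ℝ E]

/-- A function which measures the time along a short arc. -/
lemma exists_time_function {γ : ℝ → E} (hγ : ContDiff ℝ 2 γ) (h0 : deriv γ 0 ≠ 0) :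
    ∃ θ : E → ℝ, ContDiff ℝ 2 θ ∧ ∃ η > 0, ∀ s : ℝ, |s| < η → θ (γ s) = s := by
  -- A functional not killing the velocity is a local C² parameter on the arc; θ is this functional
  -- followed by the local inverse of l ∘ γ, cut off to be defined everywhere.
  obtain ⟨l, hl⟩ := SeparatingDual.exists_ne_zero (R := ℝ) h0
  have hφ : ContDiff ℝ 2 (l ∘ γ) := l.contDiff.comp hγ
  have hd : HasDerivAt (l ∘ γ) (l (deriv γ 0)) 0 :=
    l.hasFDerivAt.comp_hasDerivAt 0 (hγ.differentiable (by norm_num) 0).hasDerivAt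
  have hd' : HasFDerivAt (l ∘ γ)
      ((ContinuousLinearEquiv.unitsEquivAut ℝ (Units.mk0 _ hl) : ℝ ≃L[ℝ] ℝ) : ℝ →L[ℝ] ℝ) 0 := by
    have heq : ((ContinuousLinearEquiv.unitsEquivAut ℝ (Units.mk0 _ hl) : ℝ ≃L[ℝ] ℝ) : ℝ →L[ℝ] ℝ) =
        ContinuousLinearMap.toSpanSingleton ℝ (l (deriv γ 0)) := by ext; simp
    rw [heq]
    exact hd.hasFDerivAt
  have hg := hφ.contDiffAt.to_localInverse hd' (by norm_num)
  set g := hφ.contDiffAt.localInverse hd' (by norm_num) with hgdef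
  have hinv : ∀ᶠ s in 𝓝 (0 : ℝ), g ((l ∘ γ) s) = s :=
    (hφ.contDiffAt.hasStrictFDerivAt' hd' (by norm_num)).eventually_left_inverse
  obtain ⟨U, hU, hgU⟩ := hg.contDiffOn (m := 2) le_rfl (by simp)
  obtain ⟨u, hu, huo, hmu⟩ := mem_nhds_iff.1 hU
  obtain ⟨w, hw, -, -, V, hV, hmV, -, hwV⟩ := exists_cutoff (n := 2) huo hmu (hgU.mono hu)
  refine ⟨w ∘ l, hw.comp l.contDiff, ?_⟩
  have hev : ∀ᶠ s in 𝓝 (0 : ℝ), (w ∘ l) (γ s) = s := by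
    filter_upwards [hinv, hφ.continuous.continuousAt.eventually (hV.mem_nhds hmV)] with s h1 h2
    exact (hwV h2).trans h1
  obtain ⟨η, hη, hball⟩ := Metric.eventually_nhds_iff_ball.1 hev
  exact ⟨η, hη, fun s hs => hball s (by simpa [Real.dist_eq] using hs)⟩

lemma exists_primitive {u : ℝ → ℝ} (hu : ContDiff ℝ 1 u) :
    ∃ v : ℝ → ℝ, ContDiff ℝ 2 v ∧ ∀ t, HasDerivAt v (u t) t := by
  have hd : ∀ t, HasDerivAt (fun t => ∫ s in (0 : ℝ)..t, u s) (u t) t := fun t =>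
    hu.continuous.integral_hasStrictDerivAt 0 t |>.hasDerivAt
  refine ⟨_, ?_, hd⟩
  rw [show (2 : ℕ∞ω) = 1 + 1 by norm_num, contDiff_succ_iff_deriv]
  refine ⟨fun t => (hd t).differentiableAt, by simp, ?_⟩
  have : deriv (fun t => ∫ s in (0 : ℝ)..t, u s) = u := funext fun t => (hd t).deriv
  rwa [this]

/-- A `C²` function with prescribed value zero and prescribed `C¹` differential along a curve. -/
lemma exists_function_of_differential {γ : ℝ → E} (hγ : ContDiff ℝ 2 γ) {θ : E → ℝ}
    (hθ : ContDiff ℝ 2 θ) {ξ : ℝ → E →L[ℝ] ℝ} (hξ : ContDiff ℝ 1 ξ)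
    (hξγ : ∀ s, ξ s (deriv γ s) = 0) :
    ∃ f : E → ℝ, ContDiff ℝ 2 f ∧ ∀ s, θ (γ s) = s → f (γ s) = 0 ∧
      HasFDerivAt f (ξ s) (γ s) := by
  let b := Module.finBasis ℝ E
  let c : Fin (Module.finrank ℝ E) → E →L[ℝ] ℝ := fun i => LinearMap.toContinuousLinearMap (b.coord i)
  have hc : ∀ u, ∑ i, c i u • b i = u := fun u => b.sum_repr u
  have hex : ∀ i, ∃ v : ℝ → ℝ, ContDiff ℝ 2 v ∧ ∀ t, HasDerivAt v (ξ t (b i)) t := fun i =>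
    exists_primitive (hξ.clm_apply contDiff_const)
  choose v hv hvd using hex
  -- The obvious candidate ξ_θ (x - γ (θ x)) is only C¹, as ξ is. With v i a primitive of t ↦ ξ t (b
  -- i), the difference quotient hidden in this formula has the same differential on the arc and is
  -- C². The term along the velocity disappears because ξ s annihilates it.
  refine ⟨fun x => ∑ i, (v i (θ x + c i (x - γ (θ x))) - v i (θ x)), ?_, fun s hs => ⟨?_, ?_⟩⟩
  · refine ContDiff.sum fun i _ => ContDiff.sub ((hv i).comp ?_) ((hv i).comp hθ)
    exact hθ.add ((c i).contDiff.comp (contDiff_id.sub (hγ.comp hθ)))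
  · simp [hs]
  · have hθd := (hθ.differentiable (by norm_num) (γ s)).hasFDerivAt
    set Dθ := fderiv ℝ θ (γ s)
    have hγd : HasDerivAt γ (deriv γ s) (θ (γ s)) := by
      rw [hs]; exact (hγ.differentiable (by norm_num) s).hasDerivAt
    have hw : HasFDerivAt (fun x => x - γ (θ x))
        (ContinuousLinearMap.id ℝ E - Dθ.smulRight (deriv γ s)) (γ s) := by
      have h1 := (hasFDerivAt_id (𝕜 := ℝ) (γ s)).sub (hγd.hasFDerivAt.comp (γ s) hθd)
      have h2 : (ContinuousLinearMap.toSpanSingleton ℝ (deriv γ s)).comp Dθ =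
        Dθ.smulRight (deriv γ s) := by ext; simp
      rw [h2] at h1
      exact h1
    have hi : ∀ i, HasFDerivAt (fun x => v i (θ x + c i (x - γ (θ x))) - v i (θ x))
        (ξ s (b i) • (c i).comp (ContinuousLinearMap.id ℝ E - Dθ.smulRight (deriv γ s)))
        (γ s) := by
      intro i
      have h1 : HasFDerivAt (fun x => θ x + c i (x - γ (θ x)))
          (Dθ + (c i).comp (ContinuousLinearMap.id ℝ E - Dθ.smulRight (deriv γ s))) (γ s) :=
        hθd.add ((c i).hasFDerivAt.comp (γ s) hw)
      have h2 : HasDerivAt (v i) (ξ s (b i)) (θ (γ s) + c i (γ s - γ (θ (γ s)))) := by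
        simpa [hs] using hvd i s
      have h3 : HasDerivAt (v i) (ξ s (b i)) (θ (γ s)) := by
        simpa [hs] using hvd i s
      have h4 := (h2.comp_hasFDerivAt (γ s) h1).sub (h3.comp_hasFDerivAt (γ s) hθd)
      have h5 : ξ s (b i) • (Dθ + (c i).comp
          (ContinuousLinearMap.id ℝ E - Dθ.smulRight (deriv γ s))) - ξ s (b i) • Dθ =
          ξ s (b i) • (c i).comp (ContinuousLinearMap.id ℝ E - Dθ.smulRight (deriv γ s)) := by
        rw [smul_add, add_sub_cancel_left]
      rw [← h5]
      exact h4
    have h5 := HasFDerivAt.fun_sum (u := Finset.univ) fun i _ => hi i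
    refine h5.congr_fderiv (ContinuousLinearMap.ext fun u => Eq.symm ?_)
    have h6 : ξ s u = ξ s (u - Dθ u • deriv γ s) := by
      rw [map_sub, map_smul, hξγ, smul_zero, sub_zero]
    rw [h6]
    conv_lhs => rw [← hc (u - Dθ u • deriv γ s)]
    rw [map_sum, sum_apply]
    refine Finset.sum_congr rfl fun i _ => ?_
    rw [map_smul, smul_eq_mul, mul_comm]
    rfl

/-- The second derivative of `σ p q` at a common zero of `p` and `q`. -/
lemma fderiv_mul_mul {σ p q : E → ℝ} (hσ : ContDiff ℝ 2 σ) (hp : ContDiff ℝ 2 p)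
    (hq : ContDiff ℝ 2 q) {y : E} (hpy : p y = 0) (hqy : q y = 0) :
    fderiv ℝ (fun x => σ x * (p x * q x)) y = 0 ∧
      ∀ u v, fderiv ℝ (fderiv ℝ (fun x => σ x * (p x * q x))) y u v =
        σ y * (fderiv ℝ p y u * fderiv ℝ q y v + fderiv ℝ q y u * fderiv ℝ p y v) := by
  have d : ∀ {f : E → ℝ}, ContDiff ℝ 2 f → ∀ x, HasFDerivAt f (fderiv ℝ f x) x := fun hf x =>
    (hf.differentiable (by norm_num) x).hasFDerivAt
  have d2 : ∀ {f : E → ℝ}, ContDiff ℝ 2 f → ∀ x,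
      HasFDerivAt (fderiv ℝ f) (fderiv ℝ (fderiv ℝ f) x) x := fun hf x =>
    ((hf.fderiv_right (m := 1) (by norm_num)).differentiable (by norm_num) x).hasFDerivAt
  have hpq : ∀ x, HasFDerivAt (fun x => p x * q x) (p x • fderiv ℝ q x + q x • fderiv ℝ p x) x :=
    fun x => (d hp x).mul (d hq x)
  have h1 : fderiv ℝ (fun x => σ x * (p x * q x)) = fun x =>
      σ x • (p x • fderiv ℝ q x + q x • fderiv ℝ p x) + (p x * q x) • fderiv ℝ σ x :=
    funext fun x => ((d hσ x).mul (hpq x)).fderiv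
  rw [h1]
  refine ⟨by simp [hpy, hqy], fun u v => ?_⟩
  have h2 := ((d hσ y).smul (((d hp y).smul (d2 hq y)).add ((d hq y).smul (d2 hp y)))).add
    ((hpq y).smul (d2 hσ y))
  rw [show fderiv ℝ (fun x => σ x • (p x • fderiv ℝ q x + q x • fderiv ℝ p x) +
    (p x * q x) • fderiv ℝ σ x) y = _ from h2.fderiv]
  simp [hpy, hqy]
  ring

/-- Weighted bounds for the derivatives of order at most two at a point. -/
def HasWeight (r : ℝ) (k : ℕ) (K : ℝ) (u : E → ℝ) (x : E) : Prop :=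
  ∀ m ≤ 2, ‖iteratedFDeriv ℝ m u x‖ * r ^ m ≤ K * r ^ k

/-- Weights add by the Leibniz rule; the factor 4 bounds the sum 2ᵐ of the binomial coefficients for
m ≤ 2. -/
lemma HasWeight.mul {r : ℝ} (hr : 0 ≤ r) {k l : ℕ} {K K' : ℝ} {u v : E → ℝ} {x : E}
    (hu : ContDiff ℝ 2 u) (hv : ContDiff ℝ 2 v) (h : HasWeight r k K u x)
    (h' : HasWeight r l K' v x) : HasWeight r (k + l) (4 * (K * K')) (fun x => u x * v x) x := by
  intro m hm
  have hpos : 0 ≤ (K * r ^ k) * (K' * r ^ l) :=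
    mul_nonneg ((by positivity : (0 : ℝ) ≤ _).trans (h 0 (by norm_num)))
      ((by positivity : (0 : ℝ) ≤ _).trans (h' 0 (by norm_num)))
  have h1 := norm_iteratedFDeriv_mul_le (N := 2) hu hv x (n := m) (by exact_mod_cast hm)
  calc _ ≤ (∑ i ∈ Finset.range (m + 1), (m.choose i : ℝ) * ‖iteratedFDeriv ℝ i u x‖ *
        ‖iteratedFDeriv ℝ (m - i) v x‖) * r ^ m := by gcongr
    _ = ∑ i ∈ Finset.range (m + 1), (m.choose i : ℝ) * ((‖iteratedFDeriv ℝ i u x‖ * r ^ i) *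
        (‖iteratedFDeriv ℝ (m - i) v x‖ * r ^ (m - i))) := by
      rw [Finset.sum_mul]
      refine Finset.sum_congr rfl fun i hi => ?_
      have : r ^ m = r ^ i * r ^ (m - i) := by
        rw [← pow_add, Nat.add_sub_cancel' (Nat.lt_succ_iff.1 (Finset.mem_range.1 hi))]
      rw [this]; ring
    _ ≤ ∑ i ∈ Finset.range (m + 1), (m.choose i : ℝ) * ((K * r ^ k) * (K' * r ^ l)) := by
      refine Finset.sum_le_sum fun i hi => ?_
      have hi' := Nat.lt_succ_iff.1 (Finset.mem_range.1 hi)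
      refine mul_le_mul_of_nonneg_left ?_ (Nat.cast_nonneg _)
      exact mul_le_mul (h i (hi'.trans hm)) (h' (m - i) ((Nat.sub_le _ _).trans hm))
        (by positivity) ((by positivity : (0 : ℝ) ≤ _).trans (h 0 (by norm_num)))
    _ = 2 ^ m * ((K * r ^ k) * (K' * r ^ l)) := by
      rw [← Finset.sum_mul]
      congr 1
      exact_mod_cast Nat.sum_range_choose m
    _ ≤ 4 * ((K * r ^ k) * (K' * r ^ l)) := by
      refine mul_le_mul_of_nonneg_right ?_ hpos
      interval_cases m <;> norm_num
    _ = _ := by ring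

lemma exists_bound_iteratedFDeriv {G : Type*} [NormedAddCommGroup G] [NormedSpace ℝ G] {u : E → G}
    (hu : ContDiff ℝ 2 u) (R : ℝ) : ∃ C : ℝ, ∀ m ≤ 2, ∀ x ∈ Metric.closedBall (0 : E) R,
      ‖iteratedFDeriv ℝ m u x‖ ≤ C := by
  have h1 : ∀ m ≤ 2, ∃ C : ℝ, ∀ x ∈ Metric.closedBall (0 : E) R,
      ‖iteratedFDeriv ℝ m u x‖ ≤ C := fun m hm =>
    (isCompact_closedBall 0 R).exists_bound_of_continuousOn
      (hu.continuous_iteratedFDeriv (m := m) (by exact_mod_cast hm)).continuousOn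
  choose! C hC using h1
  refine ⟨max (C 0) (max (C 1) (C 2)), fun m hm x hx => (hC m hm x hx).trans ?_⟩
  interval_cases m <;> simp

/-- Functions supported near an arc which vanish to second order along the arc can be cut off
to small neighbourhoods of the arc with uniform `C²` bounds. -/
theorem exists_uniform_cutoff {γ : ℝ → E} (hγ : ContDiff ℝ 2 γ) {θ : E → ℝ}
    (hθ : ContDiff ℝ 2 θ) {η : ℝ} (hθγ : ∀ s : ℝ, |s| < η → θ (γ s) = s) {ι : Type*} [Fintype ι]
    {f : ι → E → ℝ} (hf : ∀ i, ContDiff ℝ 2 (f i))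
    (hfγ : ∀ i (s : ℝ), |s| < η → f i (γ s) = 0) {ψ : ℝ → ℝ} (hψ : ContDiff ℝ 2 ψ) {a b : ℝ}
    (hab : Icc a b ⊆ Metric.ball 0 η) (hψs : ∀ t, t ∉ Icc a b → ψ t = 0)
    {Ω : Set E} (hΩ : IsOpen Ω) (hγΩ : γ '' Icc a b ⊆ Ω) :
    ∃ (Z : Set E) (K : ℝ), IsCompact Z ∧ Z ⊆ Ω ∧ ∀ G, IsOpen G → γ '' Icc a b ⊆ G →
      ∃ χ : E → ℝ, ContDiff ℝ 2 χ ∧ (∀ s : ℝ, |s| < η → χ (γ s) = ψ s) ∧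
        tsupport χ ⊆ G ∩ Z ∧
        ∀ i j, ∀ m ≤ 2, ∀ x, ‖iteratedFDeriv ℝ m (fun x => χ x * (f i x * f j x)) x‖ ≤ K := by
  set A := γ '' Icc a b with hA
  have hAc : IsCompact A := isCompact_Icc.image hγ.continuous
  obtain ⟨r₁, hr₁, hr₁Ω⟩ := hAc.exists_cthickening_subset_open hΩ hγΩ
  set Z := Metric.cthickening r₁ A with hZ
  have hZc : IsCompact Z := hAc.cthickening
  obtain ⟨R, hR⟩ := hZc.isBounded.subset_closedBall 0
  set w : E → E := fun x => x - γ (θ x) with hw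
  have hwc : ContDiff ℝ 2 w := contDiff_id.sub (hγ.comp hθ)
  let β : ContDiffBump (0 : E) := ⟨1, 2, by norm_num, by norm_num⟩
  have hβ : ContDiff ℝ 2 β := β.contDiff
  have hψθ : ContDiff ℝ 2 (ψ ∘ θ) := hψ.comp hθ
  obtain ⟨Cw, hCw⟩ := exists_bound_iteratedFDeriv hwc R
  obtain ⟨Cψ, hCψ⟩ := exists_bound_iteratedFDeriv hψθ R
  obtain ⟨Cβ, hCβ⟩ := exists_bound_iteratedFDeriv hβ 2
  choose Cf hCf using fun i => exists_bound_iteratedFDeriv (hf i) R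
  set C : ℝ := 1 + |Cw| + |Cψ| + |Cβ| + ∑ i, |Cf i| with hC
  have hs0 : 0 ≤ ∑ i, |Cf i| := Finset.sum_nonneg fun i _ => abs_nonneg _
  have hC1 : 1 ≤ C := by
    have := abs_nonneg Cw; have := abs_nonneg Cψ; have := abs_nonneg Cβ; linarith
  have hCCw : Cw ≤ C := by
    have := le_abs_self Cw; have := abs_nonneg Cψ; have := abs_nonneg Cβ; linarith
  have hCCψ : Cψ ≤ C := by
    have := le_abs_self Cψ; have := abs_nonneg Cw; have := abs_nonneg Cβ; linarith
  have hCCβ : Cβ ≤ C := by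
    have := le_abs_self Cβ; have := abs_nonneg Cw; have := abs_nonneg Cψ; linarith
  have hCCf : ∀ i, Cf i ≤ C := fun i => by
    have h1 : |Cf i| ≤ ∑ i, |Cf i| :=
      Finset.single_le_sum (f := fun i => |Cf i|) (fun i _ => abs_nonneg _) (Finset.mem_univ i)
    have := le_abs_self (Cf i); have := abs_nonneg Cw; have := abs_nonneg Cψ
    have := abs_nonneg Cβ; linarith
  have hC0 : 0 ≤ C := zero_le_one.trans hC1
  -- `Kχ` is the chain rule bound m! C (C / r)ᵐ for the bump at scale r, multiplied by rᵐ with m ≤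
  -- 2. In K, each 4 comes from one product and each 2 C from a factor f i of weight one. Neither
  -- depends on r, hence not on the neighbourhood G chosen later.
  set Kχ : ℝ := 2 * C * C ^ 2 with hKχ
  set K : ℝ := 4 * ((4 * (Kχ * C)) * (4 * ((2 * C) * (2 * C)))) with hK
  refine ⟨Z, K, hZc, hr₁Ω, fun G hG hAG => ?_⟩
  obtain ⟨r₂, hr₂, hr₂G⟩ := hAc.exists_cthickening_subset_open hG hAG
  -- The bump has outer radius 2, so the cutoff lives where the displacement from the arc is at most
  -- 2 r; halving r₁ and r₂ keeps this inside Z and G. The bound r ≤ 1 allows powers of r to be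
  -- compared.
  set r := min 1 (min (r₁ / 2) (r₂ / 2)) with hr
  have hr0 : 0 < r := lt_min one_pos (lt_min (by linarith) (by linarith))
  have hr1 : r ≤ 1 := min_le_left _ _
  have hrr₁ : 2 * r ≤ r₁ := by
    have : r ≤ r₁ / 2 := (min_le_right _ _).trans (min_le_left _ _)
    linarith
  have hrr₂ : 2 * r ≤ r₂ := by
    have : r ≤ r₂ / 2 := (min_le_right _ _).trans (min_le_right _ _)
    linarith
  set S : Set E := {x | θ x ∈ Icc a b ∧ ‖w x‖ ≤ 2 * r} with hS
  have hScl : IsClosed S := (isClosed_Icc.preimage hθ.continuous).inter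
    (isClosed_le hwc.continuous.norm continuous_const)
  have hSthick : ∀ ρ, 2 * r ≤ ρ → S ⊆ Metric.cthickening ρ A := fun ρ hρ x hx => by
    refine Metric.mem_cthickening_of_dist_le x (γ (θ x)) ρ A ⟨_, hx.1, rfl⟩ ?_
    rw [dist_eq_norm]
    exact hx.2.trans hρ
  have hSZ : S ⊆ Z := hSthick r₁ hrr₁
  have hSG : S ⊆ G := (hSthick r₂ hrr₂).trans hr₂G
  let χ₁ : E → ℝ := β ∘ fun x => r⁻¹ • w x
  have hrw : ContDiff ℝ 2 fun x => r⁻¹ • w x := contDiff_const.smul hwc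
  have hχ₁ : ContDiff ℝ 2 χ₁ := hβ.comp hrw
  let χ : E → ℝ := fun x => χ₁ x * (ψ ∘ θ) x
  have hχ : ContDiff ℝ 2 χ := hχ₁.mul hψθ
  have hχS : tsupport χ ⊆ S := by
    refine closure_minimal (fun x hx => ?_) hScl
    have h1 : χ₁ x ≠ 0 := left_ne_zero_of_mul hx
    have h2 : ψ (θ x) ≠ 0 := right_ne_zero_of_mul hx
    refine ⟨by by_contra h; exact h2 (hψs _ h), ?_⟩
    have h3 : r⁻¹ • w x ∈ Function.support β := h1
    rw [β.support_eq, mem_ball_zero_iff, norm_smul, norm_inv, Real.norm_of_nonneg hr0.le,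
      inv_mul_lt_iff₀ hr0] at h3
    linarith [h3, show β.rOut = 2 from rfl, show r * β.rOut = r * 2 from rfl]
  refine ⟨χ, hχ, fun s hs => ?_, hχS.trans (subset_inter hSG hSZ), fun i j m hm x => ?_⟩
  · have h1 : w (γ s) = 0 := by simp [hw, hθγ s hs]
    have h2 : χ₁ (γ s) = 1 := by
      simp only [χ₁, Function.comp_apply, h1, smul_zero]
      exact β.one_of_mem_closedBall (by simp [β.rIn_pos.le])
    simp only [χ, h2, one_mul, Function.comp_apply, hθγ s hs]
  · by_cases hx : x ∈ S
    · have hxR : x ∈ Metric.closedBall (0 : E) R := hR (hSZ hx)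
      have w1 : HasWeight r 0 Kχ χ₁ x := by
        intro m hm
        have h1 := norm_iteratedFDeriv_comp_le (N := 2) hβ hrw (n := m) (by exact_mod_cast hm) x
          (C := C) (D := C * r⁻¹) (fun i hi => (hCβ i (hi.trans hm) _ (by
            rw [mem_closedBall_zero_iff, norm_smul, norm_inv, Real.norm_of_nonneg hr0.le,
              inv_mul_le_iff₀ hr0, mul_comm r 2]
            exact hx.2)).trans hCCβ) (fun i hi1 hi => by
            have h2 : iteratedFDeriv ℝ i (fun x => r⁻¹ • w x) x = r⁻¹ • iteratedFDeriv ℝ i w x :=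
              iteratedFDeriv_const_smul_apply (hwc.contDiffAt.of_le (by
                exact_mod_cast hi.trans hm))
            rw [h2, norm_smul, norm_inv, Real.norm_of_nonneg hr0.le]
            have h3 := (hCw i (hi.trans hm) x hxR).trans hCCw
            have hri : 1 ≤ r⁻¹ := (one_le_inv₀ hr0).2 hr1
            calc r⁻¹ * ‖iteratedFDeriv ℝ i w x‖ ≤ r⁻¹ * C := by gcongr
              _ = C * r⁻¹ := mul_comm _ _
              _ ≤ (C * r⁻¹) ^ i := le_self_pow₀ (one_le_mul_of_one_le_of_one_le hC1 hri)
                (by omega))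
        calc ‖iteratedFDeriv ℝ m χ₁ x‖ * r ^ m
            ≤ (m.factorial * C * (C * r⁻¹) ^ m) * r ^ m := by gcongr
          _ = m.factorial * C * C ^ m := by
            rw [mul_assoc _ _ (r ^ m), ← mul_pow, inv_mul_cancel_right₀ hr0.ne']
          _ ≤ 2 * C * C ^ 2 := by
            have h4 : (m.factorial : ℝ) ≤ 2 := by
              interval_cases m <;> norm_num [Nat.factorial]
            have h5 : C ^ m ≤ C ^ 2 := pow_le_pow_right₀ hC1 hm
            gcongr
          _ = Kχ * r ^ 0 := by rw [hKχ, pow_zero, mul_one]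
      have w2 : HasWeight r 0 C (ψ ∘ θ) x := by
        intro m hm
        have h1 := (hCψ m hm x hxR).trans hCCψ
        have h2 : r ^ m ≤ 1 := pow_le_one₀ hr0.le hr1
        calc _ ≤ C * 1 := mul_le_mul h1 h2 (by positivity) hC0
          _ = _ := by simp
      -- f i vanishes on the arc, which is within 2 r of x, so the mean value inequality makes its
      -- value of order r.
      have w3 : ∀ i, HasWeight r 1 (2 * C) (f i) x := by
        intro i m hm
        have h1 := (hCf i m hm x hxR).trans (hCCf i)
        rw [pow_one]
        rcases Nat.eq_zero_or_pos m with rfl | hm0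
        · have hγx : γ (θ x) ∈ Metric.closedBall (0 : E) R :=
            hR (Metric.self_subset_cthickening A ⟨_, hx.1, rfl⟩)
          have h2 := Convex.norm_image_sub_le_of_norm_fderiv_le (𝕜 := ℝ) (f := f i) (C := C)
            (fun y _ => (hf i).differentiable (by norm_num) y) (fun y hy => by
              have h3 := (hCf i 1 (by norm_num) y hy).trans (hCCf i)
              rwa [norm_iteratedFDeriv_one] at h3) (convex_closedBall 0 R) hγx hxR
          rw [hfγ i _ (by simpa [Real.dist_eq] using hab hx.1), sub_zero] at h2
          rw [norm_iteratedFDeriv_zero, pow_zero, mul_one]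
          calc _ ≤ C * ‖x - γ (θ x)‖ := h2
            _ ≤ C * (2 * r) := by gcongr; exact hx.2
            _ = _ := by ring
        · have h2 : r ^ m ≤ r := pow_le_of_le_one hr0.le hr1 (by omega)
          calc _ ≤ C * r := mul_le_mul h1 h2 (by positivity) hC0
            _ ≤ 2 * C * r := by nlinarith
      have w4 := HasWeight.mul hr0.le hχ (((hf i)).mul (hf j)) (HasWeight.mul hr0.le hχ₁ hψθ w1 w2)
        (HasWeight.mul hr0.le (hf i) (hf j) (w3 i) (w3 j))
      have h5 := w4 m hm
      have hr2 : (0 : ℝ) < r ^ 2 := by positivity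
      -- The total weight 2 of the product compensates the loss of at most two powers of r by
      -- differentiation.
      have h6 : r ^ (0 + 0 + (1 + 1)) ≤ r ^ m := pow_le_pow_of_le_one hr0.le hr1 hm
      have hK0 : 0 ≤ K := by positivity
      have h7 : ‖iteratedFDeriv ℝ m (fun x => χ x * (f i x * f j x)) x‖ * r ^ m ≤ K * r ^ m :=
        h5.trans (mul_le_mul_of_nonneg_left h6 hK0)
      exact le_of_mul_le_mul_right h7 (by positivity)
    · have h1 : x ∉ tsupport (fun x => χ x * (f i x * f j x)) := fun h =>
        hx (hχS (tsupport_mul_subset_left h))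
      have h2 : iteratedFDeriv ℝ m (fun x => χ x * (f i x * f j x)) x = 0 :=
        image_eq_zero_of_notMem_tsupport fun h => h1 (tsupport_iteratedFDeriv_subset m h)
      rw [h2, norm_zero]
      positivity

end Perturbation

/-! ### Small logarithms of symplectic matrices. -/

section SymplecticLog

open Filter Matrix NormedSpace
open scoped Matrix.Norms.Operator

variable {ι : Type*} [Fintype ι] [DecidableEq ι]

lemma hasDerivAt_exp_apply {a : ℝ → ℝ} {a' t : ℝ} (ha : HasDerivAt a a' t) (Z : Matrix ι ι ℝ)
    (i k : ι) : HasDerivAt (fun t => exp (a t • Z) i k) (a' * (Z * exp (a t • Z)) i k) t := by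
  have h1 := (hasDerivAt_exp_smul_const' (𝕂 := ℝ) Z (a t)).scomp t ha
  let p : Matrix ι ι ℝ →L[ℝ] ℝ := LinearMap.toContinuousLinearMap
    { toFun := fun A => A i k, map_add' := fun _ _ => rfl, map_smul' := fun _ _ => rfl }
  have h2 := p.hasFDerivAt.comp_hasDerivAt t h1
  exact h2

/-- The hypothesis on A is about column sums, whereas the operator norm used here is the largest row
sum; the sum of all entries dominates both. -/
lemma norm_le_sum_sum (A : Matrix ι ι ℝ) : ‖A‖ ≤ ∑ j, ∑ i, |A i j| := by
  rw [Matrix.linfty_opNorm_def, Finset.sum_comm]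
  have h : (Finset.univ.sup fun i => ∑ j, ‖A i j‖₊) ≤ ∑ i, ∑ j, ‖A i j‖₊ :=
    Finset.sup_le fun i _ => Finset.single_le_sum (f := fun i => ∑ j, ‖A i j‖₊)
      (fun _ _ => zero_le) (Finset.mem_univ i)
  have h2 := NNReal.coe_le_coe.2 h
  push_cast at h2
  exact h2

/-- Square matrices of size `2 d`. -/
abbrev SqMatrix (d : ℕ) := Matrix (Fin d ⊕ Fin d) (Fin d ⊕ Fin d) ℝ

variable {d : ℕ}

/-- Symplectic matrices near `1` have a small logarithm in the symplectic Lie algebra. -/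
lemma eventually_exists_log (κ : ℝ) (hκ : 0 < κ) :
    ∀ᶠ V in 𝓝 (1 : SqMatrix d),
      V ∈ symplecticGroup (Fin d) ℝ → ∃ Z, exp Z = V ∧ (Z * J (Fin d) ℝ)ᵀ = Z * J (Fin d) ℝ ∧
        ∀ i j, |(Z * J (Fin d) ℝ) i j| < κ := by
  set Jm := J (Fin d) ℝ
  have hexp : HasStrictFDerivAt (exp : SqMatrix d → SqMatrix d)
      ((ContinuousLinearEquiv.refl ℝ (SqMatrix d) : SqMatrix d ≃L[ℝ] SqMatrix d) : SqMatrix d →L[ℝ] SqMatrix d) 0 :=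
    hasStrictFDerivAt_exp_zero (𝕂 := ℝ)
  let lg : SqMatrix d → SqMatrix d := hexp.localInverse exp _ 0
  have h0 : lg 1 = 0 := by
    have := hexp.localInverse_apply_image
    rwa [exp_zero] at this
  have hr : ∀ᶠ V in 𝓝 (1 : SqMatrix d), exp (lg V) = V := by
    have := hexp.eventually_right_inverse
    rwa [exp_zero] at this
  have hl : ∀ᶠ X in 𝓝 (0 : SqMatrix d), lg (exp X) = X := hexp.eventually_left_inverse
  have hc : Tendsto lg (𝓝 1) (𝓝 0) := by
    have := hexp.localInverse_tendsto
    rwa [exp_zero] at this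
  have hneg : Tendsto (fun V => -lg V) (𝓝 1) (𝓝 0) := by simpa using hc.neg
  have hconj : Tendsto (fun V => Jm * (lg V)ᵀ * Jm⁻¹) (𝓝 1) (𝓝 0) := by
    have h1 : Continuous fun Z : SqMatrix d => Jm * Zᵀ * Jm⁻¹ := by fun_prop
    have h2 := (h1.tendsto 0).comp hc
    simpa [Function.comp_def] using h2
  have hsmall : ∀ᶠ V in 𝓝 (1 : SqMatrix d), ∀ i j, |(lg V * Jm) i j| < κ := by
    rw [eventually_all]; intro i
    rw [eventually_all]; intro j
    have h1 : Continuous fun Z : SqMatrix d => |(Z * Jm) i j| := by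
      have : Continuous fun Z : SqMatrix d => Z * Jm := by fun_prop
      exact (this.matrix_elem i j).abs
    have h2 := (h1.tendsto 0).comp hc
    have h3 : |((0 : SqMatrix d) * Jm) i j| < κ := by simpa using hκ
    exact h2.eventually (Iio_mem_nhds h3)
  filter_upwards [hr, hneg.eventually hl, hconj.eventually hl, hsmall] with V h1 h2 h3 h4 hV
  have hVu : IsUnit V.det := SymplecticGroup.symplectic_det hV
  have hJu : IsUnit Jm := (Matrix.isUnit_iff_isUnit_det _).2 (isUnit_det_J (Fin d) ℝ)
  have hJJ : Jm * Jm⁻¹ = 1 := Matrix.mul_nonsing_inv _ (isUnit_det_J (Fin d) ℝ)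
  have hJJ' : Jm⁻¹ * Jm = 1 := Matrix.nonsing_inv_mul _ (isUnit_det_J (Fin d) ℝ)
  have e1 : exp (-lg V) = V⁻¹ := by rw [Matrix.exp_neg, h1]
  -- For symplectic V both -log V and J (log V)ᵀ J⁻¹ exponentiate to V⁻¹. They are near 0, where exp
  -- is injective, so they agree, which says that (log V) J is symmetric.
  have e2 : exp (Jm * (lg V)ᵀ * Jm⁻¹) = V⁻¹ := by
    rw [Matrix.exp_conj _ _ hJu, Matrix.exp_transpose, h1]
    symm
    refine Matrix.inv_eq_right_inv ?_
    have h5 := SymplecticGroup.mem_iff.1 hV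
    rw [← mul_assoc, ← mul_assoc, h5, hJJ]
  have h5 : Jm * (lg V)ᵀ * Jm⁻¹ = -lg V := by rw [← h3, e2, ← e1, h2]
  refine ⟨lg V, h1, ?_, h4⟩
  have h6 : Jm * (lg V)ᵀ = -lg V * Jm := by
    rw [← h5, mul_assoc _ _ Jm, hJJ', mul_one]
  rw [Matrix.transpose_mul, J_transpose, neg_mul, h6, neg_mul, neg_neg]

/-- If `A` is a symplectic matrix near `1` then `A L = L exp Z` with a small element `Z` of the
symplectic Lie algebra. -/
theorem exists_small_log {L : SqMatrix d}
    (hL : L ∈ symplecticGroup (Fin d) ℝ) {κ : ℝ} (hκ : 0 < κ) :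
    ∃ δ > 0, ∀ A ∈ symplecticGroup (Fin d) ℝ, (∀ j, ∑ i, |(A - 1) i j| < δ) →
      ∃ Z, L * exp Z = A * L ∧ (Z * J (Fin d) ℝ)ᵀ = Z * J (Fin d) ℝ ∧
        ∀ i j, |(Z * J (Fin d) ℝ) i j| < κ := by
  have hLu : IsUnit L.det := SymplecticGroup.symplectic_det hL
  have hc : Continuous fun A : SqMatrix d => L⁻¹ * A * L := by fun_prop
  have h1 : Tendsto (fun A : SqMatrix d => L⁻¹ * A * L) (𝓝 1) (𝓝 1) := by
    have := hc.tendsto 1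
    simpa [Matrix.nonsing_inv_mul _ hLu] using this
  obtain ⟨ρ, hρ, hball⟩ := Metric.eventually_nhds_iff_ball.1
    (h1.eventually (eventually_exists_log κ hκ))
  -- There are 2 d columns, each with sum below δ, so all entries sum to less than ρ; the + 1 avoids
  -- division by zero when d = 0.
  refine ⟨ρ / (Fintype.card (Fin d ⊕ Fin d) + 1), by positivity, fun A hA hAδ => ?_⟩
  have hmem : A ∈ Metric.ball (1 : SqMatrix d) ρ := by
    rw [mem_ball_iff_norm]
    refine (norm_le_sum_sum (A - 1)).trans_lt ?_
    refine (Finset.sum_le_sum fun j _ => (hAδ j).le).trans_lt ?_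
    rw [Finset.sum_const, Finset.card_univ, nsmul_eq_mul, ← mul_div_assoc, div_lt_iff₀ (by positivity)]
    nlinarith
  have hmemS : L⁻¹ * A * L ∈ symplecticGroup (Fin d) ℝ := by
    have h2 : L⁻¹ = ((⟨L, hL⟩ : symplecticGroup (Fin d) ℝ)⁻¹ : symplecticGroup (Fin d) ℝ) :=
      (SymplecticGroup.coe_inv' ⟨L, hL⟩).symm
    rw [h2]
    exact mul_mem (mul_mem (Subtype.prop _) hA) hL
  obtain ⟨Z, hZ, hsymm, hsmall⟩ := hball A hmem hmemS
  refine ⟨Z, ?_, hsymm, hsmall⟩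
  rw [hZ, ← mul_assoc, ← mul_assoc, Matrix.mul_nonsing_inv _ hLu, one_mul]

end SymplecticLog

/-! ### Effect of a second order perturbation on the derivative of the flow. -/

section PerturbedFlow

open Filter Matrix NormedSpace

variable {F : Type*} [NormedAddCommGroup F] [NormedSpace ℝ F] [FiniteDimensional ℝ F]
  {Ω : Set F} {B : F → (F →L[ℝ] ℝ) →L[ℝ] F} {f f' h : F → ℝ} {Φ Φ' : ℝ → F → F} {d : ℕ}

/-- The flow preserves both f and B. Consequently covectors that annihilate X_f at the start
annihilate the velocity of the orbit after transport. -/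
lemma IsLocalPoisson.fderiv_flow_hamField (hB : IsLocalPoisson Ω B) (hf : ContDiff ℝ 2 f)
    (hfc : HasCompactSupport f) (hfΩ : tsupport f ⊆ Ω) (hΦ : IsFlow (hamField B f) Φ) {y : F}
    (hy : y ∈ Ω) (t : ℝ) : fderiv ℝ (Φ t) y (hamField B f y) = hamField B f (Φ t y) := by
  have h4 : f ∘ Φ t = f := funext fun z => hB.apply_flow hf hfΩ hΦ z t
  have hd : DifferentiableAt ℝ (Φ t) y :=
    (hΦ.contDiff_apply (hB.contDiff_hamField hf hfΩ)
      (hasCompactSupport_hamField hfc) t).differentiable (by norm_num) _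
  have h5 := fderiv_comp y (hf.differentiable (by norm_num) (Φ t y)) hd
  rw [h4] at h5
  rw [hamField, hamField, hB.sharp_flow hf hfc hfΩ hΦ hy, ← h5]

/-- A perturbation which vanishes to first order along an orbit does not change the orbit. -/
lemma IsLocalPoisson.flow_eq_of_fderiv_eq_zero (hB : IsLocalPoisson Ω B) (hf : ContDiff ℝ 2 f)
    (hf' : ContDiff ℝ 2 f') (hfc' : HasCompactSupport f') (hfΩ' : tsupport f' ⊆ Ω)
    (hh : ContDiff ℝ 2 h) (hff' : ∀ x, f' x = f x + h x)
    (hΦ : IsFlow (hamField B f) Φ) (hΦ' : IsFlow (hamField B f') Φ') {y : F} {c : ℝ}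
    (hdh : ∀ t ∈ Icc 0 c, fderiv ℝ h (Φ t y) = 0) {t : ℝ} (ht : t ∈ Icc 0 c) :
    Φ' t y = Φ t y := by
  obtain ⟨K, hK⟩ := (hB.contDiff_hamField hf' hfΩ').lipschitzWith_of_hasCompactSupport
    (hasCompactSupport_hamField hfc') (by norm_num)
  have hsum : ∀ x, fderiv ℝ f' x = fderiv ℝ f x + fderiv ℝ h x := fun x => by
    rw [funext hff']
    exact fderiv_fun_add (hf.differentiable (by norm_num) x) (hh.differentiable (by norm_num) x)
  have h1 := hΦ'.eq_of_hasDerivWithinAt hK (u := fun t => Φ t y) (a := 0) (b := c) (fun s hs => by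
    have := hΦ.deriv y s
    have e : hamField B f' (Φ s y) = hamField B f (Φ s y) := by
      rw [hamField, hsum, hdh s hs, add_zero, hamField]
    rw [e]
    exact this.hasDerivWithinAt) (t := 0) (s := t) ⟨le_rfl, ht.1.trans ht.2⟩ ht
  simpa [hΦ.zero] using h1.symm

/-- The derivative of the perturbed flow along an orbit, for a perturbation which vanishes to first
order along the orbit and whose second derivative is given by a path in the symplectic Lie
algebra. -/
theorem IsLocalPoisson.fderiv_perturbed_flow (hB : IsLocalPoisson Ω B) (hf : ContDiff ℝ 2 f)
    (hfc : HasCompactSupport f) (hfΩ : tsupport f ⊆ Ω)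
    (hf' : ContDiff ℝ 2 f') (hfc' : HasCompactSupport f') (hfΩ' : tsupport f' ⊆ Ω)
    (hh : ContDiff ℝ 2 h) (hff' : ∀ x, f' x = f x + h x)
    (hΦ : IsFlow (hamField B f) Φ) (hΦ' : IsFlow (hamField B f') Φ') {y : F} (hy : y ∈ Ω) {c : ℝ}
    (hdh : ∀ t ∈ Icc 0 c, fderiv ℝ h (Φ t y) = 0) {b : Fin d ⊕ Fin d → F}
    {ξ : Fin d ⊕ Fin d → F →L[ℝ] ℝ} (hξ : ∀ i, B y (ξ i) = b i)
    (hξJ : ∀ i j, ξ i (b j) = J (Fin d) ℝ j i) {a a' : ℝ → ℝ} (ha : ∀ t, HasDerivAt a (a' t) t)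
    (ha0 : a 0 = 0) {Z : SqMatrix d}
    (hZ : (Z * J (Fin d) ℝ)ᵀ = Z * J (Fin d) ℝ)
    (hd2 : ∀ t ∈ Icc 0 c, ∀ u v, fderiv ℝ (fderiv ℝ h) (Φ t y) u v =
      a' t * ∑ i, ∑ j, (Z * J (Fin d) ℝ) i j * (ξ i (fderiv ℝ (Φ (-t)) (Φ t y) u) *
        ξ j (fderiv ℝ (Φ (-t)) (Φ t y) v))) (hc : 0 ≤ c) (k : Fin d ⊕ Fin d) :
    fderiv ℝ (Φ' c) y (b k) = ∑ j, exp (a c • Z) j k • fderiv ℝ (Φ c) y (b j) := by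
  have := FiniteDimensional.complete ℝ F
  have hX := hB.contDiff_hamField hf hfΩ
  have hX' := hB.contDiff_hamField hf' hfΩ'
  obtain ⟨K, hK⟩ := hX'.lipschitzWith_of_hasCompactSupport
    (hasCompactSupport_hamField hfc') (by norm_num)
  have horb : ∀ t ∈ Icc 0 c, Φ' t y = Φ t y := fun t ht =>
    hB.flow_eq_of_fderiv_eq_zero hf hf' hfc' hfΩ' hh hff' hΦ hΦ' hdh ht
  have hmem : ∀ t, Φ t y ∈ Ω := fun t => hB.flow_mem hf hfc hfΩ hΦ hy t
  set S := Z * J (Fin d) ℝ with hS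
  -- the linearized perturbed vector field
  have hDX : ∀ t ∈ Icc 0 c, ∀ u, fderiv ℝ (hamField B f') (Φ t y) u =
      fderiv ℝ (hamField B f) (Φ t y) u + B (Φ t y) (fderiv ℝ (fderiv ℝ h) (Φ t y) u) := by
    intro t ht u
    have e : hamField B f' = fun x => hamField B f x + hamField B h x := by
      funext x
      have : fderiv ℝ f' x = fderiv ℝ f x + fderiv ℝ h x := by
        rw [funext hff']
        exact fderiv_fun_add (hf.differentiable (by norm_num) x)
          (hh.differentiable (by norm_num) x)
      rw [hamField, this, map_add]; rfl
    have h1 := hB.hasFDerivAt_hamField (hmem t) hh.contDiffAt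
    have h2 := ((hX.differentiable (by norm_num) (Φ t y)).hasFDerivAt.add h1).fderiv
    rw [e]
    rw [show fderiv ℝ (fun x => hamField B f x + hamField B h x) (Φ t y) = _ from h2]
    simp [hdh t ht]
  let β : ℝ → Fin d ⊕ Fin d → F := fun t j => fderiv ℝ (Φ t) y (b j)
  let V : ℝ → SqMatrix d := fun t => exp (a t • Z)
  -- Variation of constants: β t j are the unperturbed images of the b j, and the coefficients exp
  -- (a Z) absorb the perturbation. It remains to check that u solves the perturbed variational
  -- equation.
  let u : ℝ → F := fun t => ∑ j, V t j k • β t j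
  have hβ : ∀ t j, HasDerivAt (fun t => β t j) (fderiv ℝ (hamField B f) (Φ t y) (β t j)) t :=
    fun t j => (hΦ.hasDerivAt_fderiv hX (hasCompactSupport_hamField hfc) y t).clm_apply
      (hasDerivAt_const t (b j)) |>.congr_deriv (by simp [β])
  have hu' : ∀ t, HasDerivAt u (∑ j, (V t j k • fderiv ℝ (hamField B f) (Φ t y) (β t j) +
      (a' t * (Z * V t) j k) • β t j)) t := fun t =>
    HasDerivAt.fun_sum fun j _ => (hasDerivAt_exp_apply (ha t) Z j k).smul (hβ t j)
  have hback : ∀ t j, fderiv ℝ (Φ (-t)) (Φ t y) (β t j) = b j := fun t j => by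
    have := hB.fderiv_flow_comp hf hfc hfΩ hΦ y t
    exact congrArg (fun A : F →L[ℝ] F => A (b j)) this
  have hsharp : ∀ t i, B (Φ t y) ((ξ i).comp (fderiv ℝ (Φ (-t)) (Φ t y))) = β t i := fun t i => by
    rw [hB.fderiv_flow_sharp hf hfc hfΩ hΦ hy t, hξ]
  have hJJ : J (Fin d) ℝ * (J (Fin d) ℝ)ᵀ = 1 := by
    rw [J_transpose, mul_neg, J_squared, neg_neg]
  have hu : ∀ t ∈ Icc 0 c, HasDerivAt u (fderiv ℝ (hamField B f') (Φ t y) (u t)) t := by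
    intro t ht
    refine (hu' t).congr_deriv ?_
    rw [hDX t ht, Finset.sum_add_distrib]
    congr 1
    · simp only [u, map_sum, map_smul]
    · have hξu : ∀ i, ξ i (fderiv ℝ (Φ (-t)) (Φ t y) (u t)) = ((J (Fin d) ℝ)ᵀ * V t) i k := by
        intro i
        simp only [u, map_sum, map_smul, hback, hξJ, smul_eq_mul, Matrix.mul_apply,
          Matrix.transpose_apply]
        exact Finset.sum_congr rfl fun l _ => mul_comm _ _
      have e1 : fderiv ℝ (fderiv ℝ h) (Φ t y) (u t) = ∑ j, (a' t * (Z * V t) j k) •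
          ((ξ j).comp (fderiv ℝ (Φ (-t)) (Φ t y))) := by
        ext v
        -- Here the symmetry of S = Z J is used: evaluating ξ i on u gives Jᵀ V, and contracting
        -- with S gives back Z V.
        have e2 : Z * V t = Sᵀ * ((J (Fin d) ℝ)ᵀ * V t) := by
          rw [hZ, hS, mul_assoc, ← mul_assoc (J (Fin d) ℝ), hJJ, one_mul]
        rw [hd2 t ht, Finset.sum_comm, Finset.mul_sum, _root_.sum_apply]
        refine Finset.sum_congr rfl fun j _ => ?_
        rw [e2, Matrix.mul_apply, _root_.smul_apply, ContinuousLinearMap.comp_apply, smul_eq_mul,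
          mul_assoc, Finset.sum_mul]
        congr 1
        refine Finset.sum_congr rfl fun i _ => ?_
        rw [hξu, Matrix.transpose_apply]
        ring
      rw [e1, map_sum]
      refine Finset.sum_congr rfl fun j _ => ?_
      rw [map_smul, hsharp]
  have hu'' : ∀ t ∈ Icc 0 c, HasDerivAt (fun t => fderiv ℝ (Φ' t) y (b k))
      (fderiv ℝ (hamField B f') (Φ t y) (fderiv ℝ (Φ' t) y (b k))) t := fun t ht => by
    have h1 := (hΦ'.hasDerivAt_fderiv hX' (hasCompactSupport_hamField hfc') y t).clm_apply
      (hasDerivAt_const t (b k))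
    rw [horb t ht] at h1
    exact h1.congr_deriv (by simp)
  have h0 : ∀ (Ψ : ℝ → F → F) (X : F → F), IsFlow X Ψ → fderiv ℝ (Ψ 0) y (b k) = b k := by
    intro Ψ X hΨ
    have : Ψ 0 = id := funext hΨ.zero
    rw [this, fderiv_id]; rfl
  have hini : fderiv ℝ (Φ' 0) y (b k) = u 0 := by
    rw [h0 Φ' _ hΦ']
    have hβ0 : ∀ j, β 0 j = b j := fun j => by
      have : Φ 0 = id := funext hΦ.zero
      simp only [β, this, fderiv_id]; rfl
    simp only [u, V, ha0, hβ0, zero_smul, exp_zero, Matrix.one_apply, ite_smul, one_smul]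
    simp only [Finset.sum_ite_eq', Finset.mem_univ, if_true]
  exact ODE_solution_unique_of_mem_Icc_right
    (v := fun t z => fderiv ℝ (hamField B f') (Φ t y) z) (s := fun _ => univ) (K := K)
    (a := 0) (b := c) (f := fun t => fderiv ℝ (Φ' t) y (b k)) (g := u)
    (fun t _ => ((fderiv ℝ (hamField B f') (Φ t y)).lipschitz.weaken
      (by exact_mod_cast norm_fderiv_le_of_lipschitz ℝ hK)).lipschitzOnWith)
    (fun t ht => (hu'' t ht).continuousAt.continuousWithinAt)
    (fun t ht => (hu'' t ⟨ht.1, ht.2.le⟩).hasDerivWithinAt) (fun _ _ => mem_univ _)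
    (fun t ht => (hu t ht).continuousAt.continuousWithinAt)
    (fun t ht => (hu t ⟨ht.1, ht.2.le⟩).hasDerivWithinAt) (fun _ _ => mem_univ _) hini
    ⟨hc, le_rfl⟩

end PerturbedFlow

/-! ### Realizing a symplectic matrix by a perturbation along a short arc. -/

section LocalPerturbation

open Filter

/-- A smooth transition from `0` to `1` on `[α, β]` and its derivative. -/
lemma exists_transition {α β : ℝ} (hαβ : α < β) :
    ∃ a a' : ℝ → ℝ, (∀ t, HasDerivAt a (a' t) t) ∧ ContDiff ℝ 2 a' ∧ (∀ t ≤ α, a t = 0) ∧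
      (∀ t, β ≤ t → a t = 1) ∧ ∀ t, t ∉ Icc α β → a' t = 0 := by
  have hpos : 0 < β - α := sub_pos.2 hαβ
  have hs : ContDiff ℝ 3 fun t => Real.smoothTransition ((t - α) / (β - α)) :=
    (Real.smoothTransition.contDiff (n := 3)).comp
      ((contDiff_id.sub contDiff_const).div_const _)
  have h0 : ∀ t ≤ α, Real.smoothTransition ((t - α) / (β - α)) = 0 := fun t ht =>
    Real.smoothTransition.zero_of_nonpos (div_nonpos_of_nonpos_of_nonneg (by linarith) hpos.le)
  have h1 : ∀ t, β ≤ t → Real.smoothTransition ((t - α) / (β - α)) = 1 := fun t ht =>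
    Real.smoothTransition.one_of_one_le ((one_le_div hpos).2 (by linarith))
  refine ⟨fun t => Real.smoothTransition ((t - α) / (β - α)), deriv _,
    fun t => (hs.differentiable (by norm_num) t).hasDerivAt, ?_, h0, h1, fun t ht => ?_⟩
  · rw [show (3 : ℕ∞ω) = 2 + 1 by norm_num, contDiff_succ_iff_deriv] at hs
    exact hs.2.2
  · rw [mem_Icc, not_and_or, not_le, not_le] at ht
    rcases ht with ht | ht
    · have : (fun t => Real.smoothTransition ((t - α) / (β - α))) =ᶠ[𝓝 t] fun _ => 0 := by
        filter_upwards [Iio_mem_nhds ht] with s hs using h0 s (le_of_lt hs)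
      rw [this.deriv_eq, deriv_const]
    · have : (fun t => Real.smoothTransition ((t - α) / (β - α))) =ᶠ[𝓝 t] fun _ => 1 := by
        filter_upwards [Ioi_mem_nhds ht] with s hs using h1 s (le_of_lt hs)
      rw [this.deriv_eq, deriv_const]

section QuadraticForm

variable {E : Type*} [NormedAddCommGroup E] [NormedSpace ℝ E] [FiniteDimensional ℝ E] {ι : Type*} [Fintype ι]

/-- The function `χ ∑ S i j f i f j / 2`. -/
def quadraticFun (S : Matrix ι ι ℝ) (χ : E → ℝ) (f : ι → E → ℝ) (x : E) : ℝ :=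
  ∑ p : ι × ι, (S p.1 p.2 / 2) * (χ x * (f p.1 x * f p.2 x))

variable {S : Matrix ι ι ℝ} {χ : E → ℝ} {f : ι → E → ℝ}

lemma contDiff_quadraticFun (hχ : ContDiff ℝ 2 χ) (hf : ∀ i, ContDiff ℝ 2 (f i)) :
    ContDiff ℝ 2 (quadraticFun S χ f) :=
  ContDiff.sum fun p _ => contDiff_const.mul (hχ.mul ((hf p.1).mul (hf p.2)))

lemma tsupport_quadraticFun_subset : tsupport (quadraticFun S χ f) ⊆ tsupport χ := by
  refine closure_mono fun x hx => ?_
  rw [Function.mem_support] at hx ⊢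
  intro h0
  exact hx (by simp [quadraticFun, h0])

/-- At a common zero of the f i only terms with one derivative on each f survive. There are two of
them, equal after summation by symmetry of S, which cancels the 1/2 in the definition. -/
lemma fderiv_quadraticFun (hχ : ContDiff ℝ 2 χ) (hf : ∀ i, ContDiff ℝ 2 (f i))
    (hS : S.transpose = S) {y : E} (hy : ∀ i, f i y = 0) : fderiv ℝ (quadraticFun S χ f) y = 0 ∧
      ∀ u v, fderiv ℝ (fderiv ℝ (quadraticFun S χ f)) y u v =
        χ y * ∑ i, ∑ j, S i j * (fderiv ℝ (f i) y u * fderiv ℝ (f j) y v) := by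
  set g : ι × ι → E → ℝ := fun p x => χ x * (f p.1 x * f p.2 x) with hg
  have hgc : ∀ p, ContDiff ℝ 2 (g p) := fun p => hχ.mul ((hf p.1).mul (hf p.2))
  have h1 : fderiv ℝ (quadraticFun S χ f) = fun x => ∑ p, (S p.1 p.2 / 2) • fderiv ℝ (g p) x := by
    funext x
    refine HasFDerivAt.fderiv (HasFDerivAt.fun_sum fun p _ => ?_)
    exact (((hgc p).differentiable (by norm_num) x).hasFDerivAt.const_mul _)
  have h2 : HasFDerivAt (fderiv ℝ (quadraticFun S χ f))
      (∑ p, (S p.1 p.2 / 2) • fderiv ℝ (fderiv ℝ (g p)) y) y := by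
    rw [h1]
    refine HasFDerivAt.fun_sum fun p _ => ?_
    have h := (((hgc p).fderiv_right (m := 1) (by norm_num)).differentiable
      (by norm_num) y).hasFDerivAt
    exact h.const_smul (S p.1 p.2 / 2)
  have h3 := fun p : ι × ι => fderiv_mul_mul hχ (hf p.1) (hf p.2) (hy p.1) (hy p.2)
  refine ⟨?_, fun u v => ?_⟩
  · rw [h1]
    exact Finset.sum_eq_zero fun p _ => by rw [(h3 p).1, smul_zero]
  · have hSij : ∀ i j, S j i = S i j := fun i j => congrFun (congrFun hS i) j
    rw [h2.fderiv, sum_apply, sum_apply]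
    have h4 : ∀ p : ι × ι, ((S p.1 p.2 / 2) • fderiv ℝ (fderiv ℝ (g p)) y) u v =
        χ y / 2 * (S p.1 p.2 * (fderiv ℝ (f p.1) y u * fderiv ℝ (f p.2) y v)) +
        χ y / 2 * (S p.1 p.2 * (fderiv ℝ (f p.2) y u * fderiv ℝ (f p.1) y v)) := fun p => by
      rw [smul_apply, smul_apply, (h3 p).2 u v, smul_eq_mul]
      ring
    rw [Finset.sum_congr rfl fun p _ => h4 p, Finset.sum_add_distrib, ← Finset.mul_sum,
      ← Finset.mul_sum, Fintype.sum_prod_type, Fintype.sum_prod_type]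
    have h5 : ∑ i, ∑ j, S i j * (fderiv ℝ (f j) y u * fderiv ℝ (f i) y v) =
        ∑ i, ∑ j, S i j * (fderiv ℝ (f i) y u * fderiv ℝ (f j) y v) := by
      rw [Finset.sum_comm]
      exact Finset.sum_congr rfl fun i _ => Finset.sum_congr rfl fun j _ => by rw [hSij]
    rw [h5]
    ring

lemma norm_iteratedFDeriv_quadraticFun_le (hχ : ContDiff ℝ 2 χ) (hf : ∀ i, ContDiff ℝ 2 (f i))
    {κ K : ℝ} (hS : ∀ i j, |S i j| ≤ κ) {m : ℕ} (hm : m ≤ 2) {x : E}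
    (hK : ∀ i j, ‖iteratedFDeriv ℝ m (fun x => χ x * (f i x * f j x)) x‖ ≤ K) :
    ‖iteratedFDeriv ℝ m (quadraticFun S χ f) x‖ ≤ (Fintype.card (ι × ι)) * (κ * K) := by
  have hc : ∀ p : ι × ι, ContDiffAt ℝ m (fun x => χ x * (f p.1 x * f p.2 x)) x := fun p =>
    ((hχ.mul ((hf p.1).mul (hf p.2))).of_le (by exact_mod_cast hm)).contDiffAt
  have h1 : iteratedFDeriv ℝ m (quadraticFun S χ f) x = ∑ p : ι × ι, (S p.1 p.2 / 2) •
      iteratedFDeriv ℝ m (fun x => χ x * (f p.1 x * f p.2 x)) x := by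
    have := iteratedFDeriv_fun_sum_apply (𝕜 := ℝ) (u := Finset.univ) (n := m) (x := x)
      (f := fun (p : ι × ι) x => (S p.1 p.2 / 2) • (χ x * (f p.1 x * f p.2 x)))
      fun p _ => (hc p).const_smul _
    refine this.trans (Finset.sum_congr rfl fun p _ => ?_)
    exact iteratedFDeriv_const_smul_apply' (hc p)
  rw [h1]
  refine (norm_sum_le_of_le Finset.univ (f := fun p : ι × ι => (S p.1 p.2 / 2) •
      iteratedFDeriv ℝ m (fun x => χ x * (f p.1 x * f p.2 x)) x) (n := fun _ => κ * K)
      fun p _ => ?_).trans_eq (by simp)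
  rw [norm_smul, Real.norm_eq_abs, abs_div, abs_two]
  have h2 := hS p.1 p.2
  exact mul_le_mul (by have := abs_nonneg (S p.1 p.2); linarith) (hK p.1 p.2) (norm_nonneg _)
    ((abs_nonneg _).trans h2)

end QuadraticForm

variable {F : Type*} [NormedAddCommGroup F] [NormedSpace ℝ F] [FiniteDimensional ℝ F]
  {Ω : Set F} {B : F → (F →L[ℝ] ℝ) →L[ℝ] F} {f : F → ℝ} {Φ : ℝ → F → F}

/-- Bootstrapping in γ' = X ∘ γ: orbits are one degree smoother than the field. -/
lemma IsFlow.contDiff_orbit {X : F → F} (hΦ : IsFlow X Φ) (hX : ContDiff ℝ 1 X) (y : F) :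
    ContDiff ℝ 2 fun t => Φ t y := by
  have hd : _root_.deriv (fun t => Φ t y) = fun t => X (Φ t y) := funext fun t => (hΦ.deriv y t).deriv
  have hdiff : Differentiable ℝ fun t => Φ t y := fun t => (hΦ.deriv y t).differentiableAt
  have h1 : ContDiff ℝ 1 fun t => Φ t y := by
    rw [contDiff_one_iff_deriv, hd]
    exact ⟨hdiff, hX.continuous.comp hdiff.continuous⟩
  rw [show (2 : ℕ∞ω) = 1 + 1 by norm_num, contDiff_succ_iff_deriv, hd]
  exact ⟨hdiff, by simp, hX.comp h1⟩

/-- Covectors transported along an orbit of a Hamiltonian flow depend `C¹` on time. -/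
lemma IsLocalPoisson.contDiff_fderiv_flow_neg (hB : IsLocalPoisson Ω B) (hf : ContDiff ℝ 2 f)
    (hfc : HasCompactSupport f) (hfΩ : tsupport f ⊆ Ω) (hΦ : IsFlow (hamField B f) Φ) (y : F) :
    ContDiff ℝ 1 fun t => fderiv ℝ (Φ (-t)) (Φ t y) := by
  have := FiniteDimensional.complete ℝ F
  have hX := hB.contDiff_hamField hf hfΩ
  have hd := hΦ.hasDerivAt_fderiv hX (hasCompactSupport_hamField hfc) y
  have hdiff : Differentiable ℝ fun t => fderiv ℝ (Φ t) y := fun t => (hd t).differentiableAt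
  have hY : ContDiff ℝ 1 fun t => fderiv ℝ (Φ t) y := by
    rw [contDiff_one_iff_deriv, show deriv (fun t => fderiv ℝ (Φ t) y) = _ from
      funext fun t => (hd t).deriv]
    exact ⟨hdiff, ((hX.continuous_fderiv (by norm_num)).comp
      (hΦ.contDiff_orbit hX y).continuous).clm_comp hdiff.continuous⟩
  have h1 := hB.fderiv_flow_comp hf hfc hfΩ hΦ y
  have h2 := hB.fderiv_flow_comp' hf hfc hfΩ hΦ y
  have e : (fun t => fderiv ℝ (Φ (-t)) (Φ t y)) =
      fun t => ContinuousLinearMap.inverse (fderiv ℝ (Φ t) y) :=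
    funext fun t => (ContinuousLinearMap.inverse_eq (h2 t) (h1 t)).symm
  rw [e, contDiff_iff_contDiffAt]
  intro t
  exact ContDiffAt.comp t (contDiffAt_map_inverse
    (ContinuousLinearEquiv.equivOfInverse' (fderiv ℝ (Φ t) y) _ (h2 t) (h1 t))) hY.contDiffAt

open Matrix NormedSpace in
/-- The derivative of a Hamiltonian flow along a short arc of an orbit can be modified by any
symplectic matrix near the identity by a `C²` small perturbation of the Hamiltonian which is
supported near the arc and does not change the orbit. -/
theorem IsLocalPoisson.exists_perturbation {d : ℕ} (hB : IsLocalPoisson Ω B)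
    (hf : ContDiff ℝ 2 f) (hfc : HasCompactSupport f) (hfΩ : tsupport f ⊆ Ω)
    (hΦ : IsFlow (hamField B f) Φ) {y : F} (hy : y ∈ Ω) (hX0 : hamField B f y ≠ 0)
    {b : Fin d ⊕ Fin d → F} {ξ : Fin d ⊕ Fin d → F →L[ℝ] ℝ} (hξ : ∀ i, B y (ξ i) = b i)
    (hξJ : ∀ i j, ξ i (b j) = J (Fin d) ℝ j i) (hξX : ∀ i, ξ i (hamField B f y) = 0)
    {V : Set F} (hV : IsOpen V) (hyV : y ∈ V) {T₀ : ℝ} (hT₀ : 0 < T₀) :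
    ∃ α β c : ℝ, 0 < α ∧ α < β ∧ β < c ∧ c < T₀ ∧ (∀ t ∈ Icc 0 c, Φ t y ∈ V) ∧
      ∃ Z : Set F, IsCompact Z ∧ Z ⊆ V ∧ ∀ L ∈ symplecticGroup (Fin d) ℝ, ∀ ε > 0, ∃ δ > 0,
        ∀ A ∈ symplecticGroup (Fin d) ℝ, (∀ j, ∑ i, |(A - 1) i j| < δ) →
        ∀ G, IsOpen G → (fun t => Φ t y) '' Icc α β ⊆ G →
        ∃ h : F → ℝ, ContDiff ℝ 2 h ∧ tsupport h ⊆ G ∩ Z ∧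
          (∀ m ≤ 2, ∀ x, ‖iteratedFDeriv ℝ m h x‖ ≤ ε) ∧
          (∀ t ∈ Icc 0 c, fderiv ℝ h (Φ t y) = 0) ∧
          ∀ Φ' : ℝ → F → F, IsFlow (hamField B fun x => f x + h x) Φ' →
            ∃ Q : SqMatrix d, L * Q = A * L ∧
              ∀ k, fderiv ℝ (Φ' c) y (b k) = ∑ j, Q j k • fderiv ℝ (Φ c) y (b j) := by
  have hX := hB.contDiff_hamField hf hfΩ
  set γ : ℝ → F := fun t => Φ t y with hγdef
  have hγ : ContDiff ℝ 2 γ := hΦ.contDiff_orbit hX y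
  have hγ' : ∀ t, deriv γ t = hamField B f (Φ t y) := fun t => (hΦ.deriv y t).deriv
  have hγ0 : γ 0 = y := hΦ.zero y
  obtain ⟨θ, hθ, η, hη, hθγ⟩ := exists_time_function hγ (by rw [hγ', hΦ.zero]; exact hX0)
  have hγV : ∀ᶠ t in 𝓝 (0 : ℝ), γ t ∈ V ∩ Ω :=
    hγ.continuous.continuousAt.eventually_mem
      ((hV.inter hB.isOpen).mem_nhds (by rw [hγ0]; exact ⟨hyV, hy⟩))
  obtain ⟨ρ, hρ, hρV⟩ := Metric.eventually_nhds_iff.1 hγV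
  -- Short enough for the orbit to stay in V and in Ω, for θ to measure time along it, and to end
  -- before T₀. The perturbation acts on the middle third of [0, c].
  set c : ℝ := min T₀ (min η ρ) / 2 with hc
  have hm : 0 < min T₀ (min η ρ) := lt_min hT₀ (lt_min hη hρ)
  have hc0 : 0 < c := half_pos hm
  have hcm : c < min T₀ (min η ρ) := half_lt_self hm
  have hcT : c < T₀ := hcm.trans_le (min_le_left _ _)
  have hcη : c < η := hcm.trans_le ((min_le_right _ _).trans (min_le_left _ _))
  have hcρ : c < ρ := hcm.trans_le ((min_le_right _ _).trans (min_le_right _ _))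
  have hγVc : ∀ t ∈ Icc 0 c, γ t ∈ V ∩ Ω := fun t ht => hρV (by
    rw [Real.dist_eq, sub_zero, abs_of_nonneg ht.1]; exact ht.2.trans_lt hcρ)
  have hηc : ∀ t ∈ Icc 0 c, |t| < η := fun t ht => by
    rw [abs_of_nonneg ht.1]; exact ht.2.trans_lt hcη
  obtain ⟨a, a', ha, ha', ha0, ha1, hasupp⟩ := exists_transition (α := c / 3) (β := 2 * c / 3)
    (by linarith)
  have hsub : Icc (c / 3) (2 * c / 3) ⊆ Icc 0 c := fun t ht =>
    ⟨by linarith [ht.1], by linarith [ht.2]⟩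
  -- the transported covectors
  set ξt : Fin d ⊕ Fin d → ℝ → F →L[ℝ] ℝ :=
    fun i t => (ξ i).comp (fderiv ℝ (Φ (-t)) (Φ t y)) with hξt
  have hξtc : ∀ i, ContDiff ℝ 1 (ξt i) := fun i =>
    contDiff_const.clm_comp (hB.contDiff_fderiv_flow_neg hf hfc hfΩ hΦ y)
  have hξtγ : ∀ i s, ξt i s (deriv γ s) = 0 := fun i s => by
    rw [hγ', ← hB.fderiv_flow_hamField hf hfc hfΩ hΦ hy s]
    have h1 := congrArg (fun A : F →L[ℝ] F => A (hamField B f y))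
      (hB.fderiv_flow_comp hf hfc hfΩ hΦ y s)
    exact (congrArg (ξ i) h1).trans (hξX i)
  choose g hg hgγ using fun i => exists_function_of_differential hγ hθ (hξtc i) (hξtγ i)
  obtain ⟨Z, K, hZ, hZV, hcut⟩ := exists_uniform_cutoff hγ hθ hθγ hg
    (fun i s hs => (hgγ i s (hθγ s hs)).1) ha' (a := c / 3) (b := 2 * c / 3)
    (fun t ht => by
      rw [mem_ball_zero_iff, Real.norm_eq_abs]
      exact hηc t (hsub ht)) hasupp (hV.inter hB.isOpen)
    (by rintro _ ⟨t, ht, rfl⟩; exact hγVc t (hsub ht))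
  refine ⟨c / 3, 2 * c / 3, c, by linarith, by linarith, by linarith, hcT,
    fun t ht => (hγVc t ht).1, Z, hZ, fun x hx => (hZV hx).1, fun L hL ε hε => ?_⟩
  set N : ℝ := ((Fintype.card ((Fin d ⊕ Fin d) × (Fin d ⊕ Fin d)) : ℕ) : ℝ) with hN
  have hN0 : 0 ≤ N := Nat.cast_nonneg _
  -- The perturbation is a sum of N terms, each of size at most κ (|K| + 1). As K was fixed before
  -- G, the δ obtained from κ does not depend on G.
  set κ : ℝ := ε / (N * (|K| + 1) + 1) with hκ
  have hden : 0 < N * (|K| + 1) + 1 := by positivity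
  have hκ0 : 0 < κ := div_pos hε hden
  obtain ⟨δ, hδ, hlog⟩ := exists_small_log hL hκ0
  refine ⟨δ, hδ, fun A hA hAδ G hG hGγ => ?_⟩
  obtain ⟨S, hS, hSsymm, hSκ⟩ := hlog A hA hAδ
  obtain ⟨χ, hχ, hχγ, hχG, hχK⟩ := hcut G hG hGγ
  -- The functions g i have the transported covectors as differentials along the arc and χ restricts
  -- to a' there, so h has the required second derivative. Since a goes from 0 to 1, the matrix
  -- obtained at time c is exp S.
  set h := quadraticFun (S * J (Fin d) ℝ) χ g with hh
  have hhc : ContDiff ℝ 2 h := contDiff_quadraticFun hχ hg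
  have hhs : tsupport h ⊆ G ∩ Z := tsupport_quadraticFun_subset.trans hχG
  have hhd := fun (t : ℝ) (ht : t ∈ Icc 0 c) => fderiv_quadraticFun hχ hg hSsymm (y := γ t)
    fun i => (hgγ i t (hθγ t (hηc t ht))).1
  have hhcs : HasCompactSupport h := hZ.of_isClosed_subset (isClosed_tsupport h)
    fun x hx => (hhs hx).2
  have hfc' : HasCompactSupport fun x => f x + h x := hfc.add hhcs
  have hfΩ' : tsupport (fun x => f x + h x) ⊆ Ω := (tsupport_add f h).trans
    (union_subset hfΩ fun x hx => (hZV (hhs hx).2).2)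
  refine ⟨h, hhc, hhs, fun m hm x => ?_, fun t ht => (hhd t ht).1, fun Φ' hΦ' =>
    ⟨exp S, hS, fun k => ?_⟩⟩
  · refine (norm_iteratedFDeriv_quadraticFun_le hχ hg (fun i j => (hSκ i j).le) hm
      fun i j => (hχK i j m hm x).trans ((le_abs_self K).trans (by linarith : |K| ≤ |K| + 1))).trans ?_
    have e : ε = κ * (N * (|K| + 1) + 1) := by rw [hκ, div_mul_cancel₀ _ hden.ne']
    rw [e]
    nlinarith
  · have h1 := hB.fderiv_perturbed_flow hf hfc hfΩ (hf.add hhc) hfc' hfΩ' hhc (fun _ => rfl) hΦ hΦ'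
      hy (c := c) (fun t ht => (hhd t ht).1) hξ hξJ ha (ha0 0 (by linarith)) hSsymm
      (fun t ht u v => by
        rw [(hhd t ht).2 u v, hχγ t (hηc t ht)]
        refine congrArg _ (Finset.sum_congr rfl fun i _ => Finset.sum_congr rfl fun j _ => ?_)
        rw [(hgγ i t (hθγ t (hηc t ht))).2.fderiv, (hgγ j t (hθγ t (hηc t ht))).2.fderiv]
        rfl) hc0.le k
    rwa [ha1 c (by linarith), one_smul] at h1

end LocalPerturbation

/-! ### The global C² norm of functions supported in a chart. -/

section NormBound

open Filter

variable {E : Type*} [NormedAddCommGroup E] [NormedSpace ℝ E] [FiniteDimensional ℝ E]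
  {M : Type*} [TopologicalSpace M] [T2Space M] [ChartedSpace E M] [IsManifold 𝓘(ℝ, E) ∞ M]
  {e e' : OpenPartialHomeomorph M E}

/-- The `C²` size in a chart of functions given in another chart. -/
lemma exists_bound_iteratedFDeriv_liftFun (he : e ∈ IsManifold.maximalAtlas 𝓘(ℝ, E) ∞ M)
    (he' : e' ∈ IsManifold.maximalAtlas 𝓘(ℝ, E) ∞ M) {Z : Set E} (hZ : IsCompact Z)
    (hZe : Z ⊆ e.target) {K : Set M} (hK : IsClosed K) (hKe : K ⊆ e'.source) :
    ∃ C : ℝ, 0 ≤ C ∧ ∀ u : E → ℝ, ContDiff ℝ 2 u → tsupport u ⊆ Z → ∀ κ : ℝ,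
      (∀ m ≤ 2, ∀ x, ‖iteratedFDeriv ℝ m u x‖ ≤ κ) → ∀ m ≤ 2, ∀ x ∈ K,
        ‖iteratedFDeriv ℝ m (liftFun e u ∘ e'.symm) (e' x)‖ ≤ C * κ := by
  set D := e'.target ∩ e'.symm ⁻¹' e.source with hD
  have hDo : IsOpen D := e'.isOpen_inter_preimage_symm e.open_source
  have hτ : ContDiffOn ℝ ∞ (e ∘ e'.symm) D :=
    ((contMDiffOn_of_mem_maximalAtlas he).comp
      ((contMDiffOn_symm_of_mem_maximalAtlas he').mono inter_subset_left)
      fun x hx => hx.2).contDiffOn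
  set A := e' '' (K ∩ e.symm '' Z) with hA
  have hAc : IsCompact A := by
    refine IsCompact.image_of_continuousOn ?_ (e'.continuousOn.mono fun x hx => hKe hx.1)
    exact (hZ.image_of_continuousOn (e.continuousOn_symm.mono hZe)).inter_left hK
  have hmem : ∀ x ∈ K ∩ e.symm '' Z, x ∈ e.source := by
    rintro _ ⟨_, z, hz, rfl⟩
    exact e.map_target (hZe hz)
  have hAD : A ⊆ D := by
    rintro _ ⟨x, hx, rfl⟩
    refine ⟨e'.map_source (hKe hx.1), ?_⟩
    rw [mem_preimage, e'.left_inv (hKe hx.1)]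
    exact hmem x hx
  have hb : ∀ i : ℕ, ∃ C : ℝ, ∀ y ∈ A, ‖iteratedFDerivWithin ℝ i (e ∘ e'.symm) D y‖ ≤ C :=
    fun i => hAc.exists_bound_of_continuousOn
      ((hτ.continuousOn_iteratedFDerivWithin (by exact_mod_cast le_top)
        hDo.uniqueDiffOn).mono hAD)
  choose c hc using hb
  -- With this r the i-th derivative of the change of charts is at most rⁱ for i = 1, 2, as the
  -- estimate for compositions requires.
  set r : ℝ := 1 + |c 1| + |c 2| with hr
  have hr1 : 1 ≤ r := by have := abs_nonneg (c 1); have := abs_nonneg (c 2); linarith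
  refine ⟨2 * r ^ 2, by positivity, fun u hu huZ κ hκ m hm x hx => ?_⟩
  have hκ0 : 0 ≤ κ := (norm_nonneg _).trans (hκ 0 (by norm_num) 0)
  by_cases hxu : x ∈ e.symm '' tsupport u
  · have hxZ : x ∈ K ∩ e.symm '' Z := ⟨hx, image_mono huZ hxu⟩
    have hyA : e' x ∈ A := ⟨x, hxZ, rfl⟩
    have hyD := hAD hyA
    have hev : liftFun e u ∘ e'.symm =ᶠ[𝓝 (e' x)] u ∘ (e ∘ e'.symm) := by
      filter_upwards [hDo.mem_nhds hyD] with y hy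
      exact liftFun_of_mem u hy.2
    have h1 := norm_iteratedFDerivWithin_comp_le (g := u) (f := e ∘ e'.symm) (n := m) (s := D)
      (t := univ) (N := 2) (C := κ) (D := r) hu.contDiffOn (hτ.of_le (WithTop.coe_le_coe.2 (le_top : (2 : ℕ∞) ≤ ⊤)))
      (by exact_mod_cast hm) uniqueDiffOn_univ hDo.uniqueDiffOn (mapsTo_univ _ _) hyD
      (fun i hi => by rw [iteratedFDerivWithin_univ]; exact hκ i (hi.trans hm) _)
      (fun i h1i him => by
        refine (hc i _ hyA).trans ?_
        have h2 := abs_nonneg (c 1)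
        have h3 := abs_nonneg (c 2)
        have h4 := le_abs_self (c 1)
        have h5 := le_abs_self (c 2)
        have hi2 : i ≤ 2 := him.trans hm
        interval_cases i
        · rw [pow_one]; linarith
        · nlinarith)
    rw [(hev.iteratedFDeriv ℝ m).eq_of_nhds, ← iteratedFDerivWithin_of_isOpen m hDo hyD]
    refine h1.trans ?_
    have h2 : (m.factorial : ℝ) ≤ 2 := by
      exact_mod_cast (Nat.factorial_le hm)
    have h3 : r ^ m ≤ r ^ 2 := pow_le_pow_right₀ hr1 hm
    calc (m.factorial : ℝ) * κ * r ^ m ≤ 2 * κ * r ^ 2 := by gcongr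
      _ = 2 * r ^ 2 * κ := by ring
  · have hev : liftFun e u ∘ e'.symm =ᶠ[𝓝 (e' x)] fun _ => 0 := by
      have h1 := liftFun_eventuallyEq_zero (hZ.of_isClosed_subset (isClosed_tsupport u) huZ)
        (huZ.trans hZe) hxu
      have h2 := e'.continuousAt_symm (e'.map_source (hKe hx))
      rw [ContinuousAt, e'.left_inv (hKe hx)] at h2
      exact h2.eventually h1
    rw [(hev.iteratedFDeriv ℝ m).eq_of_nhds]
    rw [iteratedFDeriv_fun_zero]
    simp only [Pi.zero_apply, norm_zero]
    positivity

/-- The `C²` norm of functions supported in a compact subset of a chart. -/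
theorem NormAtlas.exists_c2norm_liftFun_le (𝔄 : NormAtlas E M)
    (he : e ∈ IsManifold.maximalAtlas 𝓘(ℝ, E) ∞ M) {Z : Set E} (hZ : IsCompact Z)
    (hZe : Z ⊆ e.target) :
    ∃ C : ℝ, 0 ≤ C ∧ ∀ u : E → ℝ, ContDiff ℝ 2 u → tsupport u ⊆ Z → ∀ κ : ℝ,
      (∀ m ≤ 2, ∀ x, ‖iteratedFDeriv ℝ m u x‖ ≤ κ) →
        𝔄.c2norm (liftFun e u) ≤ ENNReal.ofReal (C * κ) := by
  have hZc : IsCompact (e.symm '' Z) :=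
    hZ.image_of_continuousOn (e.continuousOn_symm.mono hZe)
  -- Only finitely many K i meet the compact support, so the supremum over all charts is controlled
  -- by finitely many constants.
  have hfin := 𝔄.locallyFinite.finite_nonempty_inter_compact hZc
  choose C hC0 hC using fun i => exists_bound_iteratedFDeriv_liftFun he (𝔄.chart_mem i) hZ hZe
    (𝔄.isClosed_K i) (𝔄.K_subset i)
  refine ⟨∑ i ∈ hfin.toFinset, C i, Finset.sum_nonneg fun i _ => hC0 i, fun u hu huZ κ hκ => ?_⟩
  have hκ0 : 0 ≤ κ := (norm_nonneg _).trans (hκ 0 (by norm_num) 0)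
  refine iSup_le fun i => iSup₂_le fun x hx => iSup₂_le fun m hm => ?_
  have hm2 : m ≤ 2 := by rw [Finset.mem_range] at hm; omega
  rw [← ofReal_norm]
  refine ENNReal.ofReal_le_ofReal ?_
  by_cases hi : i ∈ hfin.toFinset
  · refine (hC i u hu huZ κ hκ m hm2 x hx).trans ?_
    exact mul_le_mul_of_nonneg_right
      (Finset.single_le_sum (f := C) (fun j _ => hC0 j) hi) hκ0
  · have hxu : x ∉ e.symm '' tsupport u := fun h => hi (by
      rw [Finite.mem_toFinset]
      exact ⟨x, hx, image_mono huZ h⟩)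
    have hev : liftFun e u ∘ (𝔄.chart i).symm =ᶠ[𝓝 (𝔄.chart i x)] fun _ => 0 := by
      have h1 := liftFun_eventuallyEq_zero (hZ.of_isClosed_subset (isClosed_tsupport u) huZ)
        (huZ.trans hZe) hxu
      have h2 := (𝔄.chart i).continuousAt_symm ((𝔄.chart i).map_source (𝔄.K_subset i hx))
      rw [ContinuousAt, (𝔄.chart i).left_inv (𝔄.K_subset i hx)] at h2
      exact h2.eventually h1
    rw [(hev.iteratedFDeriv ℝ m).eq_of_nhds]
    rw [iteratedFDeriv_fun_zero]
    simp only [Pi.zero_apply, norm_zero]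
    exact mul_nonneg (Finset.sum_nonneg fun i _ => hC0 i) hκ0

end NormBound

/-! ### Local description of the energy surface within a leaf. -/

section LocalSection

open Filter

/-- First integrals of all Hamiltonian vector fields are constant along Hamiltonian flows. -/
lemma IsFlow.apply_eq_of_forall_fderiv_eq_zero {F : Type*} [NormedAddCommGroup F] [NormedSpace ℝ F]
    {B : F → (F →L[ℝ] ℝ) →L[ℝ] F} {f : F → ℝ} {Φ : ℝ → F → F} (hΦ : IsFlow (hamField B f) Φ)
    {v : F → F} {O : Set F} (hv : ∀ y ∈ O, DifferentiableAt ℝ v y)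
    (hk : ∀ y ∈ O, ∀ ξ, fderiv ℝ v y (B y ξ) = 0) {y : F} {s : Set ℝ} (hs : Convex ℝ s)
    (hsO : ∀ r ∈ s, Φ r y ∈ O) {a b : ℝ} (ha : a ∈ s) (hb : b ∈ s) : v (Φ b y) = v (Φ a y) := by
  have hd : ∀ r ∈ s, HasDerivWithinAt (fun r => v (Φ r y)) 0 s r := fun r hr => by
    have h1 := (hv _ (hsO r hr)).hasFDerivAt.comp_hasDerivAt r (hΦ.deriv y r)
    rw [hamField, hk _ (hsO r hr)] at h1
    exact h1.hasDerivWithinAt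
  have h1 := hs.norm_image_sub_le_of_norm_hasDerivWithin_le (C := 0) hd (fun _ _ => by simp) ha hb
  rw [zero_mul] at h1
  exact sub_eq_zero.1 (norm_le_zero_iff.1 h1)

lemma eq_of_mem_energySurface {M : Type*} [TopologicalSpace M] {H : M → ℝ} {p x : M}
    (hx : x ∈ energySurface H p) : H x = H p := by
  have h : x ∈ H ⁻¹' {H p} := connectedComponentIn_subset _ _ hx
  exact h

variable {E : Type*} [NormedAddCommGroup E] [NormedSpace ℝ E] [FiniteDimensional ℝ E]
  {M : Type*} [TopologicalSpace M] [ChartedSpace E M] [T2Space M] [IsManifold 𝓘(ℝ, E) ∞ M]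
  [SecondCountableTopology M] {π : PoissonStructure E M}

attribute [local instance] isManifold_one in
/-- The functions on the energy surface which are constant on the leaves, and the projection along
the flow to a transversal. -/
theorem IsTransversal.exists_section {H : M → ℝ} (hH : ContMDiff 𝓘(ℝ, E) 𝓘(ℝ, ℝ) 2 H) {d : ℕ}
    (hπ : π.IsRegular (d + 1)) {N : Set M} {p : M} (hN : IsTransversal π H d N p)
    (hp0 : π.hamE H p ≠ 0) {e : OpenPartialHomeomorph M E} {f : E → ℝ} {V : Set E}
    {Φ : ℝ → E → E} (h : π.ChartFlow H e f V Φ) (hpe : p ∈ e.source) (hpV : e p ∈ V) :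
    ∃ (O : Set E) (v : E → E) (s : E → ℝ), IsOpen O ∧ e p ∈ O ∧ O ⊆ V ∧
      (∀ y ∈ O, DifferentiableAt ℝ v y) ∧ (∀ y ∈ O, ∀ ξ, fderiv ℝ v y (π.tensor e y ξ) = 0) ∧
      ContDiffAt ℝ 1 s (e p) ∧ s (e p) = 0 ∧ (∀ᶠ x in 𝓝 p, x ∈ N → v (e x) = v (e p)) ∧
      (∀ᶠ z in 𝓝 (e p), v z = v (e p) → f z = f (e p) → e.symm (Φ (-s z) z) ∈ N) ∧
      ∀ u ∈ tangentE N p, fderiv ℝ s (e p) (chartDeriv e p u) = 0 := by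
  have hM2 : IsManifold 𝓘(ℝ, E) 2 M := isManifold_two
  have he := h.mem_atlas
  have he1 := mem_maximalAtlas_one he
  obtain ⟨O, v, hO, hpO, hOe, hv, hvker, hvfol⟩ := π.exists_isFoliatedMap hπ he hpe
  have hvN : ∀ᶠ x in 𝓝 p, x ∈ N → v (e x) = v (e p) :=
    hN.submanifold.eventually_eq hπ hN.mem (fun x hx => (hN.subset hx).2) hvfol ⟨hpe, hpO⟩
  have hHN : ∀ x ∈ N, H x = H p := fun x hx => eq_of_mem_energySurface (hN.subset hx).1
  obtain ⟨eN, heN, hpN, L, hLk, hL⟩ := hN.submanifold.exists_chart hN.mem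
  have htan := tangentE_eq heN hpN hN.mem hL
  have hvd : ∀ y ∈ O, ContDiffAt ℝ 1 v y := fun y hy => hv.contDiffAt (hO.mem_nhds hy)
  have hinv : e.symm (e p) = p := e.left_inv hpe
  have hpt := e.map_source hpe
  -- `f` in terms of `H`
  have hfH : ∀ y ∈ V, f y = H (e.symm y) := fun y hy => h.eqOn hy
  have hX0 : hamField (π.tensor e) f (e p) = chartDeriv e p (π.hamE H p) :=
    h.hamField_eq hH hpe hpV
  set k : E → E := eN ∘ e.symm with hk
  set j : E → E := e ∘ eN.symm with hj
  have hkp : k (e p) = eN p := by rw [hk, Function.comp_apply, hinv]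
  have hkd : ∀ u, fderiv ℝ k (e p) u = chartDeriv eN p (chartDerivSymm e (e p) u) := fun u => by
    rw [(hasFDerivAt_comp_symm he1 hpe (hasMFDerivAt_chart heN hpN)).fderiv]; rfl
  have hkc : ContDiffAt ℝ 1 k (e p) := by
    have h1 : ContMDiffAt 𝓘(ℝ, E) 𝓘(ℝ, E) 1 eN (e.symm (e p)) := by
      rw [hinv]
      exact (contMDiffOn_of_mem_maximalAtlas heN).contMDiffAt (eN.open_source.mem_nhds hpN)
    have h2 : ContMDiffAt 𝓘(ℝ, E) 𝓘(ℝ, E) 1 e.symm (e p) :=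
      (contMDiffOn_symm_of_mem_maximalAtlas he1).contMDiffAt (e.open_target.mem_nhds hpt)
    exact (h1.comp (e p) h2).contDiffAt
  have hjc : ContDiffAt ℝ 1 j (k (e p)) := by
    rw [hkp]
    have h1 : ContMDiffAt 𝓘(ℝ, E) 𝓘(ℝ, E) 1 e (eN.symm (eN p)) := by
      rw [eN.left_inv hpN]
      exact (contMDiffOn_of_mem_maximalAtlas he1).contMDiffAt (e.open_source.mem_nhds hpe)
    have h2 : ContMDiffAt 𝓘(ℝ, E) 𝓘(ℝ, E) 1 eN.symm (eN p) :=
      (contMDiffOn_symm_of_mem_maximalAtlas heN).contMDiffAt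
        (eN.open_target.mem_nhds (eN.map_source hpN))
    exact (h1.comp (eN p) h2).contDiffAt
  have hesymm : Tendsto e.symm (𝓝 (e p)) (𝓝 p) := by
    have := e.continuousAt_symm hpt
    rwa [ContinuousAt, hinv] at this
  have heNsymm : Tendsto eN.symm (𝓝 (eN p)) (𝓝 p) := by
    have := eN.continuousAt_symm (eN.map_source hpN)
    rwa [ContinuousAt, eN.left_inv hpN] at this
  have hjk : ∀ᶠ y in 𝓝 (e p), j (k y) = y := by
    filter_upwards [e.open_target.mem_nhds hpt,
      hesymm.eventually (eN.open_source.mem_nhds hpN)] with y hy hyN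
    rw [hj, hk, Function.comp_apply, Function.comp_apply, eN.left_inv hyN, e.right_inv hy]
  have hkj : ∀ᶠ z in 𝓝 (k (e p)), k (j z) = z := by
    rw [hkp]
    filter_upwards [eN.open_target.mem_nhds (eN.map_source hpN),
      heNsymm.eventually (e.open_source.mem_nhds hpe)] with y hy hyN
    rw [hj, hk, Function.comp_apply, Function.comp_apply, e.left_inv hyN, eN.right_inv hy]
  set Q : E → E × ℝ := fun y => (v y, f y) with hQ
  have hQc : ContDiffAt ℝ 1 Q (e p) := (hvd _ hpO).prodMk (h.contDiff.of_le (by norm_num)).contDiffAt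
  have hQd : ∀ u, fderiv ℝ Q (e p) u = (fderiv ℝ v (e p) u, fderiv ℝ f (e p) u) := fun u => by
    have h1 := ((hvd _ hpO).differentiableAt (by norm_num)).hasFDerivAt.prodMk
      (h.contDiff.differentiable (by norm_num) (e p)).hasFDerivAt
    rw [show fderiv ℝ Q (e p) = _ from h1.fderiv]; rfl
  have hkL : k (e p) ∈ L := by rw [hkp]; exact (hL p hpN).1 hN.mem
  -- On N the Casimirs are locally constant because N lies in the leaf, and H is constant because N
  -- lies in the energy surface.
  have hQL : ∀ᶠ z in 𝓝 (k (e p)), z ∈ L → Q (j z) = Q (e p) := by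
    rw [hkp]
    filter_upwards [eN.open_target.mem_nhds (eN.map_source hpN), heNsymm.eventually hvN,
      heNsymm.eventually ((e.open_source.mem_nhds hpe)),
      heNsymm.eventually ((e.continuousAt hpe).eventually (h.isOpen.mem_nhds hpV))]
      with z hz hzv hze hzV hzL
    have hzN : eN.symm z ∈ N := (hL _ (eN.map_target hz)).2 (by rwa [eN.right_inv hz])
    have h1 : f (e (eN.symm z)) = f (e p) := by
      rw [hfH _ hzV, hfH _ hpV, e.left_inv hze, hinv, hHN _ hzN]
    exact Prod.ext (hzv hzN) h1
  have hdf : ∀ w, fderiv ℝ f (e p) (chartDeriv e p w) = dE H p w := fun w => by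
    have h1 : (dE H p : E →L[ℝ] ℝ) = (fderiv ℝ (H ∘ e.symm) (e p)).comp (chartDeriv e p) :=
      dAt_eq_comp he1 hpe ((hH p).mdifferentiableAt (by norm_num))
    have h2 : f =ᶠ[𝓝 (e p)] H ∘ e.symm := by
      filter_upwards [h.isOpen.mem_nhds hpV] with y hy using h.eqOn hy
    rw [h1, h2.fderiv_eq]; rfl
  -- The kernel of dQ is im ♯ ∩ ker dH read in the chart, which transversality splits into T_p N and
  -- the line of X_H.
  have hker : ∀ u, fderiv ℝ Q (e p) u = 0 → ∃ a : ℝ,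
      fderiv ℝ k (e p) (u - a • hamField (π.tensor e) f (e p)) ∈ L := by
    intro u hu
    rw [hQd, Prod.mk_eq_zero] at hu
    obtain ⟨ξ, hξ⟩ := (hvker _ hpO u).1 hu.1
    have hξ' : chartDeriv e p (π.sharpE p (ξ.comp (chartDeriv e p))) = u :=
      (π.tensor_apply hpe ξ).symm.trans hξ
    set w := π.sharpE p (ξ.comp (chartDeriv e p)) with hw
    have hw1 : w ∈ tangentE N p ⊔ Submodule.span ℝ {π.hamE H p} := by
      rw [hN.sup_eqE]
      refine ⟨⟨_, rfl⟩, ?_⟩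
      have h1 := hdf w
      rw [hξ', hu.2] at h1
      exact h1.symm
    obtain ⟨t, ht, w', hw', htw⟩ := Submodule.mem_sup.1 hw1
    obtain ⟨a, rfl⟩ := Submodule.mem_span_singleton.1 hw'
    refine ⟨a, ?_⟩
    have h1 : u - a • hamField (π.tensor e) f (e p) = chartDeriv e p t := by
      rw [hX0, ← hξ', ← htw, map_add, map_smul, add_sub_cancel_right]
    rw [h1, hkd, chartDerivSymm_apply he1 hpe]
    rw [htan] at ht
    exact ht
  have hX : fderiv ℝ k (e p) (hamField (π.tensor e) f (e p)) ∉ L := by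
    rw [hX0, hkd, chartDerivSymm_apply he1 hpe]
    intro hmem
    have h1 : π.hamE H p ∈ tangentE N p := by rw [htan]; exact hmem
    exact hp0 (Submodule.disjoint_def.1 hN.disjointE _ h1 (Submodule.mem_span_singleton_self _))
  have hΦc := h.contDiff_flow
  have hΦ0 := h.isFlow.zero (e p)
  have hQΦ : ∀ᶠ q : ℝ × E in 𝓝 (0, e p), Q (Φ q.1 q.2) = Q q.2 := by
    have h1 : ∀ᶠ q : ℝ × E in 𝓝 (0, e p), Φ q.1 q.2 ∈ O :=
      hΦc.continuous.continuousAt.eventually_mem (hO.mem_nhds (by simpa only [hΦ0] using hpO))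
    obtain ⟨ε, hε, hεO⟩ := Metric.eventually_nhds_iff.1 h1
    filter_upwards [Metric.ball_mem_nhds (0, e p) hε] with q hq
    rw [Metric.mem_ball, Prod.dist_eq, max_lt_iff] at hq
    have hq1 : |q.1| < ε := by simpa [Real.dist_eq] using hq.1
    refine Prod.ext ?_ ?_
    · have h2 := h.isFlow.apply_eq_of_forall_fderiv_eq_zero (v := v) (O := O)
        (fun y hy => (hvd y hy).differentiableAt (by norm_num))
        (fun y hy ξ => (hvker y hy _).2 ⟨ξ, rfl⟩) (y := q.2) (convex_ball (0 : ℝ) ε) (fun r hr =>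
          hεO (y := (r, q.2)) (by
            rw [Prod.dist_eq, max_lt_iff]
            exact ⟨hr, hq.2⟩)) (a := 0) (b := q.1) (Metric.mem_ball_self hε)
          (by rwa [mem_ball_zero_iff, Real.norm_eq_abs])
      rw [h.isFlow.zero] at h2
      exact h2
    · exact h.isLocalPoisson.apply_flow h.contDiff h.tsupport_subset h.isFlow q.2 q.1
  obtain ⟨s, hs, hs0, hsL, hsd⟩ := exists_flow_section hΦc (h.hasFDerivAt_flow (e p)) hΦ0 hkc hjc
    hjk hkj hQc hkL hQL hker hX hQΦ
  refine ⟨O ∩ V, v, s, hO.inter h.isOpen, ⟨hpO, hpV⟩, inter_subset_right,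
    fun y hy => (hvd y hy.1).differentiableAt (by norm_num),
    fun y hy ξ => (hvker y hy.1 _).2 ⟨ξ, rfl⟩, hs, hs0, hvN, ?_, fun u hu => hsd _ ?_⟩
  · have h1 : Tendsto (fun z => e.symm (Φ (-s z) z)) (𝓝 (e p)) (𝓝 p) := by
      refine hesymm.comp ?_
      have h2 : ContinuousAt (fun z => Φ (-s z) z) (e p) :=
        hΦc.continuous.continuousAt.comp (f := fun z => (-s z, z))
          (hs.continuousAt.neg.prodMk continuousAt_id)
      rw [ContinuousAt, hs0, neg_zero, hΦ0] at h2
      exact h2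
    filter_upwards [hsL, h1.eventually (eN.open_source.mem_nhds hpN)] with z hz hzN hzv hzf
    exact (hL _ hzN).2 (hz (Prod.ext hzv hzf))
  · rw [hkd, chartDerivSymm_apply he1 hpe]
    rw [htan] at hu
    exact hu

end LocalSection

/-! ### Going forward with one flow and back with another. -/

section ReturnMap

open Filter

section Vector

variable {F : Type*} [NormedAddCommGroup F] [NormedSpace ℝ F] [FiniteDimensional ℝ F]
  {Ω : Set F} {B : F → (F →L[ℝ] ℝ) →L[ℝ] F} {f f' : F → ℝ} {Φ Φ' : ℝ → F → F} {y₀ : F}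

/-- The tube lemma, used to keep whole families of orbits inside an open set. -/
lemma eventually_forall_mem {G : Type*} [TopologicalSpace G] {Y : Type*} [TopologicalSpace Y]
    {g : Y × G → F} (hg : Continuous g) {K : Set Y} (hK : IsCompact K)
    {x₀ : G} {O : Set F} (hO : ∀ t ∈ K, O ∈ 𝓝 (g (t, x₀))) :
    ∀ᶠ x in 𝓝 x₀, ∀ t ∈ K, g (t, x) ∈ O := by
  refine hK.eventually_forall_of_forall_eventually fun t ht => ?_
  have h1 : ContinuousAt (fun z : G × Y => g (z.2, z.1)) (x₀, t) :=
    (hg.comp (continuous_snd.prodMk continuous_fst)).continuousAt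
  exact h1.eventually (hO t ht)

lemma eventually_flow_neg_flow_mem (hΦ : Continuous fun q : ℝ × F => Φ q.1 q.2)
    (hΦ' : Continuous fun q : ℝ × F => Φ' q.1 q.2) {c : ℝ}
    (h : ∀ t ∈ Icc 0 c, Φ (-t) (Φ' t y₀) = y₀) {O : Set F} (hO : O ∈ 𝓝 y₀) :
    ∀ᶠ y in 𝓝 y₀, ∀ t ∈ Icc 0 c, Φ (-t) (Φ' t y) ∈ O := by
  refine eventually_forall_mem (g := fun q : ℝ × F => Φ (-q.1) (Φ' q.1 q.2)) ?_ isCompact_Icc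
    fun t ht => by simpa only [h t ht] using hO
  exact hΦ.comp (continuous_fst.neg.prodMk hΦ')

/-- Following a Hamiltonian flow forward and another one backward preserves the common first
integrals of all Hamiltonian vector fields. -/
lemma eventually_apply_flow_neg_flow_eq (hΦ : Continuous fun q : ℝ × F => Φ q.1 q.2)
    (hΦ' : Continuous fun q : ℝ × F => Φ' q.1 q.2) (hf : IsFlow (hamField B f) Φ)
    (hf' : IsFlow (hamField B f') Φ') (hadd : ∀ s t y, Φ (s + t) y = Φ s (Φ t y)) {v : F → F}
    {O : Set F} (hO : IsOpen O) (hv : ∀ y ∈ O, DifferentiableAt ℝ v y)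
    (hk : ∀ y ∈ O, ∀ ξ, fderiv ℝ v y (B y ξ) = 0) {c : ℝ}
    (heq : ∀ t ∈ Icc 0 c, Φ' t y₀ = Φ t y₀) (hcO : ∀ t ∈ Icc 0 c, Φ t y₀ ∈ O) :
    ∀ᶠ y in 𝓝 y₀, ∀ t ∈ Icc 0 c, v (Φ (-t) (Φ' t y)) = v y := by
  have h1 : ∀ᶠ y in 𝓝 y₀, ∀ t ∈ Icc 0 c, Φ' t y ∈ O :=
    eventually_forall_mem (g := fun q : ℝ × F => Φ' q.1 q.2) hΦ' isCompact_Icc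
      fun t ht => hO.mem_nhds (by simpa only [heq t ht] using hcO t ht)
  -- Pairs (t, t') with t' ≤ t: the backward path from the point reached at time t must stay in O at
  -- every intermediate time t', not only at its end.
  have hK : IsCompact ((Icc 0 c ×ˢ Icc 0 c) ∩ {q : ℝ × ℝ | q.2 ≤ q.1}) :=
    (isCompact_Icc.prod isCompact_Icc).inter_right (isClosed_le continuous_snd continuous_fst)
  have h2 := eventually_forall_mem (g := fun q : (ℝ × ℝ) × F => Φ (-q.1.2) (Φ' q.1.1 q.2))
    (hΦ.comp ((continuous_snd.comp continuous_fst).neg.prodMk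
      (hΦ'.comp ((continuous_fst.comp continuous_fst).prodMk continuous_snd)))) hK (x₀ := y₀)
    (O := O) (fun q hq => hO.mem_nhds (by
      obtain ⟨⟨hq1, hq2⟩, hq3⟩ := hq
      simp only [heq q.1 hq1, ← hadd]
      exact hcO _ ⟨by linarith [show q.2 ≤ q.1 from hq3], by linarith [hq1.2, hq2.1]⟩))
  filter_upwards [h1, h2] with y h1 h2 t ht
  have h3 := hf'.apply_eq_of_forall_fderiv_eq_zero hv hk (y := y) (convex_Icc 0 c) h1 (a := 0)
    (b := t) ⟨le_rfl, ht.1.trans ht.2⟩ ht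
  rw [hf'.zero] at h3
  have h4 := hf.apply_eq_of_forall_fderiv_eq_zero hv hk (y := Φ' t y) (convex_Icc (-t) 0)
    (fun r hr => by
      have := h2 (t, -r) ⟨⟨ht, by linarith [hr.2], by linarith [hr.1, ht.2]⟩, by
        show -r ≤ t
        linarith [hr.1]⟩
      simpa only [neg_neg] using this) (a := 0) (b := -t) ⟨by linarith [ht.1], le_rfl⟩
    ⟨le_rfl, by linarith [ht.1]⟩
  rw [hf.zero] at h4
  rw [h4, h3]

/-- The derivative of the return map. -/
lemma IsLocalPoisson.hasFDerivAt_return {d : ℕ} (hB : IsLocalPoisson Ω B) (hf : ContDiff ℝ 2 f)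
    (hfc : HasCompactSupport f) (hfΩ : tsupport f ⊆ Ω)
    (hΦ : IsFlow (hamField B f) Φ) (hΦ'c : ContDiff ℝ 1 fun q : ℝ × F => Φ' q.1 q.2)
    (hΦd : HasFDerivAt (fun q : ℝ × F => Φ q.1 q.2)
      ((ContinuousLinearMap.fst ℝ ℝ F).smulRight (hamField B f y₀) +
        ContinuousLinearMap.snd ℝ ℝ F) (0, y₀)) {c : ℝ} (heq : Φ' c y₀ = Φ c y₀)
    {s : F → ℝ} (hs : ContDiffAt ℝ 1 s y₀) (hs0 : s y₀ = 0) {b : Fin d ⊕ Fin d → F}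
    (hsb : ∀ i, fderiv ℝ s y₀ (b i) = 0) {Q : SqMatrix d}
    (hQ : ∀ k, fderiv ℝ (Φ' c) y₀ (b k) = ∑ j, Q j k • fderiv ℝ (Φ c) y₀ (b j)) :
    ∃ D : F →L[ℝ] F, (∀ k, D (b k) = ∑ j, Q j k • b j) ∧
      HasFDerivAt (fun y => Φ (-s (Φ (-c) (Φ' c y))) (Φ (-c) (Φ' c y))) D y₀ := by
  have hΦt : ∀ t, ContDiff ℝ 1 (Φ t) := fun t =>
    hΦ.contDiff_apply (hB.contDiff_hamField hf hfΩ) (hasCompactSupport_hamField hfc) t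
  have hΦ't : ContDiff ℝ 1 (Φ' c) := hΦ'c.comp (contDiff_prodMk_right c)
  have hz0 : Φ (-c) (Φ' c y₀) = y₀ := by
    rw [heq, ← hB.flow_add hf hfc hfΩ hΦ, neg_add_cancel, hΦ.zero]
  set Dz : F →L[ℝ] F := (fderiv ℝ (Φ (-c)) (Φ c y₀)).comp (fderiv ℝ (Φ' c) y₀) with hDz
  have hz : HasFDerivAt (fun y => Φ (-c) (Φ' c y)) Dz y₀ := by
    have h1 : HasFDerivAt (Φ (-c)) (fderiv ℝ (Φ (-c)) (Φ c y₀)) (Φ' c y₀) := by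
      rw [heq]; exact ((hΦt _).differentiable (by norm_num) _).hasFDerivAt
    exact h1.comp y₀ (hΦ't.differentiable (by norm_num) _).hasFDerivAt
  have hDzb : ∀ k, Dz (b k) = ∑ j, Q j k • b j := fun k => by
    rw [hDz, ContinuousLinearMap.comp_apply, hQ, map_sum]
    refine Finset.sum_congr rfl fun j _ => ?_
    rw [map_smul]
    exact congrArg (fun A : F →L[ℝ] F => Q j k • A (b j))
      (hB.fderiv_flow_comp hf hfc hfΩ hΦ y₀ c)
  have hsd : HasFDerivAt (fun y => s (Φ (-c) (Φ' c y))) ((fderiv ℝ s y₀).comp Dz) y₀ := by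
    have h1 : HasFDerivAt s (fderiv ℝ s y₀) (Φ (-c) (Φ' c y₀)) := by
      rw [hz0]; exact (hs.differentiableAt (by norm_num)).hasFDerivAt
    exact h1.comp y₀ hz
  refine ⟨((ContinuousLinearMap.fst ℝ ℝ F).smulRight (hamField B f y₀) +
        ContinuousLinearMap.snd ℝ ℝ F).comp ((-((fderiv ℝ s y₀).comp Dz)).prod Dz),
    fun k => ?_, ?_⟩
  · have h1 : fderiv ℝ s y₀ (Dz (b k)) = 0 := by
      rw [hDzb, map_sum]
      exact Finset.sum_eq_zero fun j _ => by rw [map_smul, hsb, smul_zero]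
    rw [← hDzb]
    simp [h1]
  · have h1 : HasFDerivAt (fun q : ℝ × F => Φ q.1 q.2)
      ((ContinuousLinearMap.fst ℝ ℝ F).smulRight (hamField B f y₀) +
        ContinuousLinearMap.snd ℝ ℝ F) (-s (Φ (-c) (Φ' c y₀)), Φ (-c) (Φ' c y₀)) := by
      rw [hz0, hs0, neg_zero]; exact hΦd
    exact h1.comp (f := fun y => (-s (Φ (-c) (Φ' c y)), Φ (-c) (Φ' c y))) y₀ (hsd.neg.prodMk hz)

end Vector

variable {E : Type*} [NormedAddCommGroup E] [NormedSpace ℝ E] [FiniteDimensional ℝ E]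
  {M : Type*} [TopologicalSpace M] [ChartedSpace E M] [T2Space M] [IsManifold 𝓘(ℝ, E) ∞ M]
  {π : PoissonStructure E M} {H : M → ℝ} {e : OpenPartialHomeomorph M E} {f g : E → ℝ} {V : Set E}
  {Φ : ℝ → E → E}

lemma PoissonStructure.hamVF_add_liftFun (hH : ContMDiff 𝓘(ℝ, E) 𝓘(ℝ, ℝ) 2 H)
    (he : e ∈ IsManifold.maximalAtlas 𝓘(ℝ, E) ∞ M) (hg : ContDiff ℝ 2 g)
    (hgc : HasCompactSupport g) (hge : tsupport g ⊆ e.target) {x : M}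
    (hx : x ∈ e.symm '' tsupport g → fderiv ℝ g (e x) = 0) :
    π.hamVF (fun x => H x + liftFun e g x) x = π.hamVF H x := by
  have := isManifold_one (E := E) (M := M)
  have := isManifold_two (E := E) (M := M)
  suffices h : dAt (E := E) (fun x => H x + liftFun e g x) x = dAt (E := E) H x by
    rw [PoissonStructure.hamVF, h]; rfl
  have he1 := mem_maximalAtlas_one he
  have he2 : e ∈ IsManifold.maximalAtlas 𝓘(ℝ, E) 2 M :=
    IsManifold.maximalAtlas_subset_of_le (by norm_cast) he
  by_cases hxs : x ∈ e.symm '' tsupport g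
  · have hxe : x ∈ e.source := by
      obtain ⟨y, hy, rfl⟩ := hxs
      exact e.map_target (hge hy)
    have hlift := contMDiff_liftFun he2 hg hgc hge
    have h1 := dAt_eq_comp he1 hxe
      (((hH.add hlift) x).mdifferentiableAt (by norm_num))
    have h2 := dAt_eq_comp he1 hxe ((hH x).mdifferentiableAt (by norm_num))
    have h3 : ((H + liftFun e g) ∘ e.symm) =ᶠ[𝓝 (e x)] fun y => (H ∘ e.symm) y + g y := by
      filter_upwards [e.open_target.mem_nhds (e.map_source hxe)] with y hy
      have := liftFun_comp_symm (e := e) g hy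
      simp only [Function.comp_apply] at this
      simp [this]
    have h4 : fderiv ℝ ((H + liftFun e g) ∘ e.symm) (e x) = fderiv ℝ (H ∘ e.symm) (e x) := by
      rw [h3.fderiv_eq, fderiv_fun_add, hx hxs, add_zero]
      · exact ((contDiffOn_comp_symm he2 hH).contDiffAt
          (e.open_target.mem_nhds (e.map_source hxe))).differentiableAt (by norm_num)
      · exact hg.differentiable (by norm_num) _
    rw [h4] at h1
    exact h1.trans h2.symm
  · have h1 : (fun x => H x + liftFun e g x) =ᶠ[𝓝 x] H := by
      filter_upwards [liftFun_eventuallyEq_zero hgc hge hxs] with y hy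
      simp [hy]
    exact h1.mfderiv_eq

/-- The Hamiltonian is constant along the orbits. -/
lemma PoissonStructure.apply_eq_of_isMIntegralCurveOn (hH : ContMDiff 𝓘(ℝ, E) 𝓘(ℝ, ℝ) 2 H)
    {γ : ℝ → M} {a b : ℝ} (hγ : IsMIntegralCurveOn γ (π.hamVF H) (Icc a b)) {s t : ℝ}
    (hs : s ∈ Icc a b) (ht : t ∈ Icc a b) : H (γ s) = H (γ t) := by
  have hd : ∀ r ∈ Icc a b, HasDerivWithinAt (H ∘ γ) 0 (Icc a b) r := fun r hr => by
    have h1 := (((hH (γ r)).mdifferentiableAt (by norm_num)).hasMFDerivAt.comp_hasMFDerivWithinAt r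
      (hγ r hr)).hasFDerivWithinAt
    have h2 : HasFDerivWithinAt (H ∘ γ) ((dE H (γ r)).comp
      ((1 : ℝ →L[ℝ] ℝ).smulRight (π.hamE H (γ r)))) (Icc a b) r := h1
    have h3 := h2.hasDerivWithinAt
    have h4 : dE H (γ r) (π.hamE H (γ r)) = 0 := by
      have := π.skewE (γ r) (dE H (γ r)) (dE H (γ r))
      rw [π.hamE_eq]
      linarith
    simpa [h4] using h3
  have h1 := (convex_Icc a b).norm_image_sub_le_of_norm_hasDerivWithin_le (C := 0) hd
    (fun _ _ => by simp) ht hs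
  rw [zero_mul] at h1
  exact sub_eq_zero.1 (norm_le_zero_iff.1 h1)

lemma PoissonStructure.ChartFlow.eq_symm_flow (h : π.ChartFlow H e f V Φ)
    (hH : ContMDiff 𝓘(ℝ, E) 𝓘(ℝ, ℝ) 2 H) {c : ℝ → M} {b : ℝ} {y : E}
    (hc : IsMIntegralCurveOn c (π.hamVF H) (Icc 0 b)) (hc0 : c 0 = e.symm y)
    (hy : ∀ r ∈ Icc 0 b, Φ r y ∈ V) : ∀ r ∈ Icc 0 b, c r = e.symm (Φ r y) := by
  have h1 := h.isMIntegralCurveOn hH (s := Icc 0 b) (a := 0) (y := y) (fun t ht => by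
    rw [sub_zero]; exact hy t ht)
  have h2 := PoissonStructure.eqOn_of_isMIntegralCurveOn hH hc h1
    (by simp only [sub_zero, h.isFlow.zero, hc0])
  intro r hr
  simpa only [sub_zero] using h2 hr

/-- The orbits of the points near `p` of a transversal in a chart. -/
lemma PoissonStructure.ChartFlow.eventually_orbit_eq (h : π.ChartFlow H e f V Φ)
    (hH : ContMDiff 𝓘(ℝ, E) 𝓘(ℝ, ℝ) 2 H) {p : M} (hpe : p ∈ e.source) {N U : Set M} (hU : U ∈ 𝓝 p)
    {τ : M → ℝ} (hτ : ContinuousWithinAt τ N p) {s : E → ℝ} (hs : ContinuousAt s (e p))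
    (hs0 : s (e p) = 0) {a c : ℝ} (ha : 0 < a) (hcτ : c < τ p)
    (hcV : ∀ t ∈ Icc 0 c, Φ t (e p) ∈ V) :
    ∀ᶠ z in 𝓝 (e p), e.symm (Φ (-s z) z) ∈ N → e.symm (Φ (-s z) z) ∈ U ∧ ∀ t ∈ Icc a c,
      0 < t + s z ∧ t + s z < τ (e.symm (Φ (-s z) z)) ∧ ∀ c' : ℝ → M,
        IsMIntegralCurveOn c' (π.hamVF H) (Icc 0 (τ (e.symm (Φ (-s z) z)))) →
        c' 0 = e.symm (Φ (-s z) z) → c' (t + s z) = e.symm (Φ t z) := by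
  have hinv : e.symm (e p) = p := e.left_inv hpe
  have hpt := e.map_source hpe
  have hρ : Tendsto (fun z => Φ (-s z) z) (𝓝 (e p)) (𝓝 (e p)) := by
    have h2 : ContinuousAt (fun z => Φ (-s z) z) (e p) :=
      h.contDiff_flow.continuous.continuousAt.comp (f := fun z => (-s z, z))
        (hs.neg.prodMk continuousAt_id)
    rw [ContinuousAt, hs0, neg_zero, h.isFlow.zero] at h2
    exact h2
  have hσ : Tendsto (fun z => e.symm (Φ (-s z) z)) (𝓝 (e p)) (𝓝 p) := by
    have := e.continuousAt_symm hpt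
    rw [ContinuousAt, hinv] at this
    exact this.comp hρ
  have hτ' : ∀ᶠ x in 𝓝 p, x ∈ N → (c + τ p) / 2 < τ x :=
    eventually_nhdsWithin_iff.1 (hτ.eventually (lt_mem_nhds (by linarith)))
  -- For |s z| < r and t in [a, c], the shifted time t + s z is positive and below (c + τ p) / 2,
  -- hence below the transition times of nearby points of N.
  set r : ℝ := min a ((τ p - c) / 2) with hr
  have hr0 : 0 < r := lt_min ha (by linarith)
  have hsr : ∀ᶠ z in 𝓝 (e p), |s z| < r := by
    have := hs.abs.tendsto
    rw [hs0, abs_zero] at this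
    exact this.eventually (gt_mem_nhds hr0)
  -- The interval [0, t + s] varies with s; rescaling it by [0, 1] gives a fixed compact parameter
  -- set.
  have hV : ∀ᶠ q : ℝ × E in 𝓝 (0, e p), ∀ l ∈ Icc (0 : ℝ) 1 ×ˢ Icc 0 c,
      Φ (l.1 * (l.2 + q.1)) q.2 ∈ V := by
    refine eventually_forall_mem (g := fun w : (ℝ × ℝ) × (ℝ × E) =>
      Φ (w.1.1 * (w.1.2 + w.2.1)) w.2.2) ?_ (isCompact_Icc.prod isCompact_Icc) fun l hl => ?_
    · exact h.contDiff_flow.continuous.comp (f := fun w : (ℝ × ℝ) × (ℝ × E) =>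
        (w.1.1 * (w.1.2 + w.2.1), w.2.2)) (by fun_prop)
    · refine h.isOpen.mem_nhds ?_
      simp only [add_zero]
      exact hcV _ ⟨mul_nonneg hl.1.1 hl.2.1,
        (mul_le_of_le_one_left hl.2.1 hl.1.2).trans hl.2.2⟩
  have hV' : ∀ᶠ z in 𝓝 (e p), ∀ l ∈ Icc (0 : ℝ) 1 ×ˢ Icc 0 c,
      Φ (l.1 * (l.2 + s z)) (Φ (-s z) z) ∈ V := by
    have h1 : Tendsto (fun z => (s z, Φ (-s z) z)) (𝓝 (e p)) (𝓝 (0, e p)) := by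
      rw [nhds_prod_eq]
      have h2 := hs.tendsto
      rw [hs0] at h2
      exact h2.prodMk hρ
    exact h1.eventually hV
  filter_upwards [hσ.eventually hU, hσ.eventually hτ', hsr, hV'] with z hzU hzτ hzs hzV hzN
  refine ⟨hzU, fun t ht => ?_⟩
  have h1 := abs_lt.1 hzs
  have h2 := min_le_left a ((τ p - c) / 2)
  have h3 := min_le_right a ((τ p - c) / 2)
  have h4 := hzτ hzN
  have ht0 : 0 < t + s z := by linarith [ht.1]
  have htτ : t + s z < τ (e.symm (Φ (-s z) z)) := by linarith [ht.2]
  refine ⟨ht0, htτ, fun c' hc' hc'0 => ?_⟩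
  have h5 := h.eq_symm_flow hH (b := t + s z) (hc'.mono (Icc_subset_Icc_right htτ.le)) hc'0
    (fun r hr => by
      have := hzV (r / (t + s z), t) ⟨⟨div_nonneg hr.1 ht0.le, (div_le_one ht0).2 hr.2⟩,
        ha.le.trans ht.1, ht.2⟩
      simpa only [div_mul_cancel₀ _ ht0.ne'] using this) (t + s z) ⟨ht0.le, le_rfl⟩
  rw [h5, ← h.flow_add, add_neg_cancel_right]

/-- The points of an orbit before the first hitting time are pairwise distinct. -/
lemma PoissonStructure.ne_of_first_hit (hH : ContMDiff 𝓘(ℝ, E) 𝓘(ℝ, ℝ) 2 H) {γ : ℝ → M} {T : ℝ}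
    (hγ : IsMIntegralCurveOn γ (π.hamVF H) (Icc 0 T)) {N' : Set M} (hT : γ T ∈ N')
    (hfirst : ∀ t ∈ Ioo 0 T, γ t ∉ N') {s t : ℝ} (hs : s ∈ Ioo 0 T) (ht : t ∈ Icc 0 T)
    (hst : s ≠ t) : γ s ≠ γ t := by
  -- If γ a = γ b, moving both by T - b gives γ (a + T - b) = γ T, a visit to N' strictly before T.
  -- The last condition excludes only a = 0 and b = T, so a closed orbit is allowed.
  have key : ∀ a b : ℝ, 0 ≤ a → a < b → b ≤ T → 0 < a + (T - b) → γ a ≠ γ b := by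
    intro a b ha hab hbT hpos heq
    have h1 : IsMIntegralCurveOn (γ ∘ (· + a)) (π.hamVF H) (Icc 0 (T - b)) :=
      (hγ.comp_add a).mono fun r hr => ⟨by linarith [hr.1], by linarith [hr.2]⟩
    have h2 : IsMIntegralCurveOn (γ ∘ (· + b)) (π.hamVF H) (Icc 0 (T - b)) :=
      (hγ.comp_add b).mono fun r hr => ⟨by linarith [hr.1], by linarith [hr.2]⟩
    have h3 := PoissonStructure.eqOn_of_isMIntegralCurveOn hH h1 h2 (by simpa using heq)
      (show T - b ∈ Icc 0 (T - b) from ⟨by linarith, le_rfl⟩)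
    simp only [Function.comp_apply, sub_add_cancel] at h3
    exact hfirst (T - b + a) ⟨by linarith, by linarith⟩ (by rw [h3]; exact hT)
  rcases lt_or_gt_of_ne hst with hlt | hlt
  · exact key s t hs.1.le hlt ht.2 (by linarith [hs.1, ht.2])
  · exact (key t s ht.1 hlt hs.2.le (by linarith [hs.2, ht.1])).symm

end ReturnMap

/-! ### The perturbed Poincaré map as old map after return map. -/

section PerturbedMap

open Filter

variable {E : Type*} [NormedAddCommGroup E] [NormedSpace ℝ E] [FiniteDimensional ℝ E]
  {M : Type*} [TopologicalSpace M] [ChartedSpace E M] [T2Space M] [IsManifold 𝓘(ℝ, E) ∞ M]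
  {π : PoissonStructure E M} {H : M → ℝ} {e : OpenPartialHomeomorph M E} {f g : E → ℝ} {V : Set E}
  {Φ : ℝ → E → E}

lemma contMDiff_add_liftFun (hH : ContMDiff 𝓘(ℝ, E) 𝓘(ℝ, ℝ) 2 H)
    (he : e ∈ IsManifold.maximalAtlas 𝓘(ℝ, E) ∞ M) (hg : ContDiff ℝ 2 g)
    (hgc : HasCompactSupport g) (hge : tsupport g ⊆ e.target) :
    ContMDiff 𝓘(ℝ, E) 𝓘(ℝ, ℝ) 2 (fun x => H x + liftFun e g x) := by
  have := isManifold_two (E := E) (M := M)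
  exact hH.add (contMDiff_liftFun (IsManifold.maximalAtlas_subset_of_le (by norm_cast) he) hg hgc hge)

lemma PoissonStructure.ChartFlow.add (h : π.ChartFlow H e f V Φ) (hg : ContDiff ℝ 2 g)
    (hgc : HasCompactSupport g) (hge : tsupport g ⊆ e.target) {Φ' : ℝ → E → E}
    (hΦ' : IsFlow (hamField (π.tensor e) fun y => f y + g y) Φ') :
    π.ChartFlow (fun x => H x + liftFun e g x) e (fun y => f y + g y) V Φ' where
  mem_atlas := h.mem_atlas
  contDiff := h.contDiff.add hg
  hasCompactSupport := h.hasCompactSupport.add hgc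
  tsupport_subset := (tsupport_add f g).trans (union_subset h.tsupport_subset hge)
  isOpen := h.isOpen
  subset := h.subset
  eqOn := fun y hy => by
    have h1 := liftFun_comp_symm (e := e) g (h.subset hy)
    have h2 := h.eqOn hy
    simp only [Function.comp_apply] at h1 h2 ⊢
    rw [h1, h2]
  isFlow := hΦ'

/-- The Poincaré map of a Hamiltonian perturbed near a piece of an orbit is the composition of the
old Poincaré map with a return map of the first transversal to itself. -/
theorem IsPoincareMap.comp_return (hH : ContMDiff 𝓘(ℝ, E) 𝓘(ℝ, ℝ) 2 H) {T : ℝ} (hT : 0 < T)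
    {γ : ℝ → M} (hγ : IsMIntegralCurveOn γ (π.hamVF H) (Icc 0 T)) {N N' : Set M}
    (hpN : γ 0 ∈ N) (hHN : ∀ x ∈ N, H x = H (γ 0)) (hHN' : ∀ x ∈ N', H x = H (γ T)) {P : M → M}
    (hP : IsPoincareMap π H N N' (γ 0) (γ T) T P) (h : π.ChartFlow H e f V Φ)
    (hpe : γ 0 ∈ e.source) {O : Set E} {v : E → E} {s : E → ℝ} (hO : IsOpen O) (hOV : O ⊆ V)
    (hv : ∀ y ∈ O, DifferentiableAt ℝ v y) (hk : ∀ y ∈ O, ∀ ξ, fderiv ℝ v y (π.tensor e y ξ) = 0)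
    (hs : ContDiffAt ℝ 1 s (e (γ 0))) (hs0 : s (e (γ 0)) = 0)
    (hvN : ∀ᶠ x in 𝓝 (γ 0), x ∈ N → v (e x) = v (e (γ 0)))
    (hsec : ∀ᶠ z in 𝓝 (e (γ 0)), v z = v (e (γ 0)) → f z = f (e (γ 0)) →
      e.symm (Φ (-s z) z) ∈ N)
    (hg : ContDiff ℝ 2 g) (hgc : HasCompactSupport g) (hge : tsupport g ⊆ e.target) {Φ' : ℝ → E → E}
    (hΦ' : IsFlow (hamField (π.tensor e) fun y => f y + g y) Φ') {a c₀ c : ℝ} (ha : 0 < a)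
    (hac : a < c) (hc₀ : c₀ < c) (hcT : c < T) (hcO : ∀ t ∈ Icc 0 c, Φ t (e (γ 0)) ∈ O)
    (hdg : ∀ t ∈ Icc 0 c, fderiv ℝ g (Φ t (e (γ 0))) = 0)
    (hga : ∀ t ∈ Icc 0 a, Φ t (e (γ 0)) ∉ tsupport g)
    (hgT : ∀ t ∈ Icc c₀ T, γ t ∉ e.symm '' tsupport g) :
    (∀ᶠ x in 𝓝 (γ 0), x ∈ N →
      e.symm (Φ (-s (Φ (-c) (Φ' c (e x)))) (Φ (-c) (Φ' c (e x)))) ∈ N) ∧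
    IsPoincareMap π (fun x => H x + liftFun e g x) N N' (γ 0) (γ T) T
      (fun x => P (e.symm (Φ (-s (Φ (-c) (Φ' c (e x)))) (Φ (-c) (Φ' c (e x)))))) := by
  have hM := isManifold_one (E := E) (M := M)
  obtain ⟨hPp, U, hU, τ, hτT, hτC, hτ⟩ := hP
  set y₀ := e (γ 0) with hy₀
  have he1 := mem_maximalAtlas_one h.mem_atlas
  have hpt : y₀ ∈ e.target := e.map_source hpe
  have hinv : e.symm y₀ = γ 0 := e.left_inv hpe
  have hpU : γ 0 ∈ N ∩ U := ⟨hpN, mem_of_mem_nhds hU⟩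
  have hτcont : ContinuousWithinAt τ N (γ 0) :=
    (continuousWithinAt_inter hU).1 (hτC _ hpU).continuousWithinAt
  have h' := h.add hg hgc hge hΦ'
  have hH' := contMDiff_add_liftFun hH h.mem_atlas hg hgc hge
  have hB := h.isLocalPoisson
  have hc0 : 0 ≤ c := (ha.trans hac).le
  have heq : ∀ t ∈ Icc 0 c, Φ' t y₀ = Φ t y₀ := fun t ht =>
    hB.flow_eq_of_fderiv_eq_zero h.contDiff h'.contDiff h'.hasCompactSupport h'.tsupport_subset hg
      (fun _ => rfl) h.isFlow h'.isFlow hdg ht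
  have hΦc := h.contDiff_flow
  have hΦ'c := h'.contDiff_flow
  have hback : ∀ t y, Φ t (Φ (-t) y) = y := fun t y => by
    rw [← h.flow_add, add_neg_cancel, h.isFlow.zero]
  have hz₀ : ∀ t ∈ Icc 0 c, Φ (-t) (Φ' t y₀) = y₀ := fun t ht => by
    rw [heq t ht, ← h.flow_add, neg_add_cancel, h.isFlow.zero]
  set S : Set M := e.symm '' tsupport g with hS
  have hSc : IsClosed S := isClosed_symm_image hgc hge
  -- the orbits of the points near `γ 0` avoid the support after time `c₀`
  have havoid : ∀ᶠ x in 𝓝 (γ 0), x ∈ N → ∀ c' : ℝ → M,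
      IsMIntegralCurveOn c' (π.hamVF H) (Icc 0 (τ x)) → c' 0 = x →
        ∀ r ∈ Icc 0 (τ x), c₀ ≤ r → c' r ∉ S := by
    obtain ⟨T', hTT', γ', hγ'γ, hγ'⟩ := PoissonStructure.exists_extension hH hT.le hγ
    have h0 : γ' 0 = γ 0 := hγ'γ ⟨le_rfl, hT.le⟩
    have h1 := IsPoincareMap.eventually_orbit hH hT hTT' hγ' (N := N) (τ := τ)
      (by rw [h0]; exact hτcont) (by rw [h0]; exact hτT)
      ({q : ℝ × M | q.1 < c₀} ∪ {q : ℝ × M | q.2 ∈ Sᶜ})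
      ((isOpen_lt continuous_fst continuous_const).union (hSc.isOpen_compl.preimage continuous_snd))
      (fun r hr => by
        by_cases hrc : r < c₀
        · exact Or.inl hrc
        · refine Or.inr ?_
          show γ' r ∈ Sᶜ
          rw [hγ'γ hr]
          exact hgT r ⟨not_lt.1 hrc, hr.2⟩)
    rw [h0] at h1
    filter_upwards [eventually_nhdsWithin_iff.1 h1] with x hx hxN c' hc' hc'0 r hr hcr
    rcases hx hxN c' hc' hc'0 r hr with h2 | h2
    · exact absurd h2 (not_lt.2 hcr)
    · exact h2
  -- the projection along the flow
  have hρ : ContinuousAt (fun z => Φ (-s z) z) y₀ :=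
    hΦc.continuous.continuousAt.comp (f := fun z => (-s z, z))
      (hs.continuousAt.neg.prodMk continuousAt_id)
  have hρ0 : Φ (-s y₀) y₀ = y₀ := by rw [hs0, neg_zero, h.isFlow.zero]
  have hσ : Tendsto (fun z => e.symm (Φ (-s z) z)) (𝓝 y₀) (𝓝 (γ 0)) := by
    have h1 := e.continuousAt_symm hpt
    rw [ContinuousAt, hinv] at h1
    rw [ContinuousAt, hρ0] at hρ
    exact h1.comp hρ
  -- All requirements on a point z that is to be slid onto N. The bound c₀ - c < s z ensures that
  -- the old orbit, resumed at time c + s z, is already past c₀ and so avoids the support.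
  have hnear : ∀ᶠ z in 𝓝 y₀, (v z = v y₀ → f z = f y₀ → e.symm (Φ (-s z) z) ∈ N) ∧
      (e.symm (Φ (-s z) z) ∈ N → e.symm (Φ (-s z) z) ∈ U ∧ ∀ t ∈ Icc a c,
        0 < t + s z ∧ t + s z < τ (e.symm (Φ (-s z) z)) ∧ ∀ c' : ℝ → M,
          IsMIntegralCurveOn c' (π.hamVF H) (Icc 0 (τ (e.symm (Φ (-s z) z)))) →
          c' 0 = e.symm (Φ (-s z) z) → c' (t + s z) = e.symm (Φ t z)) ∧
      (e.symm (Φ (-s z) z) ∈ N → ∀ c' : ℝ → M,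
        IsMIntegralCurveOn c' (π.hamVF H) (Icc 0 (τ (e.symm (Φ (-s z) z)))) →
        c' 0 = e.symm (Φ (-s z) z) → ∀ r ∈ Icc 0 (τ (e.symm (Φ (-s z) z))), c₀ ≤ r → c' r ∉ S) ∧
      c₀ - c < s z ∧ ContDiffAt ℝ 1 s z ∧ Φ (-s z) z ∈ e.target := by
    have h1 := h.eventually_orbit_eq hH hpe hU hτcont hs.continuousAt hs0 (a := a) (c := c) ha
      (by rw [hτT]; exact hcT) (fun t ht => hOV (hcO t ht))
    have h2 : ∀ᶠ z in 𝓝 y₀, c₀ - c < s z :=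
      hs.continuousAt.eventually (lt_mem_nhds (by rw [hs0]; linarith))
    have h3 : ∀ᶠ z in 𝓝 y₀, Φ (-s z) z ∈ e.target :=
      hρ.eventually (e.open_target.mem_nhds (by simpa only [hρ0] using hpt))
    filter_upwards [hsec, h1, hσ.eventually havoid, h2, hs.eventually (by norm_num), h3]
      with z z1 z2 z3 z4 z5 z6 using ⟨z1, z2, z3, z4, z5, z6⟩
  have hnear' := eventually_flow_neg_flow_mem (y₀ := y₀) hΦc.continuous hΦ'c.continuous hz₀ hnear
  have hvz := eventually_apply_flow_neg_flow_eq hΦc.continuous hΦ'c.continuous h.isFlow h'.isFlow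
    h.flow_add hO hv hk heq hcO
  have hV' : ∀ᶠ y in 𝓝 y₀, ∀ t ∈ Icc 0 c, Φ' t y ∈ V :=
    eventually_forall_mem (g := fun q : ℝ × E => Φ' q.1 q.2) hΦ'c.continuous isCompact_Icc
      fun t ht => h.isOpen.mem_nhds (by simpa only [heq t ht] using hOV (hcO t ht))
  have hVa : ∀ᶠ y in 𝓝 y₀, ∀ t ∈ Icc 0 a, Φ t y ∈ V ∩ (tsupport g)ᶜ :=
    eventually_forall_mem (g := fun q : ℝ × E => Φ q.1 q.2) hΦc.continuous isCompact_Icc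
      fun t ht => (h.isOpen.inter (isClosed_tsupport g).isOpen_compl).mem_nhds
        ⟨hOV (hcO t ⟨ht.1, ht.2.trans hac.le⟩), hga t ht⟩
  have hgc' : ∀ᶠ y in 𝓝 y₀, Φ' c y ∉ tsupport g := by
    have h1 : Φ' c y₀ ∈ (tsupport g)ᶜ := by
      rw [heq c ⟨hc0, le_rfl⟩]
      intro h2
      have h3 := h.eq_symm_flow hH (hγ.mono (Icc_subset_Icc_right hcT.le)) hinv.symm
        (fun t ht => hOV (hcO t ht)) c ⟨hc0, le_rfl⟩
      exact hgT c ⟨hc₀.le, hcT.le⟩ ⟨_, h2, h3.symm⟩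
    have h2 : ContinuousAt (Φ' c) y₀ := (hΦ'c.comp (contDiff_prodMk_right c)).continuous.continuousAt
    exact h2.eventually ((isClosed_tsupport g).isOpen_compl.mem_nhds h1)
  have hτa : ∀ᶠ x in 𝓝 (γ 0), x ∈ N → a < τ x :=
    eventually_nhdsWithin_iff.1 (hτcont.eventually (lt_mem_nhds (by rw [hτT]; exact hac.trans hcT)))
  have heC : Tendsto e (𝓝 (γ 0)) (𝓝 y₀) := e.continuousAt hpe
  set Z : M → E := fun x => Φ (-c) (Φ' c (e x)) with hZ
  set R : M → M := fun x => e.symm (Φ (-s (Z x)) (Z x)) with hR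
  have hcc : c ∈ Icc 0 c := ⟨hc0, le_rfl⟩
  -- The new orbit of x follows Φ' up to time c and then the old orbit of R x, delayed by s (Z x):
  -- at old time c + s (Z x) that orbit passes through the point Φ' c. This gives the new transition
  -- time τ (R x) - s (Z x).
  have key : ∀ᶠ x in 𝓝 (γ 0), (x ∈ N → R x ∈ N ∩ U ∧ c < τ (R x) - s (Z x) ∧ P (R x) ∈ N' ∧
      ∃ c' : ℝ → M, IsMIntegralCurveOn c' (π.hamVF fun x => H x + liftFun e g x)
        (Icc 0 (τ (R x) - s (Z x))) ∧ c' 0 = x ∧ c' (τ (R x) - s (Z x)) = P (R x) ∧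
        ∀ t ∈ Ioo 0 (τ (R x) - s (Z x)), c' t ∉ N') ∧
      x ∈ e.source ∧ ContDiffAt ℝ 1 s (Z x) ∧ Φ (-s (Z x)) (Z x) ∈ e.target := by
    filter_upwards [heC.eventually hnear', heC.eventually hvz, heC.eventually hV',
      heC.eventually hVa, heC.eventually hgc', hτa, hU, hvN, e.open_source.mem_nhds hpe]
      with x hx hxv hxV hxa hxg hxτ hxU hxvN hxe
    obtain ⟨hz1, hz2, hz3, hz4, hz5, hz6⟩ := hx c hcc
    refine ⟨fun hxN => ?_, hxe, hz5, hz6⟩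
    have hx0 : Φ 0 (e x) = e x := h.isFlow.zero _
    have hgx : g (e x) = 0 := by
      have := (hxa 0 ⟨le_rfl, ha.le⟩).2
      rw [hx0] at this
      exact image_eq_zero_of_notMem_tsupport this
    have hexV : e x ∈ V := by
      have := (hxa 0 ⟨le_rfl, ha.le⟩).1
      rwa [hx0] at this
    have hfH : ∀ y ∈ V, f y = H (e.symm y) := fun y hy => h.eqOn hy
    have hfy₀ : f y₀ = H (γ 0) := by
      rw [hfH _ (by have := hOV (hcO 0 ⟨le_rfl, hc0⟩); rwa [h.isFlow.zero] at this), hinv]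
    have hfx : f (e x) = f y₀ := by
      rw [hfH _ hexV, e.left_inv hxe, hHN x hxN, hfy₀]
    have hfΦ : ∀ t y, f (Φ t y) = f y := fun t y =>
      hB.apply_flow h.contDiff h.tsupport_subset h.isFlow y t
    have hvx : ∀ t ∈ Icc 0 c, v (Φ (-t) (Φ' t (e x))) = v y₀ := fun t ht =>
      (hxv t ht).trans (hxvN hxN)
    -- Φ' preserves f + g, and g vanishes at both ends of the new orbit piece; Φ preserves f.
    have hfz : f (Z x) = f y₀ := by
      have h1 := hB.apply_flow h'.contDiff h'.tsupport_subset h'.isFlow (e x) c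
      simp only [hgx, image_eq_zero_of_notMem_tsupport hxg, add_zero] at h1
      rw [hZ]
      simp only [hfΦ, h1, hfx]
    have hRN : R x ∈ N := hz1 (hvx c hcc) hfz
    obtain ⟨hRU, hRt⟩ := hz2 hRN
    obtain ⟨-, hRτ, hRorb⟩ := hRt c ⟨hac.le, le_rfl⟩
    obtain ⟨-, hPN', cR, hcR, hcR0, hcRP, hcRfirst⟩ := hτ (R x) ⟨hRN, hRU⟩
    have hRS := hz3 hRN cR hcR hcR0
    have hcτ : c < τ (R x) - s (Z x) := by
      have : c + s (Z x) < τ (R x) := hRτ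
      linarith
    have hglue : cR (c + s (Z x)) = e.symm (Φ' c (e x)) := by
      have := hRorb cR hcR hcR0
      rwa [hback] at this
    refine ⟨⟨hRN, hRU⟩, hcτ, hPN', fun t => if t ≤ c then e.symm (Φ' (t - 0) (e x)) else
      (cR ∘ (· + s (Z x))) t, ?_, ?_, ?_, ?_⟩
    · refine IsMIntegralCurveOn.concat hc0 hcτ.le (h'.isMIntegralCurveOn hH' fun t ht => ?_) ?_ ?_
      · rw [sub_zero]; exact hxV t ht
      · have h1 : IsMIntegralCurveOn (cR ∘ (· + s (Z x))) (π.hamVF H)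
            (Icc c (τ (R x) - s (Z x))) := (hcR.comp_add (s (Z x))).mono fun t ht => by
          have h2 : c₀ - c < s (Z x) := hz4
          have h3 : 0 < c + s (Z x) := (hRt c ⟨hac.le, le_rfl⟩).1
          exact ⟨by linarith [ht.1], by linarith [ht.2]⟩
        intro t ht
        have h2 : π.hamVF (fun x => H x + liftFun e g x) ((cR ∘ (· + s (Z x))) t) =
            π.hamVF H ((cR ∘ (· + s (Z x))) t) := by
          refine PoissonStructure.hamVF_add_liftFun hH h.mem_atlas hg hgc hge fun h3 =>
            absurd h3 ?_
          have h4 : c₀ - c < s (Z x) := hz4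
          have h5 : 0 < c + s (Z x) := (hRt c ⟨hac.le, le_rfl⟩).1
          exact hRS (t + s (Z x)) ⟨by linarith [ht.1], by linarith [ht.2]⟩ (by linarith [ht.1])
        rw [h2]
        exact h1 t ht
      · simp only [sub_zero, Function.comp_apply]
        exact hglue.symm
    · simp only [if_pos hc0, sub_zero, h'.isFlow.zero, e.left_inv hxe]
    · simp only [if_neg (not_le.2 hcτ), Function.comp_apply, sub_add_cancel]
      exact hcRP
    · intro t ht
      by_cases htc : t ≤ c
      · simp only [if_pos htc, sub_zero]
        by_cases hta : t < a
        · obtain ⟨-, -, cx, hcx, hcx0, -, hcxfirst⟩ := hτ x ⟨hxN, hxU⟩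
          have h1 := h.eq_symm_flow hH (hcx.mono (Icc_subset_Icc_right (hxτ hxN).le))
            (by rw [hcx0, e.left_inv hxe]) (fun r hr => (hxa r hr).1) t ⟨ht.1.le, hta.le⟩
          have h2 : Φ' t (e x) = Φ t (e x) :=
            hB.flow_eq_of_fderiv_eq_zero h.contDiff h'.contDiff h'.hasCompactSupport
              h'.tsupport_subset hg (fun _ => rfl) h.isFlow h'.isFlow (c := a) (fun r hr =>
                image_eq_zero_of_notMem_tsupport fun h3 =>
                  (hxa r hr).2 (tsupport_fderiv_subset ℝ h3)) ⟨ht.1.le, hta.le⟩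
          rw [h2, ← h1]
          exact hcxfirst t ⟨ht.1, hta.trans (hxτ hxN)⟩
        -- A visit to N' inside the perturbed region would have the energy of N'. Carrying the point
        -- back by Φ and sliding gives a point of N whose old orbit meets N' before its first
        -- hitting time, a contradiction.
        · intro hmem
          have htI : t ∈ Icc 0 c := ⟨ht.1.le, htc⟩
          obtain ⟨hw1, hw2, -⟩ := hx t htI
          have h1 : f (Φ' t (e x)) = f y₀ := by
            rw [hfH _ (hxV t htI), hHN' _ hmem, hfy₀]
            exact PoissonStructure.apply_eq_of_isMIntegralCurveOn hH hγ ⟨hT.le, le_rfl⟩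
              ⟨le_rfl, hT.le⟩
          have hwN := hw1 (hvx t htI) (by rw [hfΦ, h1])
          obtain ⟨hwU, hw⟩ := hw2 hwN
          obtain ⟨hpos, hlt, horb⟩ := hw t ⟨not_lt.1 hta, htc⟩
          obtain ⟨-, -, cw, hcw, hcw0, -, hcwfirst⟩ := hτ _ ⟨hwN, hwU⟩
          refine hcwfirst _ ⟨hpos, hlt⟩ ?_
          rw [horb cw hcw hcw0, hback]
          exact hmem
      · simp only [if_neg htc, Function.comp_apply]
        have h5 : 0 < c + s (Z x) := (hRt c ⟨hac.le, le_rfl⟩).1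
        exact hcRfirst _ ⟨by linarith, by linarith [ht.2]⟩
  have hZ0 : Z (γ 0) = y₀ := hz₀ c hcc
  have hR0 : R (γ 0) = γ 0 := by
    rw [hR]
    simp only [hZ0, hs0, neg_zero, h.isFlow.zero, hinv]
  refine ⟨key.mono fun x hx hxN => (hx.1 hxN).1.1, ?_, _, key, fun x => τ (R x) - s (Z x), ?_,
    fun x hx => ?_, fun x hx => ?_⟩
  · show P (R (γ 0)) = γ T
    rw [hR0, hPp]
  · show τ (R (γ 0)) - s (Z (γ 0)) = T
    rw [hR0, hZ0, hs0, hτT, sub_zero]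
  · obtain ⟨hxN, hx1, hxe, hxs, hxt⟩ := hx
    have hecd : ContMDiffAt 𝓘(ℝ, E) 𝓘(ℝ, E) 1 e x :=
      (contMDiffOn_of_mem_maximalAtlas he1).contMDiffAt (e.open_source.mem_nhds hxe)
    have hzc : ContDiff ℝ 1 fun y => Φ (-c) (Φ' c y) :=
      (hΦc.comp (contDiff_prodMk_right (-c))).comp (hΦ'c.comp (contDiff_prodMk_right c))
    have hZc : ContMDiffAt 𝓘(ℝ, E) 𝓘(ℝ, E) 1 Z x := hzc.contMDiff.contMDiffAt.comp x hecd
    have hsZ : ContMDiffAt 𝓘(ℝ, E) 𝓘(ℝ, ℝ) 1 (fun x => s (Z x)) x :=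
      ContMDiffAt.comp x hxs.contMDiffAt hZc
    have hρc : ContDiffAt ℝ 1 (fun z => Φ (-s z) z) (Z x) :=
      hΦc.contDiffAt.comp (f := fun z => (-s z, z)) (Z x) (hxs.neg.prodMk contDiffAt_id)
    have hRc : ContMDiffAt 𝓘(ℝ, E) 𝓘(ℝ, E) 1 R x :=
      ContMDiffAt.comp x ((contMDiffOn_symm_of_mem_maximalAtlas he1).contMDiffAt
        (e.open_target.mem_nhds hxt)) (ContMDiffAt.comp x hρc.contMDiffAt hZc)
    refine ContMDiffWithinAt.sub ?_ hsZ.contMDiffWithinAt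
    exact (hτC (R x) (hx1 hxN).1).comp x hRc.contMDiffWithinAt fun y hy => (hy.2.1 hy.1).1
  · obtain ⟨hxN, hx1, -⟩ := hx
    obtain ⟨-, hcτ, hPN, c', hc'⟩ := hx1 hxN
    exact ⟨hc0.trans_lt hcτ, hPN, c', hc'⟩

end PerturbedMap

/-! ### Assembly of the proof. -/

section Main

open Filter

variable {E : Type*} [NormedAddCommGroup E] [NormedSpace ℝ E] [FiniteDimensional ℝ E]
  {M : Type*} [TopologicalSpace M] [ChartedSpace E M] [T2Space M] [IsManifold 𝓘(ℝ, E) ∞ M]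
  {π : PoissonStructure E M} {H : M → ℝ}

/-- The orbit between the two transversals meets the second transversal only at its endpoint. -/
lemma IsPoincareMap.notMem_of_mem_Ioo (hH : ContMDiff 𝓘(ℝ, E) 𝓘(ℝ, ℝ) 2 H) {T : ℝ} {γ : ℝ → M}
    (hγ : IsMIntegralCurveOn γ (π.hamVF H) (Icc 0 T)) {N N' : Set M} (hpN : γ 0 ∈ N)
    {P : M → M} {p' : M} (hP : IsPoincareMap π H N N' (γ 0) p' T P) :
    ∀ t ∈ Ioo 0 T, γ t ∉ N' := by
  obtain ⟨-, U, hU, τ, hτT, -, hτ⟩ := hP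
  obtain ⟨-, -, c, hc, hc0, -, hfirst⟩ := hτ _ ⟨hpN, mem_of_mem_nhds hU⟩
  rw [hτT] at hc hfirst
  intro t ht
  rw [← PoissonStructure.eqOn_of_isMIntegralCurveOn hH hc hγ hc0 ⟨ht.1.le, ht.2.le⟩]
  exact hfirst t ht

/-- The derivative of a Poincaré map composed with a return map. -/
lemma IsDerivMatrix.comp_return {d : ℕ} {p p' : M} {N : Set M} {P : M → M}
    (hPp : P p = p')
    {b b' : Fin d ⊕ Fin d → E} {D : E →L[ℝ] E} (hD : HasMFDerivWithinAt 𝓘(ℝ, E) 𝓘(ℝ, E) P N p D)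
    {L A Q : SqMatrix d} (hDb : ∀ j, D (b j) = ∑ i, L i j • b' i)
    {e : OpenPartialHomeomorph M E} (he : e ∈ IsManifold.maximalAtlas 𝓘(ℝ, E) ∞ M)
    (hpe : p ∈ e.source) {r : E → E} (hr0 : r (e p) = e p) {D₀ : E →L[ℝ] E}
    (hr : HasFDerivAt r D₀ (e p))
    (hD₀ : ∀ k, D₀ (chartDeriv e p (b k)) = ∑ j, Q j k • chartDeriv e p (b j))
    (hrN : ∀ᶠ x in 𝓝 p, x ∈ N → e.symm (r (e x)) ∈ N) (hLQ : L * Q = A * L) :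
    IsDerivMatrix (E := E) (p := p) (p' := p') N (fun x => P (e.symm (r (e x)))) b b' (A * L) := by
  have := isManifold_one (E := E) (M := M)
  have he1 := mem_maximalAtlas_one he
  have hR0 : e.symm (r (e p)) = p := by rw [hr0, e.left_inv hpe]
  set R : M → M := fun x => e.symm (r (e x)) with hR
  let DR : E →L[ℝ] E := (chartDerivSymm e (e p)).comp (D₀.comp (chartDeriv e p))
  have h1 : HasMFDerivAt 𝓘(ℝ, E) 𝓘(ℝ, E) R p DR := by
    have h2 : HasMFDerivAt 𝓘(ℝ, E) 𝓘(ℝ, E) e.symm (r (e p)) (chartDerivSymm (E := E) e (e p)) := by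
      rw [hr0]; exact hasMFDerivAt_chart_symm he1 (e.map_source hpe)
    exact h2.comp p (hr.hasMFDerivAt.comp p (hasMFDerivAt_chart he1 hpe))
  have hDR : ∀ k, DR (b k) = ∑ j, Q j k • b j := fun k => by
    show chartDerivSymm e (e p) (D₀ (chartDeriv e p (b k))) = _
    rw [hD₀, map_sum]
    exact Finset.sum_congr rfl fun j _ => by rw [map_smul, chartDerivSymm_apply he1 hpe]
  have hD' : HasMFDerivWithinAt 𝓘(ℝ, E) 𝓘(ℝ, E) P N (R p) D := by
    rw [show R p = p from hR0]; exact hD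
  have h2 : HasMFDerivWithinAt 𝓘(ℝ, E) 𝓘(ℝ, E) (P ∘ R) (N ∩ {x | x ∈ N → R x ∈ N}) p
      (D.comp DR) := HasMFDerivWithinAt.comp p hD' h1.hasMFDerivWithinAt fun x hx => hx.2 hx.1
  refine ⟨?_, D.comp DR, (hasMFDerivWithinAt_inter hrN).1 h2, fun j => ?_⟩
  · show P (R p) = p'
    rw [show R p = p from hR0, hPp]
  · show D (DR (b j)) = ∑ i, (A * L) i j • b' i
    rw [hDR, map_sum, ← hLQ]
    simp only [map_smul, hDb, Matrix.mul_apply, Finset.smul_sum, Finset.sum_smul, smul_smul]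
    rw [Finset.sum_comm]
    exact Finset.sum_congr rfl fun i _ => Finset.sum_congr rfl fun k _ => by rw [mul_comm]

variable [SecondCountableTopology M]

/-- Franks' lemma for Hamiltonian flows on regular Poisson manifolds. -/
theorem exists_perturbed_isPoincareMap {d : ℕ} (hπ : π.IsRegular (d + 1)) (𝔄 : NormAtlas E M)
    (hH : ContMDiff 𝓘(ℝ, E) 𝓘(ℝ, ℝ) 2 H) {T : ℝ} (hT : 0 < T) {γ : ℝ → M}
    (hγ : IsMIntegralCurveOn γ (π.hamVF H) (Icc 0 T)) {N N' : Set M}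
    (hN : IsTransversal π H d N (γ 0)) (hN' : IsTransversal π H d N' (γ T)) {P : M → M}
    (hP : IsPoincareMap π H N N' (γ 0) (γ T) T P) {b b' : Fin d ⊕ Fin d → E}
    (hb : IsSymplecticBasis π N (γ 0) b) (hb' : IsSymplecticBasis π N' (γ T) b') :
    ∃ L : SqMatrix d,
      IsDerivMatrix (E := E) (p := γ 0) (p' := γ T) N P b b' L ∧
      ∀ ε : ℝ, 0 < ε → ∃ δ : ℝ, 0 < δ ∧ ∀ W : Set M, (∀ t ∈ Ioo 0 T, W ∈ 𝓝 (γ t)) →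
        ∀ A ∈ Matrix.symplecticGroup (Fin d) ℝ, (∀ j, ∑ i, |(A - 1) i j| < δ) →
        ∃ H' : M → ℝ, ContMDiff 𝓘(ℝ, E) 𝓘(ℝ, ℝ) 2 H' ∧
          𝔄.c2norm (fun x => H' x - H x) < ENNReal.ofReal ε ∧
          (∀ x ∈ Wᶜ ∪ γ '' Icc 0 T, π.hamVF H' x = π.hamVF H x) ∧
          ∃ P' : M → M, IsPoincareMap π H' N N' (γ 0) (γ T) T P' ∧
            IsDerivMatrix (E := E) (p := γ 0) (p' := γ T) N P' b b' (A * L) := by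
  have := isManifold_one (E := E) (M := M)
  obtain ⟨L, D, hL, hD, hDb⟩ := hP.exists_isDerivMatrix hH hT hγ hN hN' hb hb'
  refine ⟨L, ⟨hP.1, D, hD, hDb⟩, fun ε hε => ?_⟩
  -- a chart at the starting point
  set e := chartAt E (γ 0) with he_def
  have he : e ∈ IsManifold.maximalAtlas 𝓘(ℝ, E) ∞ M := IsManifold.chart_mem_maximalAtlas _
  have hpe : γ 0 ∈ e.source := mem_chart_source E (γ 0)
  have he1 := mem_maximalAtlas_one he
  obtain ⟨f, V, Φ, h, hpV⟩ := π.exists_chartFlow hH he hpe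
  have hham := hN.hamE_ne_zero hπ hb
  obtain ⟨O, v, s, hO, hpO, hOV, hv, hk, hs, hs0, hvN, hsec, hsd⟩ :=
    hN.exists_section hH hπ hham h hpe hpV
  have hB := h.isLocalPoisson
  have hpt := e.map_source hpe
  have hX0 : hamField (π.tensor e) f (e (γ 0)) = chartDeriv e (γ 0) (π.hamE H (γ 0)) :=
    h.hamField_eq hH hpe hpV
  obtain ⟨ξ, hξ, hξJ⟩ := hb.exists_covectors
  obtain ⟨α, β, c, hα, hαβ, hβc, hcT, hcO, Z, hZ, hZO, hpert⟩ :=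
    hB.exists_perturbation h.contDiff h.hasCompactSupport h.tsupport_subset h.isFlow hpt
      (by
        rw [hX0]
        exact fun h0 => hham (chartDeriv_injective he1 hpe (by rw [h0, map_zero])))
      (b := fun i => chartDeriv e (γ 0) (b i))
      (ξ := fun i => (ξ i).comp (chartDerivSymm e (e (γ 0))))
      (fun i => by
        have h1 : ((ξ i).comp (chartDerivSymm e (e (γ 0)))).comp (chartDeriv e (γ 0)) = ξ i := by
          ext u
          exact congrArg (ξ i) (chartDerivSymm_apply he1 hpe u)
        rw [π.tensor_apply hpe, h1, hξ])
      (fun i j => (congrArg (ξ i) (chartDerivSymm_apply he1 hpe (b j))).trans (hξJ i j))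
      (fun i => by
        rw [hX0]
        exact (congrArg (ξ i) (chartDerivSymm_apply he1 hpe _)).trans
          (hN.apply_hamE (by rw [hξ]; exact hb.mem i))) hO hpO hT
  have hOe : O ⊆ e.target := hOV.trans h.subset
  have hZe : Z ⊆ e.target := hZO.trans hOe
  obtain ⟨C, hC0, hC⟩ := 𝔄.exists_c2norm_liftFun_le he hZ hZe
  -- C converts chart bounds into the global norm, so the perturbation has norm at most C ε / (2 (C
  -- + 1)) < ε. Since δ is fixed here, before W, it cannot depend on W.
  obtain ⟨δ, hδ, hpert⟩ := hpert L hL (ε / (2 * (C + 1))) (by positivity)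
  refine ⟨δ, hδ, fun W hW A hA hAδ => ?_⟩
  have hc0 : 0 < c := by linarith
  have horb : ∀ t ∈ Icc 0 c, γ t = e.symm (Φ t (e (γ 0))) :=
    h.eq_symm_flow hH (hγ.mono (Icc_subset_Icc_right hcT.le)) (e.left_inv hpe).symm
      fun t ht => hOV (hcO t ht)
  have hγc : ContinuousOn γ (Icc 0 T) := fun t ht => (hγ t ht).continuousWithinAt
  have hne := fun s t => PoissonStructure.ne_of_first_hit hH hγ hN'.mem
    (hP.notMem_of_mem_Ioo hH hγ hN.mem) (s := s) (t := t)
  -- the region of the perturbation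
  set F₁ := γ '' Icc 0 (α / 2) with hF₁
  set F₂ := γ '' Icc ((β + c) / 2) T with hF₂
  have hF₁c : IsClosed F₁ := (isCompact_Icc.image_of_continuousOn
    (hγc.mono (Icc_subset_Icc_right (by linarith)))).isClosed
  have hF₂c : IsClosed F₂ := (isCompact_Icc.image_of_continuousOn
    (hγc.mono (Icc_subset_Icc_left (by linarith)))).isClosed
  set G : Set E := e.target ∩ e.symm ⁻¹' (interior W ∩ (F₁ᶜ ∩ F₂ᶜ)) with hG
  have hGo : IsOpen G := e.isOpen_inter_preimage_symm
    (isOpen_interior.inter (hF₁c.isOpen_compl.inter hF₂c.isOpen_compl))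
  -- The arc must be disjoint from the rest of the orbit for the perturbation to leave that part
  -- alone; this holds because the orbit does not cross itself before first reaching N'.
  have hGarc : (fun t => Φ t (e (γ 0))) '' Icc α β ⊆ G := by
    rintro _ ⟨t, ht, rfl⟩
    have htc : t ∈ Icc 0 c := ⟨hα.le.trans ht.1, ht.2.trans hβc.le⟩
    have htT : t ∈ Ioo 0 T := ⟨hα.trans_le ht.1, htc.2.trans_lt hcT⟩
    refine ⟨hOe (hcO t htc), ?_⟩
    rw [mem_preimage, ← horb t htc]
    refine ⟨mem_interior_iff_mem_nhds.2 (hW t htT), ?_, ?_⟩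
    · rintro ⟨r, hr, hrt⟩
      exact hne t r htT ⟨hr.1, by linarith [hr.2]⟩ (by linarith [hr.2, ht.1] : r < t).ne' hrt.symm
    · rintro ⟨r, hr, hrt⟩
      exact hne t r htT ⟨by linarith [hr.1], hr.2⟩ (by linarith [hr.1, ht.2] : t < r).ne hrt.symm
  obtain ⟨g, hg, hgs, hgε, hdg, hflow⟩ := hpert A hA hAδ G hGo hGarc
  have hge : tsupport g ⊆ e.target := fun x hx => hZe (hgs hx).2
  have hgc : HasCompactSupport g := hZ.of_isClosed_subset (isClosed_tsupport g)
    fun x hx => (hgs hx).2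
  obtain ⟨Φ', hΦ'⟩ := hB.exists_flow (h.contDiff.add hg) (h.hasCompactSupport.add hgc)
    ((tsupport_add f g).trans (union_subset h.tsupport_subset hge))
  obtain ⟨Q, hLQ, hQ⟩ := hflow Φ' hΦ'
  have h' := h.add hg hgc hge hΦ'
  have hgS : ∀ x ∈ e.symm '' tsupport g, x ∈ W ∧ x ∉ F₁ ∧ x ∉ F₂ := by
    rintro _ ⟨y, hy, rfl⟩
    have := (hgs hy).1.2
    exact ⟨interior_subset this.1, this.2.1, this.2.2⟩
  have hcc : c ∈ Icc 0 c := ⟨hc0.le, le_rfl⟩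
  have heq : Φ' c (e (γ 0)) = Φ c (e (γ 0)) :=
    hB.flow_eq_of_fderiv_eq_zero h.contDiff h'.contDiff h'.hasCompactSupport h'.tsupport_subset hg
      (fun _ => rfl) h.isFlow h'.isFlow hdg hcc
  have hret := hP.comp_return hH hT hγ hN.mem
    (fun x hx => eq_of_mem_energySurface (hN.subset hx).1)
    (fun x hx => eq_of_mem_energySurface (hN'.subset hx).1) h hpe hO hOV hv hk hs hs0 hvN hsec
    hg hgc hge hΦ' (a := α / 2) (c₀ := (β + c) / 2) (c := c) (by linarith) (by linarith)
    (by linarith) hcT hcO hdg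
    (fun t ht hmem => (hgS (γ t) ⟨_, hmem, (horb t ⟨ht.1, by linarith [ht.2]⟩).symm⟩).2.1
      ⟨t, ht, rfl⟩)
    (fun t ht hmem => (hgS (γ t) hmem).2.2 ⟨t, ht, rfl⟩)
  obtain ⟨D₀, hD₀, hr⟩ := hB.hasFDerivAt_return h.contDiff h.hasCompactSupport h.tsupport_subset
    h.isFlow h'.contDiff_flow (h.hasFDerivAt_flow (e (γ 0))) heq hs hs0
    (b := fun i => chartDeriv e (γ 0) (b i)) (fun i => hsd _ (hb.mem i)) hQ
  refine ⟨fun x => H x + liftFun e g x, contMDiff_add_liftFun hH he hg hgc hge, ?_, ?_, _, hret.2,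
    IsDerivMatrix.comp_return hP.1 hD hDb he hpe
      (r := fun y => Φ (-s (Φ (-c) (Φ' c y))) (Φ (-c) (Φ' c y))) ?_ hr hD₀ hret.1 hLQ⟩
  · simp only [add_sub_cancel_left]
    refine (hC g hg (fun x hx => (hgs hx).2) _ hgε).trans_lt ?_
    rw [ENNReal.ofReal_lt_ofReal_iff hε, ← mul_div_assoc, div_lt_iff₀ (by positivity)]
    nlinarith
  -- Off W the perturbation vanishes nearby or has zero differential. A point of Γ in its support
  -- can only be on the arc with time in (α / 2, (β + c) / 2), where dg = 0.
  · rintro x hx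
    refine PoissonStructure.hamVF_add_liftFun hH he hg hgc hge fun hxS => ?_
    obtain ⟨hxW, hx1, hx2⟩ := hgS x hxS
    rcases hx with hx | ⟨t, ht, rfl⟩
    · exact absurd hxW hx
    · have h1 : α / 2 < t := by
        by_contra hlt
        exact hx1 ⟨t, ⟨ht.1, not_lt.1 hlt⟩, rfl⟩
      have h2 : t < (β + c) / 2 := by
        by_contra hlt
        exact hx2 ⟨t, ⟨not_lt.1 hlt, ht.2⟩, rfl⟩
      have htc : t ∈ Icc 0 c := ⟨ht.1, by linarith⟩
      rw [horb t htc, e.right_inv (hOe (hcO t htc))]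
      exact hdg t htc
  · have hz0 : Φ (-c) (Φ' c (e (γ 0))) = e (γ 0) := by
      rw [heq, ← h.flow_add, neg_add_cancel, h.isFlow.zero]
    simp only [hz0, hs0, neg_zero, h.isFlow.zero]

end Main

end FranksPoisson

end

theorem theorem2 (d n : ℕ) {M : Type*} [TopologicalSpace M] [T2Space M]
    [SecondCountableTopology M]
    [ChartedSpace (EuclideanSpace ℝ (Fin (2 * (d + 1) + n))) M]
    [IsManifold 𝓘(ℝ, EuclideanSpace ℝ (Fin (2 * (d + 1) + n))) ∞ M]
    (π : FranksPoisson.PoissonStructure (EuclideanSpace ℝ (Fin (2 * (d + 1) + n))) M)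
    (hπ : π.IsRegular (d + 1))
    (𝔄 : FranksPoisson.NormAtlas (EuclideanSpace ℝ (Fin (2 * (d + 1) + n))) M)
    (H : M → ℝ)
    (hH : ContMDiff 𝓘(ℝ, EuclideanSpace ℝ (Fin (2 * (d + 1) + n))) 𝓘(ℝ, ℝ) 2 H)
    (T : ℝ) (hT : 0 < T) (γ : ℝ → M)
    (hγ : IsMIntegralCurveOn (I := 𝓘(ℝ, EuclideanSpace ℝ (Fin (2 * (d + 1) + n)))) γ
      (π.hamVF H) (Icc 0 T))
    (N N' : Set M)
    (hN : FranksPoisson.IsTransversal π H d N (γ 0))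
    (hN' : FranksPoisson.IsTransversal π H d N' (γ T))
    (P : M → M) (hP : FranksPoisson.IsPoincareMap π H N N' (γ 0) (γ T) T P)
    (b : Fin d ⊕ Fin d →
      TangentSpace 𝓘(ℝ, EuclideanSpace ℝ (Fin (2 * (d + 1) + n))) (γ 0))
    (hb : FranksPoisson.IsSymplecticBasis π N (γ 0) b)
    (b' : Fin d ⊕ Fin d →
      TangentSpace 𝓘(ℝ, EuclideanSpace ℝ (Fin (2 * (d + 1) + n))) (γ T))
    (hb' : FranksPoisson.IsSymplecticBasis π N' (γ T) b') :
    ∃ L : Matrix (Fin d ⊕ Fin d) (Fin d ⊕ Fin d) ℝ,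
      FranksPoisson.IsDerivMatrix N P b b' L ∧
      ∀ ε : ℝ, 0 < ε → ∃ δ : ℝ, 0 < δ ∧
        ∀ W : Set M, (∀ t ∈ Ioo 0 T, W ∈ 𝓝 (γ t)) →
        ∀ A ∈ Matrix.symplecticGroup (Fin d) ℝ, (∀ j, ∑ i, |(A - 1) i j| < δ) →
        ∃ H' : M → ℝ,
          ContMDiff 𝓘(ℝ, EuclideanSpace ℝ (Fin (2 * (d + 1) + n))) 𝓘(ℝ, ℝ) 2 H' ∧
          𝔄.c2norm (fun x => H' x - H x) < ENNReal.ofReal ε ∧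
          (∀ x ∈ Wᶜ ∪ γ '' Icc 0 T, π.hamVF H' x = π.hamVF H x) ∧
          ∃ P' : M → M,
            FranksPoisson.IsPoincareMap π H' N N' (γ 0) (γ T) T P' ∧
            FranksPoisson.IsDerivMatrix N P' b b' (A * L) := by
  exact FranksPoisson.exists_perturbed_isPoincareMap hπ 𝔄 hH hT hγ hN hN' hP hb hb'
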